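/- Let $M$ be a compact (Hausdorff) smooth finite-dimensional manifold, possibly with boundary or corners, and let $\mathcal A,\mathcal B$ be unital $C^*$-algebras. Conventions. For a unital $*$-algebra $\mathcal C$ with a (not necessarily complete) $C^*$-norm, a $*$-derivation $\delta:\mathcal C\to\mathcal C$ (so $\delta(x^*)=\delta(x)^*$) is closable if $x_n\to 0$ and $\delta(x_n)\to y$ in the $C^*$-completion imply $y=0$. $\mathcal C$ with a given topology is a *nice algebra* if it is a Fréchet $*$-algebra (Hausdorff, complete, topology given by countably many seminorms, multiplication jointly continuous, involution continuous) whose topology is the one defined by the seminorms $\|\delta_1\cdots\delta_k(x)\|$, $k\ge 0$, over all closable $*$-derivations $\delta_1,\dots,\delta_k$ of $\mathcal C$. The *nice-algebra tensor product* $\mathcal C\hat\otimes\mathcal D$ is the completion of the algebraic tensor product $\mathcal C\otimes\mathcal D$ in the topology defined by the seminorms $\|\tilde\delta_1\cdots\tilde\delta_k\tilde\eta_1\cdots\tilde\eta_l(X)\|_{\min}$, where $\tilde\delta=\delta\otimes\mathrm{id}$, $\tilde\eta=\mathrm{id}\otimes\eta$, the $\delta_i$ and $\eta_j$ are closable $*$-derivations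 of $\mathcal C$ and $\mathcal D$, and $\|\cdot\|_{\min}$ is the minimal $C^*$-norm. $\mathcal A\hat\otimes\mathcal B$ denotes the minimal $C^*$-tensor product. For a $C^*$-algebra $\mathcal Q$, $C^\infty(M,\mathcal Q)$ is the $*$-algebra of smooth functions $M\to\mathcal Q$ with the sup norm as its $C^*$-norm and with its usual topology of uniform convergence of all derivatives on compact subsets of coordinate neighbourhoods. Then: 1. $C^\infty(M,\mathcal A)$ and $C^\infty(M,\mathcal A\hat\otimes\mathcal B)$ are nice algebras. 2. There is an isomorphism of Fréchet $*$-algebras (a $*$-isomorphism and homeomorphism) $$\Phi: C^\infty(M,\mathcal A)\hat\otimes\mathcal B\;\cong\; C^\infty(M,\mathcal A\hat\otimes\mathcal B),\qquad \Phi(F\otimes b)(m)=F(m)\otimes b,$$ where the left-hand side is the nice-algebra tensor product. 3. If $f\in C(M,\mathcal B)$ and $\varphi\circ f\in C^\infty(M)$ for every bounded linear functional $\varphi$ on $\mathcal B$, then $f\in C^\infty(M,\mathcal B)$. Likewise, if $F\in C(M,\mathcal A\hat\otimes\mathcal B)$ and $\varphi\circ F\in C^\infty(M)$ for every bounded linear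 functional $\varphi$ on $\mathcal A\hat\otimes\mathcal B$, then $F\in C^\infty(M,\mathcal A\hat\otimes\mathcal B)$. -/

import Mathlib

open Set Filter Topology
open scoped Manifold ContDiff TensorProduct InnerProductSpace

noncomputable section

namespace NiceAlg

universe u v w

/-! ### Pre-C*-algebras, closable derivations, nice algebras -/

/-- A unital complex `*`-algebra together with a C*-norm, not assumed complete. -/
class PreCStarAlgebra (A : Type u) extends NormedRing A, StarRing A, CStarRing A,
    NormedAlgebra ℂ A, StarModule ℂ A

instance (priority := 90) preCStarOfCStar (A : Type u) [CStarAlgebra A] : PreCStarAlgebra A where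

/-- A `*`-subalgebra of a C*-algebra, with the restricted norm. -/
instance (priority := 80) preCStarOfSubalgebra {A : Type u} [CStarAlgebra A]
    (S : StarSubalgebra ℂ A) : PreCStarAlgebra S where
  norm_mul_self_le x := CStarRing.norm_star_mul_self (x := (x : A)) |>.symm.le

/-- A `*`-derivation of a pre-C*-algebra into itself which is closable for the C*-norm: if
`x n → 0` and `δ (x n)` converges in the C*-completion (that is, is a Cauchy sequence), then its
limit is `0`. -/
structure ClosableStarDerivation (A : Type u) [PreCStarAlgebra A] extends A →ₗ[ℂ] A where
  leibniz' : ∀ x y : A, toFun (x * y) = toFun x * y + x * toFun y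
  star' : ∀ x : A, toFun (star x) = star (toFun x)
  closable' : ∀ x : ℕ → A, Tendsto x atTop (𝓝 0) → CauchySeq (fun n => toFun (x n)) →
    Tendsto (fun n => toFun (x n)) atTop (𝓝 0)

/-- The composition `δ₁ ∘ ⋯ ∘ δₖ` for the multi-index `[δ₁, …, δₖ]` (the identity for `[]`). -/
def iterDer {A : Type u} [PreCStarAlgebra A] (l : List (ClosableStarDerivation A)) : A →ₗ[ℂ] A :=
  l.foldr (fun δ T => δ.toLinearMap ∘ₗ T) LinearMap.id

/-- The seminorms `x ↦ ‖δ₁ ⋯ δₖ x‖`, over all multi-indices of closable `*`-derivations. -/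
def derSeminorm (A : Type u) [PreCStarAlgebra A] :
    SeminormFamily ℂ A (List (ClosableStarDerivation A)) :=
  fun l => (normSeminorm ℂ A).comp (iterDer l)

/-- The topology `τ` makes the `*`-algebra `A` a Fréchet `*`-algebra: it is Hausdorff, given by
countably many seminorms, complete (every Cauchy sequence converges), the multiplication is
jointly continuous and the involution is continuous. -/
structure IsFrechetStarAlgebra (A : Type u) [Ring A] [Algebra ℂ A] [StarRing A]
    (τ : TopologicalSpace A) : Prop where
  t2 : T2Space A
  countable_seminorms : ∃ p : SeminormFamily ℂ A ℕ, WithSeminorms p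
  complete : ∀ x : ℕ → A, (∀ U ∈ 𝓝 (0 : A), ∃ N, ∀ m ≥ N, ∀ n ≥ N, x m - x n ∈ U) →
    ∃ a, Tendsto x atTop (𝓝 a)
  continuous_mul : Continuous fun z : A × A => z.1 * z.2
  continuous_star : Continuous fun a : A => star a

/-- With the topology `τ` (and its C*-norm) `A` is a nice algebra: a unital Fréchet `*`-algebra
whose topology is the one given by the C*-norm and all closable `*`-derivations. -/
structure IsNice (A : Type u) [PreCStarAlgebra A] (τ : TopologicalSpace A) : Prop where
  frechet : IsFrechetStarAlgebra A τ
  topology_eq : WithSeminorms (topology := τ) (derSeminorm A)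

/-! ### The minimal C*-norm on the algebraic tensor product -/

/-- A contractive unital `*`-representation on a Hilbert space, i.e. the restriction of a
representation of the C*-completion. -/
structure HilbertRep (A : Type u) [PreCStarAlgebra A] where
  H : Type u
  [normed : NormedAddCommGroup H]
  [inner : InnerProductSpace ℂ H]
  [complete : CompleteSpace H]
  π : A →⋆ₐ[ℂ] (H →L[ℂ] H)
  contractive : ∀ a, ‖π a‖ ≤ ‖a‖

attribute [instance] HilbertRep.normed HilbertRep.inner HilbertRep.complete

variable {A : Type u} {B : Type v} [PreCStarAlgebra A] [PreCStarAlgebra B]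

/-- The representation `π ⊗ ρ` of `A ⊗ B`, acting by bounded operators on the algebraic tensor
product `H ⊗ K` with its Hilbert tensor product inner product (the operator norms on it and on
its completion agree). -/
def tensorRep (π : HilbertRep A) (ρ : HilbertRep B) :
    A ⊗[ℂ] B →ₐ[ℂ] ((π.H ⊗[ℂ] ρ.H) →L[ℂ] (π.H ⊗[ℂ] ρ.H)) :=
  Algebra.TensorProduct.lift
    (AlgHom.ofLinearMap
      { toFun := fun a => (π.π a).rTensor ρ.H
        map_add' := fun a b => by simp
        map_smul' := fun c a => by simp }
      (by simp) (fun a b => by simp [ContinuousLinearMap.rTensor_mul]))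
    (AlgHom.ofLinearMap
      { toFun := fun b => (ρ.π b).lTensor π.H
        map_add' := fun a b => by simp
        map_smul' := fun c a => by simp }
      (by simp) (fun a b => by simp [ContinuousLinearMap.lTensor_mul]))
    (fun a b => by
      ext x
      simp only [AlgHom.ofLinearMap_apply, LinearMap.coe_mk, AddHom.coe_mk,
        mul_apply_eq_comp]
      induction x with
      | zero => simp
      | add x y hx hy => simp_all
      | tmul h k => simp)

theorem tensorRep_tmul (π : HilbertRep A) (ρ : HilbertRep B) (a : A) (b : B) :
    tensorRep π ρ (a ⊗ₜ[ℂ] b) = (π.π a).rTensor ρ.H * (ρ.π b).lTensor π.H :=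
  Algebra.TensorProduct.lift_tmul _ _ _ a b

/-- The operator norm `‖(π ⊗ ρ)(X)‖`. -/
def repNorm (π : HilbertRep A) (ρ : HilbertRep B) (X : A ⊗[ℂ] B) : ℝ := ‖tensorRep π ρ X‖

theorem repNorm_nonneg (π : HilbertRep A) (ρ : HilbertRep B) (X : A ⊗[ℂ] B) :
    0 ≤ repNorm π ρ X := ContinuousLinearMap.opNorm_nonneg _

theorem repNorm_add_le (π : HilbertRep A) (ρ : HilbertRep B) (X Y : A ⊗[ℂ] B) :
    repNorm π ρ (X + Y) ≤ repNorm π ρ X + repNorm π ρ Y := by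
  unfold repNorm
  rw [map_add]
  exact ContinuousLinearMap.opNorm_add_le _ _

theorem repNorm_smul_le (π : HilbertRep A) (ρ : HilbertRep B) (c : ℂ) (X : A ⊗[ℂ] B) :
    repNorm π ρ (c • X) ≤ ‖c‖ * repNorm π ρ X := by
  unfold repNorm
  rw [map_smul]
  exact ContinuousLinearMap.opNorm_smul_le _ _

theorem repNorm_mul_le (π : HilbertRep A) (ρ : HilbertRep B) (X Y : A ⊗[ℂ] B) :
    repNorm π ρ (X * Y) ≤ repNorm π ρ X * repNorm π ρ Y := by
  unfold repNorm
  rw [map_mul]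
  exact ContinuousLinearMap.opNorm_comp_le _ _

theorem repNorm_tmul_le (π : HilbertRep A) (ρ : HilbertRep B) (a : A) (b : B) :
    repNorm π ρ (a ⊗ₜ[ℂ] b) ≤ ‖a‖ * ‖b‖ := by
  unfold repNorm
  rw [tensorRep_tmul]
  refine (ContinuousLinearMap.opNorm_comp_le _ _).trans (mul_le_mul ?_ ?_
    (ContinuousLinearMap.opNorm_nonneg _) (norm_nonneg _))
  · exact (ContinuousLinearMap.norm_rTensor_le _ _).trans (π.contractive a)
  · exact (ContinuousLinearMap.norm_lTensor_le _ _).trans (ρ.contractive b)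

theorem repNorm_bound (X : A ⊗[ℂ] B) :
    ∃ C : ℝ, ∀ (π : HilbertRep A) (ρ : HilbertRep B), repNorm π ρ X ≤ C := by
  induction X with
  | zero => exact ⟨0, fun π ρ => by simpa using repNorm_smul_le π ρ 0 0⟩
  | add X Y hX hY =>
    obtain ⟨C, hC⟩ := hX
    obtain ⟨D, hD⟩ := hY
    exact ⟨C + D, fun π ρ => (repNorm_add_le π ρ X Y).trans (add_le_add (hC π ρ) (hD π ρ))⟩
  | tmul a b => exact ⟨‖a‖ * ‖b‖, fun π ρ => repNorm_tmul_le π ρ a b⟩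

/-- The minimal (spatial, "injective") C*-norm on `A ⊗ B`: the supremum of `‖(π ⊗ ρ)(X)‖` over
the representations `π` of `A` and `ρ` of `B`. -/
def minNorm (X : A ⊗[ℂ] B) : ℝ :=
  ⨆ p : HilbertRep A × HilbertRep B, repNorm p.1 p.2 X

theorem le_minNorm (X : A ⊗[ℂ] B) (π : HilbertRep A) (ρ : HilbertRep B) :
    repNorm π ρ X ≤ minNorm X := by
  obtain ⟨C, hC⟩ := repNorm_bound X
  exact le_ciSup (f := fun p : HilbertRep A × HilbertRep B => repNorm p.1 p.2 X)
    ⟨C, by rintro _ ⟨p, rfl⟩; exact hC p.1 p.2⟩ (π, ρ)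

theorem minNorm_nonneg (X : A ⊗[ℂ] B) : 0 ≤ minNorm X :=
  Real.iSup_nonneg fun p => repNorm_nonneg p.1 p.2 X

theorem minNorm_le {X : A ⊗[ℂ] B} {C : ℝ} (hC : 0 ≤ C)
    (h : ∀ (π : HilbertRep A) (ρ : HilbertRep B), repNorm π ρ X ≤ C) : minNorm X ≤ C :=
  Real.iSup_le (fun p => h p.1 p.2) hC

theorem minNorm_mul_le (X Y : A ⊗[ℂ] B) : minNorm (X * Y) ≤ minNorm X * minNorm Y :=
  minNorm_le (mul_nonneg (minNorm_nonneg X) (minNorm_nonneg Y)) fun π ρ =>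
    (repNorm_mul_le π ρ X Y).trans (mul_le_mul (le_minNorm X π ρ) (le_minNorm Y π ρ)
      (repNorm_nonneg π ρ Y) (minNorm_nonneg X))

/-- The minimal norm as a seminorm. -/
def minSeminorm (A : Type u) (B : Type v) [PreCStarAlgebra A] [PreCStarAlgebra B] :
    Seminorm ℂ (A ⊗[ℂ] B) :=
  Seminorm.ofSMulLE minNorm
    (le_antisymm (minNorm_le le_rfl fun π ρ => by simpa using repNorm_smul_le π ρ 0 0)
      (minNorm_nonneg 0))
    (fun X Y => minNorm_le (add_nonneg (minNorm_nonneg X) (minNorm_nonneg Y)) fun π ρ =>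
      (repNorm_add_le π ρ X Y).trans (add_le_add (le_minNorm X π ρ) (le_minNorm Y π ρ)))
    (fun c X => minNorm_le (mul_nonneg (norm_nonneg c) (minNorm_nonneg X)) fun π ρ =>
      (repNorm_smul_le π ρ c X).trans
        (mul_le_mul_of_nonneg_left (le_minNorm X π ρ) (norm_nonneg c)))

theorem minSeminorm_apply (X : A ⊗[ℂ] B) : minSeminorm A B X = minNorm X := rfl

/-- The algebraic tensor product is a `*`-ring, with `(a ⊗ b)* = a* ⊗ b*`. -/
instance tensorStarRing : StarRing (A ⊗[ℂ] B) where
  star_add := star_add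
  star_mul X Y := by
    induction X with
    | zero => simp
    | add X X' hX hX' => simp [add_mul, mul_add, hX, hX']
    | tmul a b =>
      induction Y with
      | zero => simp
      | add Y Y' hY hY' => simp [add_mul, mul_add, hY, hY']
      | tmul c d => simp

theorem tensorRep_star (π : HilbertRep A) (ρ : HilbertRep B) (X : A ⊗[ℂ] B)
    (x y : π.H ⊗[ℂ] ρ.H) :
    ⟪tensorRep π ρ (star X) x, y⟫_ℂ = ⟪x, tensorRep π ρ X y⟫_ℂ := by
  induction X with
  | zero => simp
  | add X Y hX hY => simp [inner_add_left, inner_add_right, hX, hY]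
  | tmul a b =>
    rw [TensorProduct.star_tmul, tensorRep_tmul, tensorRep_tmul, map_star, map_star]
    induction x with
    | zero => simp
    | add x x' hx hx' => rw [map_add, inner_add_left, inner_add_left, hx, hx']
    | tmul h k =>
      induction y with
      | zero => simp
      | add y y' hy hy' => rw [map_add, inner_add_right, inner_add_right, hy, hy']
      | tmul h' k' =>
        simp [ContinuousLinearMap.star_eq_adjoint, ContinuousLinearMap.adjoint_inner_left]

theorem repNorm_sq_le (π : HilbertRep A) (ρ : HilbertRep B) (X : A ⊗[ℂ] B) :
    repNorm π ρ X * repNorm π ρ X ≤ repNorm π ρ (star X * X) := by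
  have h0 := repNorm_nonneg π ρ (star X * X)
  have h : repNorm π ρ X ≤ √(repNorm π ρ (star X * X)) := by
    refine ContinuousLinearMap.opNorm_le_bound _ (Real.sqrt_nonneg _) fun x => ?_
    refine abs_le_of_sq_le_sq' ?_ (by positivity) |>.2
    rw [mul_pow, Real.sq_sqrt h0, ← inner_self_eq_norm_sq (𝕜 := ℂ), ← tensorRep_star]
    have h2 := norm_inner_le_norm (𝕜 := ℂ) (tensorRep π ρ (star X) (tensorRep π ρ X x)) x
    refine (RCLike.re_le_norm _).trans (h2.trans ?_)
    have h1 : ‖tensorRep π ρ (star X) (tensorRep π ρ X x)‖ ≤ repNorm π ρ (star X * X) * ‖x‖ := by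
      have := (tensorRep π ρ (star X * X)).le_opNorm x
      unfold repNorm
      rw [map_mul] at this ⊢
      exact this
    calc _ ≤ (repNorm π ρ (star X * X) * ‖x‖) * ‖x‖ :=
          mul_le_mul_of_nonneg_right h1 (norm_nonneg x)
      _ = _ := by ring
  calc _ ≤ √(repNorm π ρ (star X * X)) * √(repNorm π ρ (star X * X)) :=
        mul_self_le_mul_self (repNorm_nonneg π ρ X) h
    _ = _ := Real.mul_self_sqrt h0

theorem repNorm_le_star (π : HilbertRep A) (ρ : HilbertRep B) (X : A ⊗[ℂ] B) :
    repNorm π ρ X ≤ repNorm π ρ (star X) := by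
  rcases (repNorm_nonneg π ρ X).eq_or_lt with h | h
  · rw [← h]; exact repNorm_nonneg _ _ _
  · exact le_of_mul_le_mul_right
      ((repNorm_sq_le π ρ X).trans (repNorm_mul_le π ρ (star X) X)) h

theorem minNorm_star (X : A ⊗[ℂ] B) : minNorm (star X) = minNorm X := by
  have h : ∀ Y : A ⊗[ℂ] B, minNorm Y ≤ minNorm (star Y) := fun Y =>
    minNorm_le (minNorm_nonneg _) fun π ρ => (repNorm_le_star π ρ Y).trans (le_minNorm _ π ρ)
  exact le_antisymm ((h _).trans_eq (by rw [star_star])) (h X)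

theorem minNorm_sq_le (X : A ⊗[ℂ] B) : minNorm X * minNorm X ≤ minNorm (star X * X) := by
  have h : minNorm X ≤ √(minNorm (star X * X)) :=
    minNorm_le (Real.sqrt_nonneg _) fun π ρ => Real.le_sqrt_of_sq_le (by
      rw [sq]; exact (repNorm_sq_le π ρ X).trans (le_minNorm _ π ρ))
  calc _ ≤ √(minNorm (star X * X)) * √(minNorm (star X * X)) :=
        mul_self_le_mul_self (minNorm_nonneg X) h
    _ = _ := Real.mul_self_sqrt (minNorm_nonneg _)

/-! ### Completions of topological `*`-algebras -/

section Completion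

open UniformSpace

variable {R : Type u} [UniformSpace R] [Ring R] [StarRing R] [IsUniformAddGroup R]
  [ContinuousStar R]

theorem uniformContinuous_star' : UniformContinuous (star : R → R) :=
  uniformContinuous_addMonoidHom_of_continuous (f := (starAddEquiv : R ≃+ R).toAddMonoidHom)
    continuous_star

/-- The involution of the completion of a topological `*`-ring, extended by continuity. -/
instance completionStar : Star (Completion R) where
  star := Completion.map star

theorem completion_star_coe (x : R) : star (x : Completion R) = ((star x : R) : Completion R) :=
  Completion.map_coe uniformContinuous_star' x

instance completionContinuousStar : ContinuousStar (Completion R) where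
  continuous_star := Completion.continuous_map

instance completionStarRing [IsTopologicalRing R] : StarRing (Completion R) where
  star_involutive x := by
    induction x using Completion.induction_on with
    | hp => exact isClosed_eq (continuous_star.comp continuous_star) continuous_id
    | ih x => simp [completion_star_coe]
  star_mul x y := by
    induction x, y using Completion.induction_on₂ with
    | hp => exact isClosed_eq (by fun_prop) (by fun_prop)
    | ih x y => simp [completion_star_coe, ← Completion.coe_mul]
  star_add x y := by
    induction x, y using Completion.induction_on₂ with
    | hp => exact isClosed_eq (by fun_prop) (by fun_prop)
    | ih x y => simp [completion_star_coe, ← Completion.coe_add]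

instance completionStarModule [Module ℂ R] [UniformContinuousConstSMul ℂ R] [StarModule ℂ R] :
    StarModule ℂ (Completion R) where
  star_smul c x := by
    induction x using Completion.induction_on with
    | hp =>
      exact isClosed_eq (continuous_star.comp (continuous_const_smul c))
        ((continuous_const_smul (star c)).comp continuous_star)
    | ih x =>
      rw [← Completion.coe_smul, completion_star_coe, completion_star_coe,
        ← Completion.coe_smul, star_smul]

end Completion

/-! ### The minimal C*-tensor product `A ⊗̂ B` -/

/-- The algebraic tensor product `A ⊗ B`, normed by the minimal C*-norm. -/
def MinTensor (A : Type u) (B : Type v) [PreCStarAlgebra A] [PreCStarAlgebra B] :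
    Type (max u v) := A ⊗[ℂ] B

instance minTensorRing : Ring (MinTensor A B) := inferInstanceAs (Ring (A ⊗[ℂ] B))
instance minTensorAlgebra : Algebra ℂ (MinTensor A B) := inferInstanceAs (Algebra ℂ (A ⊗[ℂ] B))
instance minTensorStarRing : StarRing (MinTensor A B) := inferInstanceAs (StarRing (A ⊗[ℂ] B))
instance minTensorStarModule : StarModule ℂ (MinTensor A B) :=
  inferInstanceAs (StarModule ℂ (A ⊗[ℂ] B))

instance minTensorSeminormedRing : SeminormedRing (MinTensor A B) where
  __ := minTensorRing (A := A) (B := B)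
  __ := (minSeminorm A B).toSeminormedAddCommGroup
  norm_mul_le := minNorm_mul_le

theorem MinTensor.norm_def (X : MinTensor A B) : ‖X‖ = minNorm (A := A) (B := B) X := rfl

instance minTensorNormedAlgebra : NormedAlgebra ℂ (MinTensor A B) :=
  { minTensorAlgebra (A := A) (B := B) with
    norm_smul_le := fun c X => (map_smul_eq_mul (minSeminorm A B) c X).le }

instance minTensorContinuousStar : ContinuousStar (MinTensor A B) where
  continuous_star := AddMonoidHomClass.continuous_of_bound
    (starAddEquiv : MinTensor A B ≃+ MinTensor A B).toAddMonoidHom 1 fun X => by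
      rw [one_mul]; exact (minNorm_star (A := A) (B := B) X).le

/-- The minimal C*-tensor product `A ⊗̂ B`: the completion of `A ⊗ B` in the minimal C*-norm. -/
def MinTensorProduct (A : Type u) (B : Type v) [PreCStarAlgebra A] [PreCStarAlgebra B] :
    Type (max u v) := UniformSpace.Completion (MinTensor A B)

instance minCompletionNormedAlgebra :
    NormedAlgebra ℂ (UniformSpace.Completion (MinTensor A B)) where
  norm_smul_le := norm_smul_le

instance minCompletionCStarRing : CStarRing (UniformSpace.Completion (MinTensor A B)) where
  norm_mul_self_le x := by
    induction x using UniformSpace.Completion.induction_on with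
    | hp => exact isClosed_le (by fun_prop) (by fun_prop)
    | ih x =>
      rw [completion_star_coe, ← UniformSpace.Completion.coe_mul]
      simp only [UniformSpace.Completion.norm_coe]
      exact minNorm_sq_le (A := A) (B := B) x

instance minCompletionCStarAlgebra : CStarAlgebra (UniformSpace.Completion (MinTensor A B)) where

instance minTensorProductCStarAlgebra : CStarAlgebra (MinTensorProduct A B) :=
  inferInstanceAs (CStarAlgebra (UniformSpace.Completion (MinTensor A B)))

/-- The elementary tensor `a ⊗ b` in `A ⊗̂ B`. -/
def minTmul (a : A) (b : B) : MinTensorProduct A B :=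
  UniformSpace.Completion.coe' (α := MinTensor A B) (a ⊗ₜ[ℂ] b)

/-! ### The nice-algebra tensor product -/

/-- The operator `δ̃₁ ⋯ δ̃ₖ η̃₁ ⋯ η̃ₗ` on `A ⊗ B`, where `δ̃ = δ ⊗ id` and `η̃ = id ⊗ η`. -/
def tensorDer (i : List (ClosableStarDerivation A) × List (ClosableStarDerivation B)) :
    A ⊗[ℂ] B →ₗ[ℂ] A ⊗[ℂ] B :=
  TensorProduct.map (iterDer i.1) (iterDer i.2)

/-- The seminorms `X ↦ ‖δ̃₁ ⋯ δ̃ₖ η̃₁ ⋯ η̃ₗ X‖` on `A ⊗ B`, for the minimal C*-norm and all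
multi-indices of closable `*`-derivations `δᵢ` of `A` and `ηⱼ` of `B`. -/
def tensorSeminorm (A : Type u) (B : Type v) [PreCStarAlgebra A] [PreCStarAlgebra B] :
    SeminormFamily ℂ (A ⊗[ℂ] B)
      (List (ClosableStarDerivation A) × List (ClosableStarDerivation B)) :=
  fun i => (minSeminorm A B).comp (tensorDer i)

theorem tensorSeminorm_apply
    (i : List (ClosableStarDerivation A) × List (ClosableStarDerivation B)) (X : A ⊗[ℂ] B) :
    tensorSeminorm A B i X = minNorm (tensorDer i X) := rfl

theorem rTensor_leibniz (δ : ClosableStarDerivation A) (X Y : A ⊗[ℂ] B) :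
    δ.toLinearMap.rTensor B (X * Y) =
      δ.toLinearMap.rTensor B X * Y + X * δ.toLinearMap.rTensor B Y := by
  induction X with
  | zero => simp
  | add X X' hX hX' => simp only [add_mul, map_add, hX, hX']; abel
  | tmul a b =>
    induction Y with
    | zero => simp
    | add Y Y' hY hY' => simp only [mul_add, map_add, hY, hY']; abel
    | tmul c d =>
      have h : δ.toLinearMap (a * c) = δ.toLinearMap a * c + a * δ.toLinearMap c := δ.leibniz' a c
      simp [h, TensorProduct.add_tmul]

theorem lTensor_leibniz (η : ClosableStarDerivation B) (X Y : A ⊗[ℂ] B) :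
    η.toLinearMap.lTensor A (X * Y) =
      η.toLinearMap.lTensor A X * Y + X * η.toLinearMap.lTensor A Y := by
  induction X with
  | zero => simp
  | add X X' hX hX' => simp only [add_mul, map_add, hX, hX']; abel
  | tmul a b =>
    induction Y with
    | zero => simp
    | add Y Y' hY hY' => simp only [mul_add, map_add, hY, hY']; abel
    | tmul c d =>
      have h : η.toLinearMap (b * d) = η.toLinearMap b * d + b * η.toLinearMap d := η.leibniz' b d
      simp [h, TensorProduct.tmul_add]

theorem tensorDer_cons_left (δ : ClosableStarDerivation A) (l : List (ClosableStarDerivation A))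
    (m : List (ClosableStarDerivation B)) (X : A ⊗[ℂ] B) :
    tensorDer (δ :: l, m) X = δ.toLinearMap.rTensor B (tensorDer (l, m) X) := by
  have : tensorDer (δ :: l, m) = δ.toLinearMap.rTensor B ∘ₗ tensorDer (l, m) := by
    ext a b; simp [tensorDer, iterDer]
  rw [this]; rfl

theorem tensorDer_cons_right (η : ClosableStarDerivation B)
    (l : List (ClosableStarDerivation A)) (m : List (ClosableStarDerivation B)) (X : A ⊗[ℂ] B) :
    tensorDer (l, η :: m) X = η.toLinearMap.lTensor A (tensorDer (l, m) X) := by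
  have : tensorDer (l, η :: m) = η.toLinearMap.lTensor A ∘ₗ tensorDer (l, m) := by
    ext a b; simp [tensorDer, iterDer]
  rw [this]; rfl

/-- The iterated Leibniz rule. -/
theorem tensorDer_mul (l : List (ClosableStarDerivation A)) (m : List (ClosableStarDerivation B)) :
    ∃ L : List ((List (ClosableStarDerivation A) × List (ClosableStarDerivation B)) ×
        (List (ClosableStarDerivation A) × List (ClosableStarDerivation B))),
      ∀ X Y : A ⊗[ℂ] B, tensorDer (l, m) (X * Y) =
        (L.map fun p => tensorDer p.1 X * tensorDer p.2 Y).sum := by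
  induction l with
  | nil =>
    induction m with
    | nil => exact ⟨[(([], []), ([], []))], fun X Y => by simp [tensorDer, iterDer]⟩
    | cons η m ih =>
      obtain ⟨L, hL⟩ := ih
      refine ⟨L.map (fun p => ((p.1.1, η :: p.1.2), p.2)) ++
        L.map (fun p => (p.1, (p.2.1, η :: p.2.2))), fun X Y => ?_⟩
      rw [tensorDer_cons_right, hL, map_list_sum]
      simp only [List.map_map, List.map_append, List.sum_append, Function.comp_def,
        lTensor_leibniz, tensorDer_cons_right, List.sum_map_add]
  | cons δ l ih =>
    obtain ⟨L, hL⟩ := ih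
    refine ⟨L.map (fun p => ((δ :: p.1.1, p.1.2), p.2)) ++
      L.map (fun p => (p.1, (δ :: p.2.1, p.2.2))), fun X Y => ?_⟩
    rw [tensorDer_cons_left, hL, map_list_sum]
    simp only [List.map_map, List.map_append, List.sum_append, Function.comp_def,
      rTensor_leibniz, tensorDer_cons_left, List.sum_map_add]

theorem iterDer_star (l : List (ClosableStarDerivation A)) (a : A) :
    iterDer l (star a) = star (iterDer l a) := by
  induction l with
  | nil => rfl
  | cons δ l ih =>
    change δ.toLinearMap (iterDer l (star a)) = star (δ.toLinearMap (iterDer l a))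
    rw [ih]; exact δ.star' _

theorem tensorDer_star (i : List (ClosableStarDerivation A) × List (ClosableStarDerivation B))
    (X : A ⊗[ℂ] B) : tensorDer i (star X) = star (tensorDer i X) := by
  induction X with
  | zero => simp
  | add X Y hX hY => simp [hX, hY]
  | tmul a b => simp [tensorDer, iterDer_star]

/-- The algebraic tensor product `A ⊗ B`, with the locally convex topology of the seminorms
`‖δ̃₁ ⋯ δ̃ₖ η̃₁ ⋯ η̃ₗ X‖`. -/
def NiceTensor (A : Type u) (B : Type v) [PreCStarAlgebra A] [PreCStarAlgebra B] :
    Type (max u v) := A ⊗[ℂ] B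

instance niceTensorRing : Ring (NiceTensor A B) := inferInstanceAs (Ring (A ⊗[ℂ] B))
instance niceTensorAlgebra : Algebra ℂ (NiceTensor A B) := inferInstanceAs (Algebra ℂ (A ⊗[ℂ] B))
instance niceTensorStarRing : StarRing (NiceTensor A B) := inferInstanceAs (StarRing (A ⊗[ℂ] B))

/-- The seminorms `tensorSeminorm`, on the type `NiceTensor A B`. -/
def niceSeminorm (A : Type u) (B : Type v) [PreCStarAlgebra A] [PreCStarAlgebra B] :
    SeminormFamily ℂ (NiceTensor A B)
      (List (ClosableStarDerivation A) × List (ClosableStarDerivation B)) :=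
  tensorSeminorm A B

instance niceTensorUniformSpace : UniformSpace (NiceTensor A B) :=
  ⨅ i, (niceSeminorm A B i).toSeminormedAddCommGroup.toUniformSpace

instance niceTensorIsUniformAddGroup : IsUniformAddGroup (NiceTensor A B) :=
  isUniformAddGroup_iInf fun i =>
    letI := (niceSeminorm A B i).toSeminormedAddCommGroup
    inferInstance

theorem niceTensor_withSeminorms : WithSeminorms (niceSeminorm A B) :=
  (niceSeminorm A B).withSeminorms_iff_uniformSpace_eq_iInf.2 rfl

instance niceTensorContinuousSMul : ContinuousSMul ℂ (NiceTensor A B) :=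
  niceTensor_withSeminorms.continuousSMul

instance niceTensorUniformContinuousConstSMul : UniformContinuousConstSMul ℂ (NiceTensor A B) :=
  uniformContinuousConstSMul_of_continuousConstSMul ℂ _

theorem tensorSeminorm_mul
    (i : List (ClosableStarDerivation A) × List (ClosableStarDerivation B)) :
    ∃ L : List ((List (ClosableStarDerivation A) × List (ClosableStarDerivation B)) ×
        (List (ClosableStarDerivation A) × List (ClosableStarDerivation B))),
      ∀ X Y : A ⊗[ℂ] B, tensorSeminorm A B i (X * Y) ≤
        (L.map fun p => tensorSeminorm A B p.1 X * tensorSeminorm A B p.2 Y).sum := by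
  obtain ⟨L, hL⟩ := tensorDer_mul i.1 i.2
  refine ⟨L, fun X Y => ?_⟩
  change minSeminorm A B (tensorDer (i.1, i.2) (X * Y)) ≤ _
  rw [hL]
  clear hL
  induction L with
  | nil => simp
  | cons p L ih =>
    simp only [List.map_cons, List.sum_cons]
    exact (map_add_le_add _ _ _).trans (add_le_add (minNorm_mul_le _ _) ih)

theorem tensorSeminorm_star
    (i : List (ClosableStarDerivation A) × List (ClosableStarDerivation B)) (X : A ⊗[ℂ] B) :
    tensorSeminorm A B i (star X) = tensorSeminorm A B i X := by
  rw [tensorSeminorm_apply, tensorSeminorm_apply, tensorDer_star, minNorm_star]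

theorem niceSeminorm_mul
    (i : List (ClosableStarDerivation A) × List (ClosableStarDerivation B)) :
    ∃ L : List ((List (ClosableStarDerivation A) × List (ClosableStarDerivation B)) ×
        (List (ClosableStarDerivation A) × List (ClosableStarDerivation B))),
      ∀ X Y : NiceTensor A B, niceSeminorm A B i (X * Y) ≤
        (L.map fun p => niceSeminorm A B p.1 X * niceSeminorm A B p.2 Y).sum :=
  tensorSeminorm_mul i

theorem niceTensor_tendsto_sum {F : Filter (NiceTensor A B × NiceTensor A B)}
    (L : List ((List (ClosableStarDerivation A) × List (ClosableStarDerivation B)) ×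
        (List (ClosableStarDerivation A) × List (ClosableStarDerivation B))))
    (h : ∀ i j, Tendsto (fun z : NiceTensor A B × NiceTensor A B =>
      niceSeminorm A B i z.1 * niceSeminorm A B j z.2) F (𝓝 0)) :
    Tendsto (fun z : NiceTensor A B × NiceTensor A B =>
      (L.map fun p => niceSeminorm A B p.1 z.1 * niceSeminorm A B p.2 z.2).sum) F (𝓝 0) := by
  induction L with
  | nil => simpa using tendsto_const_nhds
  | cons p L ih => simpa using (h p.1 p.2).add ih

theorem niceTensor_tendsto_mul {F : Filter (NiceTensor A B × NiceTensor A B)}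
    (h : ∀ i j, Tendsto (fun z : NiceTensor A B × NiceTensor A B =>
      niceSeminorm A B i z.1 * niceSeminorm A B j z.2) F (𝓝 0)) :
    Tendsto (fun z : NiceTensor A B × NiceTensor A B => z.1 * z.2) F (𝓝 0) := by
  refine (niceTensor_withSeminorms.tendsto_nhds _ _).2 fun i ε hε => ?_
  obtain ⟨L, hL⟩ := niceSeminorm_mul i
  filter_upwards [(niceTensor_tendsto_sum L h).eventually (gt_mem_nhds hε)] with z hz
  rw [sub_zero]
  exact (hL z.1 z.2).trans_lt hz

theorem niceSeminorm_tendsto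
    (i : List (ClosableStarDerivation A) × List (ClosableStarDerivation B)) (X : NiceTensor A B) :
    Tendsto (niceSeminorm A B i) (𝓝 X) (𝓝 (niceSeminorm A B i X)) :=
  (niceTensor_withSeminorms.continuous_seminorm i).tendsto X

instance niceTensorIsTopologicalRing : IsTopologicalRing (NiceTensor A B) := by
  refine IsTopologicalRing.of_addGroup_of_nhds_zero ?_ (fun X => ?_) (fun X => ?_)
  · refine niceTensor_tendsto_mul fun i j => ?_
    have := ((niceSeminorm_tendsto i 0).comp tendsto_fst).mul
      ((niceSeminorm_tendsto j 0).comp (tendsto_snd (f := 𝓝 (0 : NiceTensor A B))))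
    simpa using this
  · have := niceTensor_tendsto_mul (F := map (fun Y => (X, Y)) (𝓝 0)) fun i j => by
      rw [tendsto_map'_iff]
      simpa using! (niceSeminorm_tendsto j 0).const_mul (niceSeminorm A B i X)
    exact tendsto_map'_iff.1 this
  · have := niceTensor_tendsto_mul (F := map (fun Y => (Y, X)) (𝓝 0)) fun i j => by
      rw [tendsto_map'_iff]
      simpa using! (niceSeminorm_tendsto i 0).mul_const (niceSeminorm A B j X)
    exact tendsto_map'_iff.1 this

instance niceTensorContinuousStar : ContinuousStar (NiceTensor A B) where
  continuous_star := by
    refine continuous_iff_continuousAt.2 fun X => ?_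
    refine (niceTensor_withSeminorms.tendsto_nhds _ _).2 fun i ε hε => ?_
    have h := (niceTensor_withSeminorms.tendsto_nhds id X).1 tendsto_id i ε hε
    filter_upwards [h] with Y hY
    rw [← star_sub]
    have h2 : niceSeminorm A B i (star (Y - X)) = niceSeminorm A B i (Y - X) :=
      tensorSeminorm_star (A := A) (B := B) i (Y - X)
    rw [h2]; exact hY

/-- The nice-algebra tensor product `A ⊗̂ B`: the completion of `A ⊗ B` in the topology of the
seminorms `‖δ̃₁ ⋯ δ̃ₖ η̃₁ ⋯ η̃ₗ X‖`. -/
def NiceTensorProduct (A : Type u) (B : Type v) [PreCStarAlgebra A] [PreCStarAlgebra B] :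
    Type (max u v) := UniformSpace.Completion (NiceTensor A B)

instance niceTensorProductUniformSpace : UniformSpace (NiceTensorProduct A B) :=
  inferInstanceAs (UniformSpace (UniformSpace.Completion (NiceTensor A B)))
instance niceTensorProductRing : Ring (NiceTensorProduct A B) :=
  inferInstanceAs (Ring (UniformSpace.Completion (NiceTensor A B)))
instance niceTensorProductAlgebra : Algebra ℂ (NiceTensorProduct A B) :=
  inferInstanceAs (Algebra ℂ (UniformSpace.Completion (NiceTensor A B)))
instance niceTensorProductStarRing : StarRing (NiceTensorProduct A B) :=
  inferInstanceAs (StarRing (UniformSpace.Completion (NiceTensor A B)))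

/-- The elementary tensor `a ⊗ b` in the nice-algebra tensor product. -/
def niceTmul (a : A) (b : B) : NiceTensorProduct A B :=
  UniformSpace.Completion.coe' (α := NiceTensor A B) (a ⊗ₜ[ℂ] b)

/-! ### Smooth functions with values in a C*-algebra -/

section Smooth

variable {E : Type*} [NormedAddCommGroup E] [NormedSpace ℝ E] {H : Type*} [TopologicalSpace H]
  (I : ModelWithCorners ℝ E H) (M : Type w) [TopologicalSpace M] [ChartedSpace H M]
  [CompactSpace M] (Q : Type u) [CStarAlgebra Q]

/-- `C^∞(M, Q)`, as a `*`-subalgebra of the C*-algebra `C(M, Q)`; its C*-norm is the sup norm. -/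
def SmoothMaps : StarSubalgebra ℂ C(M, Q) where
  carrier := {f | ContMDiff I 𝓘(ℝ, Q) ∞ f}
  mul_mem' hf hg :=
    (contDiff_mul (𝕜 := ℝ) (𝔸 := Q)).comp_contMDiff (ContMDiff.prodMk_space hf hg)
  add_mem' hf hg := ContMDiff.add hf hg
  algebraMap_mem' _ := contMDiff_const
  star_mem' hf :=
    (starL' ℝ : Q ≃L[ℝ] Q).contDiff.comp_contMDiff hf

/-- The usual topology of `C^∞(M, Q)`: uniform convergence, on the compact subsets of coordinate
neighbourhoods, of all derivatives in these coordinates. -/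
@[reducible] def smoothTopology : TopologicalSpace (SmoothMaps I M Q) :=
  ⨅ (c : M) (k : ℕ), TopologicalSpace.induced
    (fun f => UniformOnFun.ofFun {K : Set E | IsCompact K ∧ K ⊆ (extChartAt I c).target}
      (iteratedFDerivWithin ℝ k ((f : C(M, Q)) ∘ (extChartAt I c).symm) (range I)))
    inferInstance

end Smooth

end NiceAlg

end

open NiceAlg
open scoped Manifold ContDiff

noncomputable section

namespace NiceAlg

universe u v w

/-! ### The closed graph theorem for countable complete families of seminorms -/

section ClosedGraph

variable {X Y : Type*} [AddCommGroup X] [Module ℂ X] [AddCommGroup Y] [Module ℂ Y]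

/-- Every sequence which is Cauchy for all seminorms of the family converges. -/
def SeqComplete {ι : Type*} (q : ι → Seminorm ℂ X) : Prop :=
  ∀ x : ℕ → X, (∀ i, ∀ ε > 0, ∃ N, ∀ m ≥ N, ∀ n ≥ N, q i (x m - x n) < ε) →
    ∃ a, ∀ i, Tendsto (fun n => q i (x n - a)) atTop (𝓝 0)

/-- A seminorm is dominated by a family of seminorms. -/
def DominatedBy {ι : Type*} (p : Seminorm ℂ X) (q : ι → Seminorm ℂ X) : Prop :=
  ∃ (s : Finset ι) (C : ℝ), 0 ≤ C ∧ ∀ x, p x ≤ C * ∑ i ∈ s, q i x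

theorem finset_sup_le_of_monotone {q : ℕ → Seminorm ℂ X} (hq : Monotone q) (s : Finset ℕ) :
    s.sup q ≤ q (s.sup id) :=
  Finset.sup_le fun _ hi => hq (Finset.le_sup (f := id) hi)

theorem SeqComplete.exists_approx {q : ℕ → Seminorm ℂ X} (hq : Monotone q)
    (hc : SeqComplete q) (p : Seminorm ℂ X) {c : ℝ} (hc0 : 0 < c) :
    ∃ (n : ℕ) (ε : ℝ), 0 < ε ∧ ∀ x, q n x < ε → ∀ m, ∀ η > 0, ∃ y, p y ≤ c ∧ q m (x - y) < η := by
  let : TopologicalSpace X := SeminormFamily.moduleFilterBasis (𝕜 := ℂ) q |>.topology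
  have hw : WithSeminorms (𝕜 := ℂ) q := ⟨rfl⟩
  have := hw.topologicalAddGroup
  let : UniformSpace X := IsTopologicalAddGroup.rightUniformSpace X
  have : IsUniformAddGroup X := isUniformAddGroup_of_addCommGroup
  have := hw.firstCountableTopology
  have : (uniformity X).IsCountablyGenerated :=
    IsUniformAddGroup.uniformity_countably_generated
  have hball : ∀ (x : X) (U : Set X), U ∈ 𝓝 x ↔ ∃ n, ∃ r > 0, (q n).ball x r ⊆ U := by
    intro x U
    rw [hw.mem_nhds_iff]
    constructor
    · rintro ⟨s, r, hr, h⟩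
      exact ⟨s.sup id, r, hr, (Seminorm.ball_antitone (finset_sup_le_of_monotone hq s)).trans h⟩
    · rintro ⟨n, r, hr, h⟩
      exact ⟨{n}, r, hr, by simpa using h⟩
  have : CompleteSpace X := by
    refine UniformSpace.complete_of_cauchySeq_tendsto fun u hu => ?_
    obtain ⟨a, ha⟩ := hc u fun i ε hε => by
      have hmem : {z : X × X | q i (z.1 - z.2) < ε} ∈ uniformity X := by
        rw [uniformity_eq_comap_nhds_zero_swapped]
        refine ⟨(q i).ball 0 ε, (hball 0 _).2 ⟨i, ε, hε, subset_rfl⟩, fun z hz => ?_⟩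
        simpa [Seminorm.mem_ball] using hz
      obtain ⟨N, hN⟩ := cauchySeq_iff.1 hu _ hmem
      exact ⟨N, fun m hm n hn => hN m hm n hn⟩
    refine ⟨a, fun U hU => ?_⟩
    obtain ⟨n, r, hr, h⟩ := (hball a U).1 hU
    refine mem_map.2 ?_
    filter_upwards [(ha n).eventually (gt_mem_nhds hr)] with k hk
    exact h (by simpa [Seminorm.mem_ball] using hk)
  let : PseudoMetricSpace X := UniformSpace.pseudoMetricSpace X
  have : BaireSpace X := inferInstance
  have hU : ⋃ k : ℕ, closure {x | p x ≤ k * (c / 2)} = univ := by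
    refine eq_univ_of_forall fun x => mem_iUnion.2 ?_
    obtain ⟨k, hk⟩ := exists_nat_ge (p x / (c / 2))
    exact ⟨k, subset_closure ((div_le_iff₀ (by positivity)).1 hk)⟩
  obtain ⟨k, x₀, hx₀⟩ := nonempty_interior_of_iUnion_of_closed (fun _ => isClosed_closure) hU
  obtain ⟨n, r, hr, hsub⟩ := (hball x₀ _).1 (mem_interior_iff_mem_nhds.1 hx₀)
  have happ : ∀ z, q n (z - x₀) < r → ∀ m, ∀ η > 0, ∃ y, p y ≤ k * (c / 2) ∧ q m (z - y) < η := by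
    intro z hz m η hη
    have hz' : z ∈ closure {x | p x ≤ k * (c / 2)} := hsub (by simpa [Seminorm.mem_ball] using hz)
    obtain ⟨y, hy, hy'⟩ := mem_closure_iff_nhds.1 hz' _ ((hball z _).2 ⟨m, η, hη, subset_rfl⟩)
    exact ⟨y, hy', by rw [map_sub_rev]; simpa [Seminorm.mem_ball] using hy⟩
  refine ⟨n, r / (k + 1), by positivity, fun x hx m η hη => ?_⟩
  have hk1 : (0 : ℝ) < k + 1 := by positivity
  have hxr : q n ((k + 1 : ℂ) • x) < r := by
    rw [map_smul_eq_mul]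
    have : ‖(k + 1 : ℂ)‖ = k + 1 := by
      have := Complex.norm_natCast (k + 1)
      push_cast at this
      exact this
    rw [this]
    calc (k + 1 : ℝ) * q n x < (k + 1) * (r / (k + 1)) := by gcongr
      _ = r := by field_simp
  obtain ⟨y₁, h₁, h₁'⟩ := happ (x₀ + (k + 1 : ℂ) • x) (by simpa using hxr) m (η / 2) (by positivity)
  obtain ⟨y₀, h₀, h₀'⟩ := happ x₀ (by simpa using hr) m (η / 2) (by positivity)
  have hnorm : ‖((k + 1 : ℂ))⁻¹‖ = (k + 1 : ℝ)⁻¹ := by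
    rw [norm_inv]
    have := Complex.norm_natCast (k + 1)
    push_cast at this
    rw [this]
  refine ⟨((k + 1 : ℂ))⁻¹ • (y₁ - y₀), ?_, ?_⟩
  · rw [map_smul_eq_mul, hnorm]
    have h2 : p (y₁ - y₀) ≤ k * c := (map_sub_le_add p _ _).trans (by linarith)
    rw [inv_mul_le_iff₀ hk1]
    nlinarith
  · have hne : (k + 1 : ℂ) ≠ 0 := by exact_mod_cast hk1.ne'
    have : x - ((k + 1 : ℂ))⁻¹ • (y₁ - y₀) =
        ((k + 1 : ℂ))⁻¹ • ((x₀ + (k + 1 : ℂ) • x - y₁) - (x₀ - y₀)) := by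
      have hx : x = ((k + 1 : ℂ))⁻¹ • ((k + 1 : ℂ) • x) := by rw [inv_smul_smul₀ hne]
      nth_rw 1 [hx]
      rw [← smul_sub]
      congr 1
      abel
    rw [this, map_smul_eq_mul, hnorm]
    have h2 : q m ((x₀ + (k + 1 : ℂ) • x - y₁) - (x₀ - y₀)) < η :=
      (map_sub_le_add (q m) _ _).trans_lt (by linarith)
    have h3 : (k + 1 : ℝ)⁻¹ ≤ 1 := inv_le_one_of_one_le₀ (by linarith [k.cast_nonneg (α := ℝ)])
    calc _ ≤ 1 * q m ((x₀ + (k + 1 : ℂ) • x - y₁) - (x₀ - y₀)) := by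
          gcongr
      _ < η := by rwa [one_mul]

theorem seminorm_le_of_ball {p q : Seminorm ℂ X} {ε C : ℝ} (hε : 0 < ε)
    (h : ∀ x, q x < ε → p x ≤ C) (x : X) : p x ≤ 2 * C / ε * q x := by
  have hC : 0 ≤ C := (apply_nonneg p 0).trans (h 0 (by simpa using hε))
  refine le_of_forall_pos_le_add fun δ hδ => ?_
  have key : ∀ t > 0, q x < t → p x ≤ C / ε * t := by
    intro t ht hxt
    have h1 := h (((ε / t : ℝ) : ℂ) • x) (by
      rw [map_smul_eq_mul, Complex.norm_real, Real.norm_of_nonneg (by positivity)]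
      calc ε / t * q x < ε / t * t := by gcongr
        _ = ε := by field_simp)
    rw [map_smul_eq_mul, Complex.norm_real, Real.norm_of_nonneg (by positivity)] at h1
    rw [div_mul_eq_mul_div, le_div_iff₀ hε]
    rw [div_mul_eq_mul_div, div_le_iff₀ ht] at h1
    linarith
  rcases (apply_nonneg q x).eq_or_lt with h0 | h0
  · rw [← h0, mul_zero, zero_add]
    have h2 := key (δ * ε / (C + 1)) (by positivity) (by rw [← h0]; positivity)
    refine h2.trans ?_
    rw [div_mul_div_comm, div_le_iff₀ (by positivity)]
    nlinarith [mul_pos hδ hε]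
  · have h2 := key (2 * q x) (by positivity) (by linarith)
    calc p x ≤ C / ε * (2 * q x) := h2
      _ = 2 * C / ε * q x := by ring
      _ ≤ _ := by linarith

theorem closedGraph_monotone {q : ℕ → Seminorm ℂ X} {r : ℕ → Seminorm ℂ Y} (hq : Monotone q)
    (hr : Monotone r) (hqc : SeqComplete q) (hrc : SeqComplete r) (T : X →ₗ[ℂ] Y)
    (hT : ∀ (x : ℕ → X) (y : Y), (∀ i, Tendsto (fun n => q i (x n)) atTop (𝓝 0)) →
      (∀ j, Tendsto (fun n => r j (T (x n) - y)) atTop (𝓝 0)) → ∀ j, r j y = 0) (j : ℕ) :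
    ∃ (n : ℕ) (C : ℝ), 0 ≤ C ∧ ∀ x, r j (T x) ≤ C * q n x := by
  have h1 : ∀ i : ℕ, ∃ (n : ℕ) (ε : ℝ), 0 < ε ∧ ε ≤ (1 / 2) ^ i ∧ i ≤ n ∧ ∀ x, q n x < ε →
      ∀ m, ∀ η > 0, ∃ y, r i (T y) ≤ (1 / 2) ^ i ∧ q m (x - y) < η := by
    intro i
    obtain ⟨n, ε, hε, h⟩ := hqc.exists_approx hq ((r i).comp T) (c := (1 / 2) ^ i) (by positivity)
    refine ⟨max n i, min ε ((1 / 2) ^ i), by positivity, min_le_right _ _, le_max_right _ _,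
      fun x hx => h x ?_⟩
    exact ((hq (le_max_left n i)) x).trans_lt (hx.trans_le (min_le_left _ _))
  choose n ε hε hε' hn happ using h1
  suffices h : ∀ x, q (n j) x < ε j → r j (T x) ≤ 2 by
    refine ⟨n j, 2 * 2 / ε j, by have := hε j; positivity, fun x => ?_⟩
    exact seminorm_le_of_ball (p := (r j).comp T) (hε j) h x
  intro x hx
  let P : ℕ → X → Prop := fun i z => q (n (j + i)) z < ε (j + i)
  have hstep : ∀ i (z : {z // P i z}), ∃ y, r (j + i) (T y) ≤ (1 / 2) ^ (j + i) ∧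
      P (i + 1) (z.1 - y) := fun i z => happ (j + i) z.1 z.2 (n (j + (i + 1))) _ (hε _)
  choose Y₀ hY₀ hY₀' using hstep
  let u : (i : ℕ) → {z // P i z} := fun i =>
    Nat.rec ⟨x, hx⟩ (fun i z => ⟨z.1 - Y₀ i z, hY₀' i z⟩) i
  have hu0 : (u 0).1 = x := rfl
  have hus : ∀ i, (u (i + 1)).1 = (u i).1 - Y₀ i (u i) := fun i => rfl
  have hd : ∀ i, r (j + i) (T ((u i).1 - (u (i + 1)).1)) ≤ (1 / 2) ^ (j + i) := by
    intro i
    rw [hus, sub_sub_cancel]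
    exact hY₀ i (u i)
  have hpow : ∀ k i, k ≤ j + i → ∀ l, r k (T ((u i).1 - (u (i + l)).1)) ≤ 2 * (1 / 2) ^ i := by
    intro k i hk l
    have : ∀ l, r k (T ((u i).1 - (u (i + l)).1)) ≤ 2 * (1 / 2) ^ i * (1 - (1 / 2) ^ l) := by
      intro l
      induction l with
      | zero => simp
      | succ l ih =>
        have e : (u i).1 - (u (i + (l + 1))).1 =
            ((u i).1 - (u (i + l)).1) + ((u (i + l)).1 - (u (i + l + 1)).1) := by
          rw [← add_assoc]; abel
        rw [e, map_add]
        refine (map_add_le_add (r k) _ _).trans ((add_le_add ih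
          (((hr (show k ≤ j + (i + l) by omega)) _).trans (hd (i + l)))).trans ?_)
        have : ((1 : ℝ) / 2) ^ (j + (i + l)) ≤ (1 / 2) ^ (i + l) :=
          pow_le_pow_of_le_one (by norm_num) (by norm_num) (by omega)
        refine (add_le_add le_rfl this).trans_eq ?_
        rw [pow_add, pow_succ]
        ring
    refine (this l).trans ?_
    have : (0 : ℝ) ≤ (1 / 2) ^ l := by positivity
    have h3 : (0 : ℝ) ≤ (1 / 2) ^ i := by positivity
    nlinarith
  have hpt : Tendsto (fun i : ℕ => 2 * (1 / 2 : ℝ) ^ i) atTop (𝓝 0) := by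
    simpa using (tendsto_pow_atTop_nhds_zero_of_lt_one (by norm_num : (0 : ℝ) ≤ 1 / 2)
      (by norm_num)).const_mul 2
  have hu : ∀ m, Tendsto (fun i => q m (u i).1) atTop (𝓝 0) := by
    intro m
    refine squeeze_zero' (Eventually.of_forall fun i => apply_nonneg _ _) ?_ hpt
    filter_upwards [eventually_ge_atTop m] with i hi
    have h2 := (u i).2
    refine ((hq (show m ≤ n (j + i) from hi.trans ((by omega : i ≤ j + i).trans (hn _)))) _).trans
      (h2.le.trans ((hε' _).trans ?_))
    have h3 : ((1 : ℝ) / 2) ^ (j + i) ≤ (1 / 2) ^ i :=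
      pow_le_pow_of_le_one (by norm_num) (by norm_num) (by omega)
    have h4 : (0 : ℝ) ≤ (1 / 2) ^ i := by positivity
    linarith
  obtain ⟨y, hy⟩ := hrc (fun i => T (u i).1) (by
    intro k δ hδ
    obtain ⟨N, hN⟩ := eventually_atTop.1 (hpt.eventually (gt_mem_nhds hδ))
    have : ∀ a ≥ max N k, ∀ b ≥ a, r k (T (u a).1 - T (u b).1) < δ := by
      intro a ha b hb
      obtain ⟨l, rfl⟩ := Nat.exists_eq_add_of_le hb
      rw [← map_sub]
      exact (hpow k a (((le_max_right N k).trans ha).trans (by omega)) l).trans_lt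
        (hN a ((le_max_left _ _).trans ha))
    refine ⟨max N k, fun a ha b hb => ?_⟩
    rcases le_total a b with h | h
    · exact this a ha b h
    · rw [map_sub_rev]; exact this b hb a h)
  have hy0 := hT (fun i => (u i).1) y hu hy j
  have hlim : Tendsto (fun i => 2 + r j (T (u i).1 - y)) atTop (𝓝 (2 + 0)) :=
    (hy j).const_add 2
  rw [add_zero] at hlim
  refine ge_of_tendsto' hlim fun i => ?_
  have h5 := hpow j 0 (by omega) i
  rw [hu0, zero_add, pow_zero, mul_one] at h5
  have e : T x = T (x - (u i).1) + ((T (u i).1 - y) + y) := by rw [map_sub]; abel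
  rw [e]
  refine (map_add_le_add _ _ _).trans (add_le_add h5 ((map_add_le_add _ _ _).trans ?_))
  rw [hy0, add_zero]

/-- The partial sums of an enumeration of a countable family of seminorms. -/
theorem exists_monotone_family {ι : Type*} [Countable ι] (q : ι → Seminorm ℂ X) :
    ∃ Q : ℕ → Seminorm ℂ X, Monotone Q ∧ (∀ n, ∃ s : Finset ι, ∃ C : ℝ, 0 ≤ C ∧
      ∀ x, Q n x ≤ C * ∑ i ∈ s, q i x) ∧ ∀ i, ∃ n, q i ≤ Q n := by
  classical
  let q' : Option ι → Seminorm ℂ X := fun o => o.elim 0 q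
  obtain ⟨e, he⟩ := exists_surjective_nat (Option ι)
  refine ⟨fun n => (Finset.range n).sup (q' ∘ e), fun m n h =>
    Finset.sup_mono (by simpa using h), fun n => ?_, fun i => ?_⟩
  · refine ⟨((Finset.range n).image e).eraseNone, 1, zero_le_one, fun x => ?_⟩
    rw [one_mul]
    have h0 : 0 ≤ ∑ i ∈ ((Finset.range n).image e).eraseNone, q i x :=
      Finset.sum_nonneg fun i _ => apply_nonneg _ _
    refine Seminorm.finset_sup_apply_le h0 fun k hk => ?_
    change q' (e k) x ≤ _
    rcases hek : e k with _ | i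
    · simpa [q'] using h0
    · refine Finset.single_le_sum (f := fun i => q i x) (fun i _ => apply_nonneg _ _) ?_
      simp only [Finset.mem_eraseNone, Finset.mem_image]
      exact ⟨k, hk, hek⟩
  · obtain ⟨k, hk⟩ := he (some i)
    refine ⟨k + 1, ?_⟩
    have := Finset.le_sup (f := q' ∘ e) (Finset.self_mem_range_succ k)
    simpa [hk, q'] using this

theorem tendsto_of_le_mul_sum {ι : Type*} {q : ι → Seminorm ℂ X} {p : Seminorm ℂ X}
    (h : DominatedBy p q) {x : ℕ → X} (hx : ∀ i, Tendsto (fun n => q i (x n)) atTop (𝓝 0)) :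
    Tendsto (fun n => p (x n)) atTop (𝓝 0) := by
  obtain ⟨s, C, -, h⟩ := h
  refine squeeze_zero (fun n => apply_nonneg _ _) (fun n => h (x n)) ?_
  have := (tendsto_finsetSum s fun i _ => hx i).const_mul C
  simpa using this

theorem seqComplete_of_dominated {ι κ : Type*} {q : ι → Seminorm ℂ X} {q' : κ → Seminorm ℂ X}
    (h : ∀ i, DominatedBy (q' i) q) (h' : ∀ i, DominatedBy (q i) q') (hc : SeqComplete q) :
    SeqComplete q' := by
  intro x hx
  obtain ⟨a, ha⟩ := hc x fun i ε hε => by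
    obtain ⟨s, C, hC, hs⟩ := h' i
    have : ∃ N, ∀ j ∈ s, ∀ m ≥ N, ∀ n ≥ N, q' j (x m - x n) < ε / ((C + 1) * (s.card + 1)) := by
      choose N hN using fun j => hx j (ε / ((C + 1) * (s.card + 1))) (by positivity)
      exact ⟨s.sup N, fun j hj m hm n hn => hN j m ((Finset.le_sup hj).trans hm) n
        ((Finset.le_sup hj).trans hn)⟩
    obtain ⟨N, hN⟩ := this
    refine ⟨N, fun m hm n hn => (hs _).trans_lt ?_⟩
    have h1 : ∑ j ∈ s, q' j (x m - x n) ≤ s.card * (ε / ((C + 1) * (s.card + 1))) := by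
      rw [← nsmul_eq_mul]
      exact Finset.sum_le_card_nsmul _ _ _ fun j hj => (hN j hj m hm n hn).le
    calc C * ∑ j ∈ s, q' j (x m - x n) ≤ C * (s.card * (ε / ((C + 1) * (s.card + 1)))) := by gcongr
      _ = ε * (C * s.card) / ((C + 1) * (s.card + 1)) := by ring
      _ < ε := by
        rw [div_lt_iff₀ (by positivity)]
        have : C * s.card < (C + 1) * (s.card + 1) := by
          nlinarith [s.card.cast_nonneg (α := ℝ), mul_nonneg hC (s.card.cast_nonneg (α := ℝ))]
        gcongr
  exact ⟨a, fun j => tendsto_of_le_mul_sum (h j) ha⟩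

theorem DominatedBy.of_le {ι : Type*} {p : Seminorm ℂ X} {q : ι → Seminorm ℂ X} {i : ι} {C : ℝ}
    (hC : 0 ≤ C) (h : ∀ x, p x ≤ C * q i x) : DominatedBy p q :=
  ⟨{i}, C, hC, fun x => by simpa using h x⟩

/-- The closed graph theorem for linear maps between spaces with countable complete families of
seminorms. -/
theorem closedGraph {ι κ : Type*} [Countable ι] [Countable κ] {q : ι → Seminorm ℂ X}
    {r : κ → Seminorm ℂ Y} (hqc : SeqComplete q) (hrc : SeqComplete r) (T : X →ₗ[ℂ] Y)
    (hT : ∀ (x : ℕ → X) (y : Y), (∀ i, Tendsto (fun n => q i (x n)) atTop (𝓝 0)) →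
      (∀ j, Tendsto (fun n => r j (T (x n) - y)) atTop (𝓝 0)) → ∀ j, r j y = 0) (j : κ) :
    DominatedBy ((r j).comp T) q := by
  obtain ⟨Q, hQ, hQq, hqQ⟩ := exists_monotone_family q
  obtain ⟨R, hR, hRr, hrR⟩ := exists_monotone_family r
  have hq1 : ∀ i, DominatedBy (q i) Q := fun i => by
    obtain ⟨n, hn⟩ := hqQ i
    exact DominatedBy.of_le zero_le_one fun x => by rw [one_mul]; exact hn x
  have hr1 : ∀ i, DominatedBy (r i) R := fun i => by
    obtain ⟨n, hn⟩ := hrR i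
    exact DominatedBy.of_le zero_le_one fun x => by rw [one_mul]; exact hn x
  have hr0 : ∀ y, (∀ j, r j y = 0) → ∀ n, R n y = 0 := fun y hy n => by
    obtain ⟨s, C, -, h⟩ := hRr n
    exact le_antisymm ((h y).trans (by simp [hy])) (apply_nonneg _ _)
  obtain ⟨k, hk⟩ := hrR j
  obtain ⟨n, C, hC, h⟩ := closedGraph_monotone hQ hR
    (seqComplete_of_dominated hQq hq1 hqc) (seqComplete_of_dominated hRr hr1 hrc) T
    (fun x y hx hy => hr0 y (hT x y (fun i => tendsto_of_le_mul_sum (hq1 i) hx)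
      fun j => tendsto_of_le_mul_sum (hr1 j) hy)) k
  obtain ⟨s, D, hD, h'⟩ := hQq n
  refine ⟨s, C * D, mul_nonneg hC hD, fun x => ((hk (T x)).trans (h x)).trans ?_⟩
  rw [mul_assoc]
  exact mul_le_mul_of_nonneg_left (h' x) hC

end ClosedGraph

section
variable {A : Type u} {B : Type v} [PreCStarAlgebra A] [PreCStarAlgebra B]

/-! ### Representations on Hilbert spaces in arbitrary universes -/

section Representations

open TensorProduct

universe x y

theorem exists_small_hilbert (G : Type x) [NormedAddCommGroup G] [InnerProductSpace ℂ G]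
    [CompleteSpace G] [Small.{u} G] :
    ∃ (H' : Type u) (_ : NormedAddCommGroup H') (_ : InnerProductSpace ℂ H')
      (_ : CompleteSpace H'), Nonempty (H' ≃ₗᵢ[ℂ] G) := by
  let e : Shrink.{u} G ≃ₗ[ℂ] G := Shrink.linearEquiv ℂ G
  let i1 : NormedAddCommGroup (Shrink.{u} G) := NormedAddCommGroup.induced _ G e e.injective
  have hn : ∀ z, ‖z‖ = ‖e z‖ := fun _ => rfl
  let i2 : InnerProductSpace ℂ (Shrink.{u} G) :=
    { norm_smul_le := fun c z => by
        change ‖e (c • z)‖ ≤ ‖c‖ * ‖e z‖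
        rw [map_smul, norm_smul]
      inner := fun z w => inner ℂ (e z) (e w)
      norm_sq_eq_re_inner := fun z => norm_sq_eq_re_inner (𝕜 := ℂ) (e z)
      conj_inner_symm := fun z w => inner_conj_symm _ _
      add_left := fun z w t => by
        change inner ℂ (e (z + w)) (e t) = inner ℂ (e z) (e t) + inner ℂ (e w) (e t)
        rw [map_add, inner_add_left]
      smul_left := fun z w c => by
        change inner ℂ (e (c • z)) (e w) = _ * inner ℂ (e z) (e w)
        rw [map_smul, inner_smul_left] }
  let f : Shrink.{u} G ≃ₗᵢ[ℂ] G := ⟨e, fun z => rfl⟩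
  exact ⟨Shrink.{u} G, i1, i2, f.toIsometryEquiv.completeSpace_iff.2 inferInstance, ⟨f⟩⟩

variable {H : Type x} [NormedAddCommGroup H] [InnerProductSpace ℂ H] {K : Type y}
  [NormedAddCommGroup K] [InnerProductSpace ℂ K]

/-- The operators `(π ⊗ ρ)(X)` on `H ⊗ K`, for representations on Hilbert spaces of any
universes. -/
def pairRep [CompleteSpace H] [CompleteSpace K] (π : A →⋆ₐ[ℂ] (H →L[ℂ] H))
    (ρ : B →⋆ₐ[ℂ] (K →L[ℂ] K)) :
    A ⊗[ℂ] B →ₗ[ℂ] ((H ⊗[ℂ] K) →L[ℂ] (H ⊗[ℂ] K)) :=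
  TensorProduct.lift (LinearMap.mk₂ ℂ (fun a b => mapL (π a) (ρ b))
    (fun a a' b => by rw [map_add, mapL_add_left]) (fun c a b => by rw [map_smul, mapL_smul_left])
    (fun a b b' => by rw [map_add, mapL_add_right])
    (fun c a b => by rw [map_smul, mapL_smul_right]))

variable [CompleteSpace H] [CompleteSpace K]

theorem pairRep_tmul_apply (π : A →⋆ₐ[ℂ] (H →L[ℂ] H)) (ρ : B →⋆ₐ[ℂ] (K →L[ℂ] K)) (a : A) (b : B)
    (h : H) (k : K) : pairRep π ρ (a ⊗ₜ[ℂ] b) (h ⊗ₜ[ℂ] k) = π a h ⊗ₜ[ℂ] ρ b k := rfl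

theorem tensorRep_eq_pairRep (π : HilbertRep A) (ρ : HilbertRep B) (X : A ⊗[ℂ] B) :
    tensorRep π ρ X = pairRep π.π ρ.π X := by
  induction X with
  | zero => simp
  | add X Y hX hY => simp [hX, hY]
  | tmul a b =>
    rw [tensorRep_tmul]
    ext v
    induction v with
    | zero => simp
    | add v w hv hw => rw [map_add, map_add, hv, hw]
    | tmul h k => simp [pairRep_tmul_apply]

theorem pairRep_map_eq {H' : Type*} [NormedAddCommGroup H'] [InnerProductSpace ℂ H']
    [CompleteSpace H'] {A' : Type*} [PreCStarAlgebra A'] (φ : A' →ₗ[ℂ] A)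
    (π : A →⋆ₐ[ℂ] (H →L[ℂ] H)) (π' : A' →⋆ₐ[ℂ] (H' →L[ℂ] H'))
    (ρ : B →⋆ₐ[ℂ] (K →L[ℂ] K)) (V : H' →ₗ[ℂ] H) (hV : ∀ a z, V (π' a z) = π (φ a) (V z))
    (X : A' ⊗[ℂ] B) (v : H' ⊗[ℂ] K) :
    pairRep π ρ (φ.rTensor B X) (TensorProduct.map V LinearMap.id v) =
      TensorProduct.map V LinearMap.id (pairRep π' ρ X v) := by
  induction X with
  | zero => simp
  | add X Y hX hY => simp [hX, hY]
  | tmul a b =>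
    induction v with
    | zero => simp
    | add v w hv hw => rw [map_add, map_add, map_add, map_add, hv, hw]
    | tmul h k => simp [pairRep_tmul_apply, hV]

theorem exists_small_rep (π : A →⋆ₐ[ℂ] (H →L[ℂ] H)) {n : ℕ} (h : Fin n → H) :
    ∃ (H' : Type u) (_ : NormedAddCommGroup H') (_ : InnerProductSpace ℂ H')
      (_ : CompleteSpace H') (V : H' →ₗᵢ[ℂ] H) (π' : A →⋆ₐ[ℂ] (H' →L[ℂ] H')),
      (∀ a z, V (π' a z) = π a (V z)) ∧ (∀ a, ‖π' a‖ ≤ ‖π a‖) ∧ ∀ i, ∃ z, V z = h i := by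
  classical
  let T : (Fin n → A) →ₗ[ℂ] H := ∑ i, (LinearMap.applyₗ (R := ℂ) (h i) ∘ₗ
    ContinuousLinearMap.coeLM ℂ ∘ₗ (π : A →ₐ[ℂ] (H →L[ℂ] H)).toLinearMap ∘ₗ LinearMap.proj i)
  have hT : ∀ a, T a = ∑ i, π (a i) (h i) := fun a => by
    simp only [T, LinearMap.sum_apply]; rfl
  let G := (LinearMap.range T).topologicalClosure
  have : CompleteSpace G := (Submodule.isClosed_topologicalClosure _).completeSpace_coe
  have hsmall : Small.{u} G := by
    let f : (ℕ → Fin n → A) → G := fun s =>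
      if hs : ∃ g : G, Tendsto (fun i => T (s i)) atTop (𝓝 (g : H)) then hs.choose else 0
    refine small_of_surjective (f := f) fun g => ?_
    obtain ⟨s, hs, hlim⟩ := mem_closure_iff_seq_limit.1 g.2
    choose t ht using hs
    have hg : ∃ g : G, Tendsto (fun i => T (t i)) atTop (𝓝 (g : H)) := ⟨g, by simpa [ht] using hlim⟩
    refine ⟨t, ?_⟩
    simp only [f, dif_pos hg]
    exact Subtype.ext (tendsto_nhds_unique hg.choose_spec (by simpa [ht] using hlim))
  obtain ⟨H', i1, i2, i3, ⟨e⟩⟩ := exists_small_hilbert.{u} G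
  let V : H' →ₗᵢ[ℂ] H := G.subtypeₗᵢ.comp e.toLinearIsometry
  have hVG : ∀ z, V z ∈ G := fun z => (e z).2
  have hVsurj : ∀ g ∈ G, ∃ z, V z = g := fun g hg => ⟨e.symm ⟨g, hg⟩, by simp [V]⟩
  have hinv : ∀ a, ∀ g ∈ G, π a g ∈ G := by
    intro a g hg
    refine map_mem_closure (π a).continuous hg ?_
    rintro _ ⟨c, rfl⟩
    refine ⟨fun i => a * c i, ?_⟩
    rw [hT, hT, map_sum]
    simp
  let W : H' →L[ℂ] H := V.toContinuousLinearMap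
  have hWV : ∀ z, W z = V z := fun _ => rfl
  have hadj : ∀ z, ContinuousLinearMap.adjoint W (V z) = z := fun z => by
    refine ext_inner_right ℂ fun w => ?_
    rw [ContinuousLinearMap.adjoint_inner_left, hWV, V.inner_map_map]
  have hadj' : ∀ g ∈ G, V (ContinuousLinearMap.adjoint W g) = g := fun g hg => by
    obtain ⟨z, rfl⟩ := hVsurj g hg
    rw [hadj]
  let φ : A → (H' →L[ℂ] H') := fun a => ContinuousLinearMap.adjoint W ∘L π a ∘L W
  have hφ : ∀ a z, φ a z = ContinuousLinearMap.adjoint W (π a (V z)) := fun _ _ => rfl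
  have hφV : ∀ a z, V (φ a z) = π a (V z) := fun a z => hadj' _ (hinv a _ (hVG z))
  let π' : A →⋆ₐ[ℂ] (H' →L[ℂ] H') :=
    { toFun := φ
      map_one' := by ext z; rw [hφ, map_one]; exact hadj z
      map_mul' := fun a b => by
        ext z
        apply V.injective
        change V (φ (a * b) z) = V (φ a (φ b z))
        rw [hφV, hφV, hφV, map_mul]; rfl
      map_zero' := by ext z; rw [hφ, map_zero]; simp
      map_add' := fun a b => by ext z; simp [hφ]
      commutes' := fun c => by
        ext z
        apply V.injective
        rw [hφV, AlgHomClass.commutes, ContinuousLinearMap.algebraMap_apply,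
          ContinuousLinearMap.algebraMap_apply, map_smul]
      map_star' := fun a => by
        rw [ContinuousLinearMap.star_eq_adjoint]
        ext z
        refine ext_inner_right ℂ fun w => ?_
        rw [ContinuousLinearMap.adjoint_inner_left, hφ, hφ,
          ContinuousLinearMap.adjoint_inner_left, ContinuousLinearMap.adjoint_inner_right, map_star,
          ContinuousLinearMap.star_eq_adjoint, ContinuousLinearMap.adjoint_inner_left]
        rfl }
  refine ⟨H', i1, i2, i3, V, π', hφV, fun a => ?_, fun i => hVsurj _ ?_⟩
  · refine ContinuousLinearMap.opNorm_le_bound _ (norm_nonneg _) fun z => ?_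
    rw [← V.norm_map (π' a z), ← V.norm_map z]
    change ‖V (φ a z)‖ ≤ _
    rw [hφV]
    exact (π a).le_opNorm _
  · refine Submodule.le_topologicalClosure _ ⟨Pi.single i 1, ?_⟩
    rw [hT, Finset.sum_eq_single i]
    · simp
    · intro j _ hj; simp [Pi.single_eq_of_ne hj]
    · simp

/-- The minimal norm dominates representations on Hilbert spaces of any universe. -/
theorem norm_pairRep_le (π : A →⋆ₐ[ℂ] (H →L[ℂ] H)) (hπ : ∀ a, ‖π a‖ ≤ ‖a‖) (ρ : HilbertRep B)
    (X : A ⊗[ℂ] B) : ‖pairRep π ρ.π X‖ ≤ minNorm X := by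
  refine ContinuousLinearMap.opNorm_le_bound _ (minNorm_nonneg X) fun v => ?_
  obtain ⟨n, h, k, hv⟩ : ∃ (n : ℕ) (h : Fin n → H) (k : Fin n → ρ.H),
      v = ∑ i, h i ⊗ₜ[ℂ] k i := by
    obtain ⟨s, hs⟩ := TensorProduct.exists_finset v
    let e := s.equivFin
    refine ⟨s.card, fun i => (e.symm i).1.1, fun i => (e.symm i).1.2, ?_⟩
    rw [hs, ← Finset.sum_coe_sort s]
    exact (e.symm.sum_comp _).symm
  obtain ⟨H', i1, i2, i3, V, π', hV, hn, hh⟩ := exists_small_rep π h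
  choose z hz using hh
  let r : HilbertRep A := { H := H', π := π', contractive := fun a => (hn a).trans (hπ a) }
  have hv' : v = TensorProduct.map V.toLinearMap LinearMap.id (∑ i, z i ⊗ₜ[ℂ] k i) := by
    rw [hv, map_sum]
    simp [hz]
  have h1 := pairRep_map_eq (LinearMap.id : A →ₗ[ℂ] A) π π' ρ.π V.toLinearMap hV X
    (∑ i, z i ⊗ₜ[ℂ] k i)
  rw [LinearMap.rTensor_id, LinearMap.id_apply] at h1
  have hiso : ∀ w : H' ⊗[ℂ] ρ.H, ‖TensorProduct.map V.toLinearMap LinearMap.id w‖ = ‖w‖ :=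
    fun w => TensorProduct.norm_map V LinearIsometry.id w
  rw [hv', h1, hiso, hiso]
  have h2 := le_minNorm X r ρ
  rw [repNorm, tensorRep_eq_pairRep] at h2
  exact ((pairRep π' ρ.π X).le_opNorm _).trans (mul_le_mul_of_nonneg_right h2 (norm_nonneg _))

theorem minNorm_tmul_le (a : A) (b : B) : minNorm (a ⊗ₜ[ℂ] b) ≤ ‖a‖ * ‖b‖ :=
  minNorm_le (by positivity) fun π ρ => repNorm_tmul_le π ρ a b

theorem minNorm_rTensor_le {A' : Type x} [PreCStarAlgebra A'] (φ : A' →⋆ₐ[ℂ] A)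
    (hφ : ∀ a, ‖φ a‖ ≤ ‖a‖) (X : A' ⊗[ℂ] B) :
    minNorm ((φ : A' →ₐ[ℂ] A).toLinearMap.rTensor B X) ≤ minNorm X := by
  refine minNorm_le (minNorm_nonneg _) fun π ρ => ?_
  rw [repNorm, tensorRep_eq_pairRep]
  have h := pairRep_map_eq (φ : A' →ₐ[ℂ] A).toLinearMap π.π (π.π.comp φ) ρ.π LinearMap.id
    (fun _ _ => rfl) X
  have h' : pairRep π.π ρ.π ((φ : A' →ₐ[ℂ] A).toLinearMap.rTensor B X) =
      pairRep (π.π.comp φ) ρ.π X := by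
    ext v
    simpa using h v
  rw [h']
  exact norm_pairRep_le (A := A') (π.π.comp φ)
    (fun a => (π.contractive (φ a)).trans (hφ a)) ρ X

theorem minNorm_comm_le (X : A ⊗[ℂ] B) : minNorm (TensorProduct.comm ℂ A B X) ≤ minNorm X := by
  refine minNorm_le (minNorm_nonneg _) fun ρ π => ?_
  rw [repNorm, tensorRep_eq_pairRep]
  have h : ∀ v : π.H ⊗[ℂ] ρ.H, pairRep ρ.π π.π (TensorProduct.comm ℂ A B X)
      (TensorProduct.comm ℂ _ _ v) = TensorProduct.comm ℂ _ _ (pairRep π.π ρ.π X v) := by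
    intro v
    induction X with
    | zero => simp
    | add X Y hX hY => simp [hX, hY]
    | tmul a b =>
      induction v with
      | zero => simp
      | add v w hv hw => rw [map_add, map_add, map_add, map_add, hv, hw]
      | tmul h k => simp [pairRep_tmul_apply]
  refine ContinuousLinearMap.opNorm_le_bound _ (minNorm_nonneg _) fun w => ?_
  obtain ⟨v, rfl⟩ := (TensorProduct.comm ℂ π.H ρ.H).surjective w
  rw [h, TensorProduct.norm_comm, TensorProduct.norm_comm]
  have h2 := le_minNorm X π ρ
  rw [repNorm, tensorRep_eq_pairRep] at h2
  exact (ContinuousLinearMap.le_opNorm _ _).trans (mul_le_mul_of_nonneg_right h2 (norm_nonneg _))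

theorem minNorm_comm (X : A ⊗[ℂ] B) : minNorm (TensorProduct.comm ℂ A B X) = minNorm X :=
  le_antisymm (minNorm_comm_le X) (by
    have h := minNorm_comm_le (TensorProduct.comm ℂ A B X)
    have e : TensorProduct.comm ℂ B A (TensorProduct.comm ℂ A B X) = X :=
      (TensorProduct.comm ℂ A B).symm_apply_apply X
    rwa [e] at h)

end Representations

/-! ### Functions of exponential type and derivations of C*-algebras -/

section Bernstein

theorem norm_le_of_exponentialType_aux {f : ℂ → ℂ} {σ C L : ℝ} (hf : Differentiable ℂ f)
    (hC : ∀ z, ‖f z‖ ≤ C * Real.exp (σ * ‖z‖)) (hL : ∀ t : ℝ, ‖f t‖ ≤ L) (hσ : 0 ≤ σ) {w : ℂ}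
    (hw : 0 ≤ w.re) : ‖f (-Complex.I * w)‖ ≤ L * Real.exp (σ * w.re) := by
  let g : ℂ → ℂ := fun w => f (-Complex.I * w) * Complex.exp (-(σ * w))
  have hg : Differentiable ℂ g := by fun_prop
  have hgn : ∀ w, ‖g w‖ = ‖f (-Complex.I * w)‖ * Real.exp (-(σ * w.re)) := fun w => by
    simp [g, Complex.norm_exp]
  have hI : ∀ w : ℂ, ‖-Complex.I * w‖ = ‖w‖ := fun w => by simp
  have hC0 : 0 ≤ C := by
    have := (norm_nonneg _).trans (hC 0)
    simpa using this
  have hmain : ‖g w‖ ≤ L := by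
    refine PhragmenLindelof.right_half_plane_of_bounded_on_real hg.diffContOnCl
      ⟨1, by norm_num, 2 * σ, ?_⟩ ?_ (fun y => ?_) hw
    · refine Asymptotics.IsBigO.of_bound C (Eventually.of_forall fun z => ?_)
      rw [hgn, Real.rpow_one, Real.norm_of_nonneg (Real.exp_pos _).le]
      calc _ ≤ (C * Real.exp (σ * ‖z‖)) * Real.exp (σ * ‖z‖) := by
            refine mul_le_mul ((hC _).trans_eq (by rw [hI])) (Real.exp_le_exp.2 ?_)
              (Real.exp_pos _).le (by positivity)
            rw [← mul_neg]
            exact mul_le_mul_of_nonneg_left ((neg_le_abs _).trans (Complex.abs_re_le_norm z)) hσ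
        _ = C * Real.exp (2 * σ * ‖z‖) := by
            rw [mul_assoc, ← Real.exp_add]; congr 2; ring
    · refine ⟨C, eventually_map.2 ?_⟩
      filter_upwards [eventually_ge_atTop 0] with x hx
      rw [hgn]
      calc _ ≤ (C * Real.exp (σ * x)) * Real.exp (-(σ * x)) := by
            gcongr
            · refine (hC _).trans_eq ?_
              rw [hI, Complex.norm_real, Real.norm_of_nonneg hx]
            · simp
        _ = C := by rw [mul_assoc, ← Real.exp_add]; simp
    · rw [hgn]
      have : -Complex.I * (y * Complex.I) = (y : ℂ) := by
        linear_combination (-(y : ℂ)) * Complex.I_mul_I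
      rw [this]
      simpa using hL y
  rw [hgn, Real.exp_neg] at hmain
  rwa [← div_eq_mul_inv, div_le_iff₀ (Real.exp_pos _)] at hmain

/-- A weak form of Bernstein's inequality: the derivative at `0` of an entire function of
exponential type `σ`, bounded by `L` on the real line, is at most `L * exp σ`. -/
theorem norm_deriv_le_of_exponentialType {f : ℂ → ℂ} {σ C L : ℝ} (hf : Differentiable ℂ f)
    (hC : ∀ z, ‖f z‖ ≤ C * Real.exp (σ * ‖z‖)) (hL : ∀ t : ℝ, ‖f t‖ ≤ L) (hσ : 0 ≤ σ) :
    ‖deriv f 0‖ ≤ L * Real.exp σ := by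
  have hL0 : 0 ≤ L := (norm_nonneg _).trans (hL 0)
  have key : ∀ z : ℂ, ‖z‖ = 1 → ‖f z‖ ≤ L * Real.exp σ := by
    have h1 : ∀ w : ℂ, 0 ≤ w.re → ‖w‖ = 1 → L * Real.exp (σ * w.re) ≤ L * Real.exp σ := by
      intro w _ hw
      have : w.re ≤ 1 := hw ▸ Complex.re_le_norm w
      gcongr
      nlinarith
    intro z hz
    rcases le_total 0 (Complex.I * z).re with h | h
    · have h2 := norm_le_of_exponentialType_aux hf hC hL hσ h
      have e : -Complex.I * (Complex.I * z) = z := by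
        linear_combination (-z) * Complex.I_mul_I
      rw [e] at h2
      exact h2.trans (h1 _ h (by simpa using hz))
    · have h' : 0 ≤ (-(Complex.I * z)).re := by simpa using h
      have h2 := norm_le_of_exponentialType_aux (f := fun z => f (-z)) (by fun_prop)
        (fun z => by simpa using hC (-z)) (fun t => by simpa using hL (-t)) hσ h'
      have e : -(-Complex.I * (-(Complex.I * z))) = z := by
        linear_combination (-z) * Complex.I_mul_I
      simp only [e] at h2
      exact h2.trans (h1 _ h' (by simpa using hz))
  have h := Complex.norm_deriv_le_of_forall_mem_sphere_norm_le one_pos hf.diffContOnCl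
    (c := 0) fun z hz => key z (by simpa using hz)
  simpa using h

theorem norm_exp_clm_le {V : Type*} [NormedAddCommGroup V] [NormedSpace ℂ V]
    (d : V →L[ℂ] V) (z : ℂ) : ‖NormedSpace.exp (z • d)‖ ≤ Real.exp (‖d‖ * ‖z‖) := by
  rw [NormedSpace.exp_eq_tsum ℂ]
  have hsum := NormedSpace.expSeries_div_hasSum_exp (‖d‖ * ‖z‖)
  rw [← Real.exp_eq_exp_ℝ] at hsum
  refine tsum_of_norm_bounded hsum fun n => ?_
  rw [norm_smul, norm_inv, div_eq_inv_mul]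
  have h1 : ‖((n.factorial : ℕ) : ℂ)‖ = n.factorial := Complex.norm_natCast _
  rw [h1]
  have h2 : ‖(z • d) ^ n‖ ≤ ‖z • d‖ ^ n := by
    rcases n.eq_zero_or_pos with rfl | hn
    · rw [pow_zero, pow_zero]; exact ContinuousLinearMap.norm_id_le
    · exact norm_pow_le' _ hn
  rw [norm_smul, mul_comm] at h2
  gcongr

variable {V : Type*} [NormedAddCommGroup V] [NormedSpace ℂ V] [CompleteSpace V]

theorem exp_neg_mul_exp (d : V →L[ℂ] V) (z : ℂ) :
    NormedSpace.exp ((-z) • d) * NormedSpace.exp (z • d) = 1 := by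
  have hder : ∀ z, HasDerivAt (fun z : ℂ => NormedSpace.exp ((-z) • d) * NormedSpace.exp (z • d))
      0 z := by
    intro z
    have h1 := (hasDerivAt_exp_smul_const d (-z)).scomp z (hasDerivAt_neg z)
    have h2 := hasDerivAt_exp_smul_const' d z
    refine (h1.mul h2).congr_deriv ?_
    simp [mul_assoc]
  have := is_const_of_deriv_eq_zero (fun z => (hder z).differentiableAt)
    (fun z => (hder z).deriv) z 0
  simpa using this

theorem exp_mul_exp_neg (d : V →L[ℂ] V) (z : ℂ) :
    NormedSpace.exp (z • d) * NormedSpace.exp ((-z) • d) = 1 := by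
  simpa using exp_neg_mul_exp d (-z)

theorem hasDerivAt_exp_smul_apply (d : V →L[ℂ] V) (a : V) (z : ℂ) :
    HasDerivAt (fun z : ℂ => NormedSpace.exp (z • d) a) (d (NormedSpace.exp (z • d) a)) z := by
  have h := (hasDerivAt_exp_smul_const' d z).clm_apply (hasDerivAt_const z a)
  simpa using h

theorem hasDerivAt_exp_smul_apply_real (d : V →L[ℂ] V) (a : V) (t : ℝ) :
    HasDerivAt (fun t : ℝ => (NormedSpace.exp ((t : ℂ) • d) : V →L[ℂ] V) a)
      (d ((NormedSpace.exp ((t : ℂ) • d) : V →L[ℂ] V) a)) t := by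
  have h := (hasDerivAt_exp_smul_apply d a (t : ℂ)).scomp t Complex.ofRealCLM.hasDerivAt
  simpa using! h

theorem exp_zero_smul_apply (d : V →L[ℂ] V) (z : ℂ) (hz : z = 0) (a : V) :
    (NormedSpace.exp (z • d) : V →L[ℂ] V) a = a := by
  simp [hz]

theorem eq_exp_smul_apply (d : V →L[ℂ] V) {F : ℝ → V}
    (hF : ∀ t, HasDerivAt F (d (F t)) t) {a : V} (h0 : F 0 = a) (t : ℝ) :
    F t = NormedSpace.exp ((t : ℂ) • d) a := by
  subst h0
  have hder : ∀ t, HasDerivAt (fun t : ℝ => NormedSpace.exp ((-t) • d) (F t)) 0 t := by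
    intro t
    have h1 := (hasDerivAt_exp_smul_const d (-t)).scomp t (hasDerivAt_neg t)
    have h1' := (ContinuousLinearMap.restrictScalarsL ℂ V V ℝ ℝ).hasFDerivAt.comp_hasDerivAt t h1
    have h2 := h1'.clm_apply (hF t)
    refine h2.congr_deriv ?_
    simp
  have := is_const_of_deriv_eq_zero (fun z => (hder z).differentiableAt)
    (fun z => (hder z).deriv) t 0
  have e : ((-t : ℝ)) • d = (-(t : ℂ)) • d := by
    rw [← Complex.ofReal_neg]; rfl
  simp only [e, neg_zero, zero_smul, NormedSpace.exp_zero] at this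
  have h2 := congrArg (NormedSpace.exp ((t : ℂ) • d) : V →L[ℂ] V) this
  have h3 : NormedSpace.exp ((t : ℂ) • d) (NormedSpace.exp ((-(t : ℂ)) • d) (F t)) = F t :=
    congrArg (fun T : V →L[ℂ] V => T (F t)) (exp_mul_exp_neg d t)
  exact h3.symm.trans h2

/-- The automorphism `exp (t d)` for a bounded `*`-derivation `d`. -/
def expDer {A : Type u} [CStarAlgebra A] (d : A →L[ℂ] A)
    (hd : ∀ a b, d (a * b) = d a * b + a * d b) (hs : ∀ a, d (star a) = star (d a)) (t : ℝ) :
    A →⋆ₐ[ℂ] A :=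
  have hder := hasDerivAt_exp_smul_apply_real d
  have h0 := exp_zero_smul_apply d ((0 : ℝ) : ℂ) Complex.ofReal_zero
  have h1 : d 1 = 0 := by simpa using hd 1 1
  have hone : (NormedSpace.exp ((t : ℂ) • d) : A →L[ℂ] A) 1 = 1 :=
    (eq_exp_smul_apply d (F := fun _ => 1) (fun t => by
      rw [h1]; exact hasDerivAt_const _ _) rfl t).symm
  { toFun := fun a => (NormedSpace.exp ((t : ℂ) • d) : A →L[ℂ] A) a
    map_one' := hone
    map_mul' := fun a b => by
      have h := eq_exp_smul_apply d (F := fun t : ℝ =>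
        (NormedSpace.exp ((t : ℂ) • d) : A →L[ℂ] A) a *
          (NormedSpace.exp ((t : ℂ) • d) : A →L[ℂ] A) b) (fun t => by
        rw [hd]; exact (hder a t).mul (hder b t)) (by rw [h0, h0]) t
      exact h.symm
    map_zero' := map_zero _
    map_add' := map_add _
    commutes' := fun c => by
      rw [Algebra.algebraMap_eq_smul_one, map_smul, hone]
    map_star' := fun a => by
      have h := eq_exp_smul_apply d (F := fun t : ℝ =>
        star ((NormedSpace.exp ((t : ℂ) • d) : A →L[ℂ] A) a)) (fun t => by
        rw [hs]; exact (hder a t).star) (by rw [h0]) t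
      exact h.symm }

theorem minNorm_rTensor_derivation_le {A : Type u} {B : Type v} [CStarAlgebra A]
    [PreCStarAlgebra B] (d : A →L[ℂ] A) (hd : ∀ a b, d (a * b) = d a * b + a * d b)
    (hs : ∀ a, d (star a) = star (d a)) (X : A ⊗[ℂ] B) :
    minNorm (d.toLinearMap.rTensor B X) ≤ Real.exp ‖d‖ * minNorm X := by
  have hexp : ∀ t : ℝ, minNorm ((NormedSpace.exp ((t : ℂ) • d) : A →L[ℂ] A).toLinearMap.rTensor B X)
      ≤ minNorm X := fun t =>
    by
      have e : (NormedSpace.exp ((t : ℂ) • d) : A →L[ℂ] A).toLinearMap =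
          ((expDer d hd hs t : A →⋆ₐ[ℂ] A) : A →ₐ[ℂ] A).toLinearMap := LinearMap.ext fun a => rfl
      rw [e]
      exact minNorm_rTensor_le _ (fun a => NonUnitalStarAlgHom.norm_apply_le _ a) X
  refine minNorm_le (mul_nonneg (Real.exp_pos _).le (minNorm_nonneg X)) fun π ρ => ?_
  refine ContinuousLinearMap.opNorm_le_bound _
    (mul_nonneg (Real.exp_pos _).le (minNorm_nonneg X)) fun v => ?_
  have key : ∀ w, ‖⟪w, tensorRep π ρ (d.toLinearMap.rTensor B X) v⟫_ℂ‖ ≤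
      (minNorm X * (‖w‖ * ‖v‖)) * Real.exp ‖d‖ := by
    intro w
    let ℓ : A ⊗[ℂ] B →ₗ[ℂ] ℂ :=
      { toFun := fun Y => ⟪w, tensorRep π ρ Y v⟫_ℂ
        map_add' := fun Y Z => by rw [map_add]; simp [inner_add_right]
        map_smul' := fun c Y => by
          rw [map_smul]
          exact inner_smul_right (𝕜 := ℂ) w (tensorRep π ρ Y v) c }
    have hℓ : ∀ Y, ‖ℓ Y‖ ≤ minNorm Y * (‖w‖ * ‖v‖) := fun Y => by
      refine (norm_inner_le_norm (𝕜 := ℂ) w (tensorRep π ρ Y v)).trans ?_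
      have h1 := (tensorRep π ρ Y).le_opNorm v
      have h2 := le_minNorm Y π ρ
      rw [repNorm] at h2
      calc _ ≤ ‖w‖ * (minNorm Y * ‖v‖) := by
            gcongr; exact h1.trans (mul_le_mul_of_nonneg_right h2 (norm_nonneg _))
        _ = _ := by ring
    have hcont : ∀ b, ∃ L : A →L[ℂ] ℂ, ∀ a, L a = ℓ (a ⊗ₜ[ℂ] b) := fun b =>
      ⟨(ℓ ∘ₗ (TensorProduct.mk ℂ A B).flip b).mkContinuous (‖b‖ * (‖w‖ * ‖v‖)) fun a => by
        refine (hℓ _).trans ?_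
        calc _ ≤ (‖a‖ * ‖b‖) * (‖w‖ * ‖v‖) := by
              gcongr; exact minNorm_tmul_le a b
          _ = _ := by ring, fun a => rfl⟩
    let f : ℂ → ℂ := fun z => ℓ ((NormedSpace.exp (z • d) : A →L[ℂ] A).toLinearMap.rTensor B X)
    have hf : ∀ z, HasDerivAt f (ℓ (d.toLinearMap.rTensor B
        ((NormedSpace.exp (z • d) : A →L[ℂ] A).toLinearMap.rTensor B X))) z := by
      intro z
      simp only [f]
      clear hexp
      induction X with
      | zero => simpa using hasDerivAt_const z (0 : ℂ)
      | add X Y hX hY =>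
        have h := HasDerivAt.fun_add hX hY
        simp only [map_add]
        exact h
      | tmul a b =>
        obtain ⟨L, hL⟩ := hcont b
        simp only [LinearMap.rTensor_tmul, ContinuousLinearMap.coe_coe, ← hL]
        exact L.hasFDerivAt.comp_hasDerivAt z (hasDerivAt_exp_smul_apply d a z)
    have hC : ∃ C, ∀ z, ‖f z‖ ≤ C * Real.exp (‖d‖ * ‖z‖) := by
      simp only [f]
      clear hexp hf f
      induction X with
      | zero => exact ⟨0, fun z => by simp⟩
      | add X Y hX hY =>
        obtain ⟨C, hC⟩ := hX
        obtain ⟨D, hD⟩ := hY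
        refine ⟨C + D, fun z => ?_⟩
        rw [map_add, map_add, add_mul]
        exact (norm_add_le _ _).trans (add_le_add (hC z) (hD z))
      | tmul a b =>
        obtain ⟨L, hL⟩ := hcont b
        refine ⟨‖L‖ * ‖a‖, fun z => ?_⟩
        simp only [LinearMap.rTensor_tmul, ContinuousLinearMap.coe_coe, ← hL]
        calc _ ≤ ‖L‖ * (‖(NormedSpace.exp (z • d) : A →L[ℂ] A)‖ * ‖a‖) :=
              (L.le_opNorm _).trans (by gcongr; exact ContinuousLinearMap.le_opNorm _ _)
          _ ≤ ‖L‖ * (Real.exp (‖d‖ * ‖z‖) * ‖a‖) := by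
              gcongr; exact norm_exp_clm_le d z
          _ = _ := by ring
    obtain ⟨C, hC⟩ := hC
    have h := norm_deriv_le_of_exponentialType (fun z => (hf z).differentiableAt) hC
      (L := minNorm X * (‖w‖ * ‖v‖)) (fun t => (hℓ _).trans
        (mul_le_mul_of_nonneg_right (hexp t) (by positivity))) (norm_nonneg d)
    have e : (NormedSpace.exp ((0 : ℂ) • d) : A →L[ℂ] A).toLinearMap = LinearMap.id :=
      LinearMap.ext fun a => exp_zero_smul_apply d 0 rfl a
    rw [(hf 0).deriv, e, LinearMap.rTensor_id] at h
    exact h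
  rcases eq_or_ne (tensorRep π ρ (d.toLinearMap.rTensor B X) v) 0 with h0 | h0
  · rw [h0, norm_zero]
    exact mul_nonneg (mul_nonneg (Real.exp_pos _).le (minNorm_nonneg X)) (norm_nonneg _)
  · have h := key (tensorRep π ρ (d.toLinearMap.rTensor B X) v)
    have hpos := norm_pos_iff.2 h0
    have h' : ‖tensorRep π ρ (d.toLinearMap.rTensor B X) v‖ ^ 2 ≤
        (minNorm X * (‖tensorRep π ρ (d.toLinearMap.rTensor B X) v‖ * ‖v‖)) * Real.exp ‖d‖ := by
      refine le_trans (le_of_eq ?_) h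
      have h2 := inner_self_eq_norm_sq_to_K (𝕜 := ℂ)
        (tensorRep π ρ (d.toLinearMap.rTensor B X) v)
      rw [congrArg norm h2, norm_pow]
      simp
    refine le_of_mul_le_mul_right (a := ‖tensorRep π ρ (d.toLinearMap.rTensor B X) v‖) ?_ hpos
    nlinarith

theorem ClosableStarDerivation.eq_of_tendsto {A : Type u} [PreCStarAlgebra A]
    (δ : ClosableStarDerivation A) {x : ℕ → A} {a b : A} (hx : Tendsto x atTop (𝓝 a))
    (hb : Tendsto (fun n => δ.toLinearMap (x n)) atTop (𝓝 b)) : b = δ.toLinearMap a := by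
  have h1 : Tendsto (fun n => x n - a) atTop (𝓝 0) := by simpa using hx.sub_const a
  have h2 : Tendsto (fun n => δ.toLinearMap (x n - a)) atTop (𝓝 (b - δ.toLinearMap a)) := by
    simp only [map_sub]
    exact hb.sub_const _
  have h3 := δ.closable' _ h1 h2.cauchySeq
  exact sub_eq_zero.1 (tendsto_nhds_unique h2 h3)

/-- A closable derivation of a C*-algebra is bounded. -/
theorem ClosableStarDerivation.exists_clm {A : Type u} [CStarAlgebra A]
    (δ : ClosableStarDerivation A) : ∃ d : A →L[ℂ] A, d.toLinearMap = δ.toLinearMap := by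
  have hc : Continuous δ.toLinearMap := by
    refine LinearMap.continuous_of_seq_closed_graph _ fun x a b hx hb => ?_
    exact δ.eq_of_tendsto hx hb
  exact ⟨⟨δ.toLinearMap, hc⟩, rfl⟩

theorem ClosableStarDerivation.exists_minNorm_rTensor_le {A : Type u} {B : Type v} [CStarAlgebra A]
    [PreCStarAlgebra B] (δ : ClosableStarDerivation A) :
    ∃ C : ℝ, 0 ≤ C ∧ ∀ X : A ⊗[ℂ] B, minNorm (δ.toLinearMap.rTensor B X) ≤ C * minNorm X := by
  obtain ⟨d, hd⟩ := δ.exists_clm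
  have hd' : ∀ a, d a = δ.toLinearMap a := fun a => congrArg (fun T : A →ₗ[ℂ] A => T a) hd
  refine ⟨Real.exp ‖d‖, (Real.exp_pos _).le, fun X => ?_⟩
  rw [← hd]
  exact minNorm_rTensor_derivation_le d
    (fun a b => by simp only [hd']; exact δ.leibniz' a b)
    (fun a => by simp only [hd']; exact δ.star' a) X

theorem ClosableStarDerivation.exists_minNorm_lTensor_le {A : Type u} {B : Type v}
    [PreCStarAlgebra A] [CStarAlgebra B] (δ : ClosableStarDerivation B) :
    ∃ C : ℝ, 0 ≤ C ∧ ∀ X : A ⊗[ℂ] B, minNorm (δ.toLinearMap.lTensor A X) ≤ C * minNorm X := by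
  obtain ⟨C, hC, h⟩ := δ.exists_minNorm_rTensor_le (B := A)
  refine ⟨C, hC, fun X => ?_⟩
  have := h (TensorProduct.comm ℂ A B X)
  rw [minNorm_comm] at this
  rw [← minNorm_comm]
  have e : TensorProduct.comm ℂ A B (δ.toLinearMap.lTensor A X) =
      δ.toLinearMap.rTensor A (TensorProduct.comm ℂ A B X) := by
    clear this
    induction X with
    | zero => simp
    | add X Y hX hY => simp only [map_add, hX, hY]
    | tmul a b => simp
  rwa [e]

end Bernstein

end

/-! ### Calculus on convex sets -/

section ConvexCalculus

variable {E : Type*} [NormedAddCommGroup E] [NormedSpace ℝ E]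
  {F : Type*} [NormedAddCommGroup F] [NormedSpace ℝ F] {K : Set E}

theorem hasFDerivWithinAt_of_tendstoUniformlyOn (hK : Convex ℝ K) {f : ℕ → E → F} {g : E → F}
    {f' : ℕ → E → E →L[ℝ] F} {g' : E → E →L[ℝ] F}
    (hf : ∀ n, ∀ y ∈ K, HasFDerivWithinAt (f n) (f' n y) K y)
    (hg : ∀ y ∈ K, Tendsto (fun n => f n y) atTop (𝓝 (g y)))
    (hu : TendstoUniformlyOn f' g' atTop K) {x : E} (hx : x ∈ K) :
    HasFDerivWithinAt g (g' x) K x := by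
  rw [hasFDerivWithinAt_iff_isLittleO, Asymptotics.isLittleO_iff]
  intro c hc
  have hε : 0 < c / 4 := by positivity
  obtain ⟨N, hN⟩ := eventually_atTop.1 (Metric.tendstoUniformlyOn_iff.1 hu _ hε)
  have h1 : ∀ y ∈ K, ‖(g y - f N y) - (g x - f N x)‖ ≤ 2 * (c / 4) * ‖y - x‖ := by
    intro y hy
    have h2 : ∀ m ≥ N, ‖(f m y - f N y) - (f m x - f N x)‖ ≤ 2 * (c / 4) * ‖y - x‖ := by
      intro m hm
      refine hK.norm_image_sub_le_of_norm_hasFDerivWithin_le (f := fun z => f m z - f N z)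
        (fun z hz => (hf m z hz).sub (hf N z hz)) (fun z hz => ?_) hx hy
      have h3 := hN m hm z hz
      have h4 := hN N le_rfl z hz
      rw [dist_eq_norm] at h3 h4
      calc ‖f' m z - f' N z‖ = ‖(g' z - f' N z) - (g' z - f' m z)‖ := by congr 1; abel
        _ ≤ _ := (norm_sub_le _ _).trans (by linarith)
    refine le_of_tendsto ((((hg y hy).sub_const (f N y)).sub
      ((hg x hx).sub_const (f N x))).norm) ?_
    filter_upwards [eventually_ge_atTop N] with m hm using h2 m hm
  have h5 := Asymptotics.isLittleO_iff.1 (hasFDerivWithinAt_iff_isLittleO.1 (hf N x hx)) hε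
  filter_upwards [h5, self_mem_nhdsWithin] with y hy hyK
  have h6 := hN N le_rfl x hx
  rw [dist_eq_norm] at h6
  have h7 : ‖(g' x - f' N x) (y - x)‖ ≤ c / 4 * ‖y - x‖ :=
    (ContinuousLinearMap.le_opNorm _ _).trans (by gcongr)
  have e : g y - g x - g' x (y - x) = ((g y - f N y) - (g x - f N x)) +
      (f N y - f N x - f' N x (y - x)) - (g' x - f' N x) (y - x) := by
    rw [ContinuousLinearMap.sub_apply]; abel
  rw [e]
  have h8 := h1 y hyK
  refine (norm_sub_le _ _).trans ((add_le_add (norm_add_le _ _) le_rfl).trans ?_)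
  linarith

/-- Limits of smooth functions on a convex set, all of whose derivatives converge uniformly. -/
theorem contDiffOn_of_tendstoUniformlyOn (hK : Convex ℝ K) (hd : UniqueDiffOn ℝ K)
    {f : ℕ → E → F} {g : E → F} (hf : ∀ n, ContDiffOn ℝ ∞ (f n) K)
    (hg : ∀ y ∈ K, Tendsto (fun n => f n y) atTop (𝓝 (g y)))
    {p : (k : ℕ) → E → E [×k]→L[ℝ] F}
    (hp : ∀ k, TendstoUniformlyOn (fun n => iteratedFDerivWithin ℝ k (f n) K) (p k) atTop K) :
    ContDiffOn ℝ ∞ g K ∧ ∀ k, ∀ x ∈ K, iteratedFDerivWithin ℝ k g K x = p k x := by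
  have hT : HasFTaylorSeriesUpToOn ∞ g (fun x k => p k x) K := by
    have hfT := fun n => (hf n).ftaylorSeriesWithin hd
    have hder : ∀ m : ℕ, ∀ x ∈ K, HasFDerivWithinAt (p m) (p (m + 1) x).curryLeft K x := by
      intro m x hx
      refine hasFDerivWithinAt_of_tendstoUniformlyOn hK
        (f' := fun n y => (iteratedFDerivWithin ℝ (m + 1) (f n) K y).curryLeft)
        (g' := fun y => (p (m + 1) y).curryLeft)
        (fun n y hy => (hfT n).fderivWithin m (by exact_mod_cast WithTop.coe_lt_top _) y hy)
        (fun y hy => (hp m).tendsto_at hy) ?_ hx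
      have := (continuousMultilinearCurryLeftEquiv ℝ (fun _ : Fin (m + 1) => E) F).isometry
      exact this.uniformContinuous.comp_tendstoUniformlyOn (hp (m + 1))
    refine ⟨fun x hx => ?_, fun m _ x hx => hder m x hx, fun m _ x hx =>
      (hder m x hx).continuousWithinAt⟩
    have h1 : Tendsto (fun n => (iteratedFDerivWithin ℝ 0 (f n) K x).curry0) atTop
        (𝓝 (p 0 x).curry0) :=
      ((continuousMultilinearCurryFin0 ℝ E F).continuous.tendsto _).comp ((hp 0).tendsto_at hx)
    exact tendsto_nhds_unique h1 (hg x hx)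
  exact ⟨hT.contDiffOn, fun k x hx =>
    (hT.eq_iteratedFDerivWithin_of_uniqueDiffOn (by exact_mod_cast le_top) hd hx).symm⟩

theorem exists_multilinear_norm_le {ι : Type*} [Fintype ι] (b : Module.Basis ι ℝ E)
    [FiniteDimensional ℝ E] (k : ℕ) : ∃ C : ℝ, 0 ≤ C ∧ ∀ T : E [×k]→L[ℝ] F,
      ‖T‖ ≤ C * ∑ r : Fin k → ι, ‖T (fun i => b (r i))‖ := by
  classical
  let φ : E →L[ℝ] (ι → ℝ) := LinearMap.toContinuousLinearMap b.equivFun.toLinearMap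
  have hφ : ∀ v i, |b.repr v i| ≤ ‖φ‖ * ‖v‖ := fun v i =>
    (norm_le_pi_norm (φ v) i).trans (φ.le_opNorm v)
  refine ⟨‖φ‖ ^ k, by positivity, fun T => ?_⟩
  refine ContinuousMultilinearMap.opNorm_le_bound
    (by positivity) fun m => ?_
  have e : T m = ∑ r : Fin k → ι, (∏ i, b.repr (m i) (r i)) • T (fun i => b (r i)) := by
    have hm : m = fun i => ∑ j, b.repr (m i) j • b j := funext fun i => (b.sum_repr (m i)).symm
    conv_lhs => rw [hm]
    rw [ContinuousMultilinearMap.map_sum]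
    refine Finset.sum_congr rfl fun r _ => ?_
    exact ContinuousMultilinearMap.map_smul_univ T _ _
  rw [e, Finset.mul_sum, Finset.sum_mul]
  refine (norm_sum_le _ _).trans (Finset.sum_le_sum fun r _ => ?_)
  rw [norm_smul, norm_prod]
  have : ∏ i, ‖b.repr (m i) (r i)‖ ≤ ‖φ‖ ^ k * ∏ i, ‖m i‖ := by
    calc _ ≤ ∏ i, (‖φ‖ * ‖m i‖) := Finset.prod_le_prod (fun _ _ => norm_nonneg _)
          fun i _ => hφ _ _
      _ = _ := by rw [Finset.prod_mul_distrib]; simp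
  calc _ ≤ (‖φ‖ ^ k * ∏ i, ‖m i‖) * ‖T fun i => b (r i)‖ := by gcongr
    _ = _ := by ring

/-- The iterated directional derivative within `K`. -/
def dirDerivs (K : Set E) (l : List E) (g : E → F) : E → F :=
  l.foldr (fun v h y => fderivWithin ℝ h K y v) g

theorem dirDerivs_nil (g : E → F) : dirDerivs K [] g = g := rfl

theorem dirDerivs_cons (v : E) (l : List E) (g : E → F) :
    dirDerivs K (v :: l) g = fun y => fderivWithin ℝ (dirDerivs K l g) K y v := rfl

theorem ContDiffOn.fderivWithin_infty_apply {g : E → F} (hd : UniqueDiffOn ℝ K)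
    (hg : ContDiffOn ℝ ∞ g K) (v : E) : ContDiffOn ℝ ∞ (fun y => fderivWithin ℝ g K y v) K :=
  (hg.fderivWithin hd (m := ∞) (by simp)).clm_apply contDiffOn_const

theorem contDiffOn_dirDerivs (hd : UniqueDiffOn ℝ K) {g : E → F} (hg : ContDiffOn ℝ ∞ g K)
    (l : List E) : ContDiffOn ℝ ∞ (dirDerivs K l g) K := by
  induction l with
  | nil => exact hg
  | cons v l ih => exact ContDiffOn.fderivWithin_infty_apply hd ih v

theorem iteratedFDerivWithin_apply_eq_dirDerivs (hd : UniqueDiffOn ℝ K) {g : E → F}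
    (hg : ContDiffOn ℝ ∞ g K) {k : ℕ} (m : Fin k → E) {y : E} (hy : y ∈ K) :
    iteratedFDerivWithin ℝ k g K y m = dirDerivs K (List.ofFn m) g y := by
  induction k generalizing y with
  | zero => simp [dirDerivs]
  | succ k ih =>
    rw [iteratedFDerivWithin_succ_apply_left, List.ofFn_succ, dirDerivs_cons]
    have hdiff : DifferentiableWithinAt ℝ (iteratedFDerivWithin ℝ k g K) K y :=
      (hg.differentiableOn_iteratedFDerivWithin (by exact_mod_cast WithTop.coe_lt_top _) hd) y hy
    have h1 := (ContinuousMultilinearMap.apply ℝ (fun _ : Fin k => E) F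
      (Fin.tail m)).hasFDerivAt.comp_hasFDerivWithinAt y hdiff.hasFDerivWithinAt
    have h2 := h1.congr (f₁ := dirDerivs K (List.ofFn fun i => m i.succ) g)
      (fun z hz => (ih _ hz).symm) (ih _ hy).symm
    beta_reduce
    rw [h2.fderivWithin (hd y hy)]
    rfl

theorem dirDerivs_congr (hd : UniqueDiffOn ℝ K) {g h : E → F} (hgh : EqOn g h K) (l : List E) :
    EqOn (dirDerivs K l g) (dirDerivs K l h) K := by
  induction l with
  | nil => exact hgh
  | cons v l ih =>
    intro y hy
    simp only [dirDerivs_cons]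
    rw [fderivWithin_congr ih (ih hy)]

end ConvexCalculus

/-! ### Weakly smooth functions are smooth -/

section WeaklySmooth

variable {E : Type*} [NormedAddCommGroup E] [NormedSpace ℝ E] {K : Set E}

theorem fderivWithin_infty_continuousOn {F : Type*} [NormedAddCommGroup F] [NormedSpace ℝ F]
    {g : E → F} (hd : UniqueDiffOn ℝ K) (hg : ContDiffOn ℝ ∞ g K) :
    ContinuousOn (fderivWithin ℝ g K) K :=
  hg.continuousOn_fderivWithin hd (by simp)

theorem hasFDerivWithinAt_of_infty {F : Type*} [NormedAddCommGroup F] [NormedSpace ℝ F]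
    {g : E → F} (hg : ContDiffOn ℝ ∞ g K) {x : E} (hx : x ∈ K) :
    HasFDerivWithinAt g (fderivWithin ℝ g K x) K x :=
  ((hg.differentiableOn (by simp)) x hx).hasFDerivWithinAt

section Dual

variable {X : Type*} [NormedAddCommGroup X] [NormedSpace ℂ X] [CompleteSpace X]

theorem exists_bound_of_closedGraph {W : Type*} [NormedAddCommGroup W] [NormedSpace ℂ W]
    [CompleteSpace W] (hc : IsCompact K) (T : X → E → W)
    (hadd : ∀ φ ψ, ∀ x ∈ K, T (φ + ψ) x = T φ x + T ψ x)
    (hsmul : ∀ (c : ℂ) φ, ∀ x ∈ K, T (c • φ) x = c • T φ x) (hT : ∀ φ, ContinuousOn (T φ) K)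
    (hclosed : ∀ (φ : ℕ → X) (ψ : X) (G : E → W), Tendsto φ atTop (𝓝 ψ) →
      TendstoUniformlyOn (fun n => T (φ n)) G atTop K → ∀ x ∈ K, G x = T ψ x) :
    ∃ C : ℝ, 0 ≤ C ∧ ∀ φ, ∀ x ∈ K, ‖T φ x‖ ≤ C * ‖φ‖ := by
  classical
  have : CompactSpace K := isCompact_iff_compactSpace.1 hc
  let S : X →ₗ[ℂ] C(K, W) :=
    { toFun := fun φ => ⟨K.restrict (T φ), (hT φ).restrict⟩
      map_add' := fun φ ψ => by ext1 x; exact hadd φ ψ x x.2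
      map_smul' := fun c φ => by ext1 x; exact hsmul c φ x x.2 }
  have hcont : Continuous S := by
    refine LinearMap.continuous_of_seq_closed_graph _ fun φ ψ G hφ hG => ?_
    ext1 x
    have hu := ContinuousMap.tendsto_iff_tendstoUniformly.1 hG
    have := hclosed φ ψ (fun y => if hy : y ∈ K then G ⟨y, hy⟩ else 0) hφ (by
      rw [Metric.tendstoUniformlyOn_iff]
      intro ε hε
      filter_upwards [Metric.tendstoUniformly_iff.1 hu ε hε] with n hn y hy
      rw [dif_pos hy]
      exact hn ⟨y, hy⟩) x x.2
    rwa [dif_pos x.2] at this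
  let S' : X →L[ℂ] C(K, W) := ⟨S, hcont⟩
  exact ⟨‖S'‖, norm_nonneg _, fun φ x hx =>
    ((S' φ).norm_coe_le_norm ⟨x, hx⟩).trans (S'.le_opNorm φ)⟩

theorem exists_bound_fderivWithin (hK : Convex ℝ K) (hc : IsCompact K) (hd : UniqueDiffOn ℝ K)
    {h : E → X →L[ℂ] ℂ} (hh : ∀ φ, ContDiffOn ℝ ∞ (fun y => h y φ) K) :
    ∃ C : ℝ, 0 ≤ C ∧ ∀ φ, ∀ x ∈ K, ‖fderivWithin ℝ (fun y => h y φ) K x‖ ≤ C * ‖φ‖ := by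
  have hdiff : ∀ φ, ∀ x ∈ K, HasFDerivWithinAt (fun y => h y φ)
      (fderivWithin ℝ (fun y => h y φ) K x) K x := fun φ x hx =>
    hasFDerivWithinAt_of_infty (hh φ) hx
  refine exists_bound_of_closedGraph hc (fun φ => fderivWithin ℝ (fun y => h y φ) K)
    (fun φ ψ x hx => ?_) (fun c φ x hx => ?_)
    (fun φ => fderivWithin_infty_continuousOn hd (hh φ)) (fun φ ψ G hφ hG x hx => ?_)
  · have h1 := ((hdiff φ x hx).add (hdiff ψ x hx)).congr'
      (f₁ := fun y => h y (φ + ψ)) (fun y _ => by simp) hx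
    exact h1.fderivWithin (hd x hx)
  · have h1 := ((hdiff φ x hx).const_smul c).congr'
      (f₁ := fun y => h y (c • φ)) (fun y _ => by simp) hx
    exact h1.fderivWithin (hd x hx)
  · exact ((hasFDerivWithinAt_of_tendstoUniformlyOn hK (f := fun n y => h y (φ n))
      (g := fun y => h y ψ) (fun n y hy => hdiff _ y hy)
      (fun y _ => ((h y).continuous.tendsto ψ).comp hφ) hG hx).fderivWithin (hd x hx)).symm

theorem continuousOn_of_weakStar (hK : Convex ℝ K) (hc : IsCompact K) (hd : UniqueDiffOn ℝ K)
    {h : E → X →L[ℂ] ℂ} (hh : ∀ φ, ContDiffOn ℝ ∞ (fun y => h y φ) K) : ContinuousOn h K := by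
  obtain ⟨C, hC, hb⟩ := exists_bound_fderivWithin hK hc hd hh
  have hl : ∀ x ∈ K, ∀ y ∈ K, ‖h y - h x‖ ≤ C * ‖y - x‖ := by
    intro x hx y hy
    refine ContinuousLinearMap.opNorm_le_bound _ (by positivity) fun φ => ?_
    have := hK.norm_image_sub_le_of_norm_hasFDerivWithin_le
      (fun z hz => hasFDerivWithinAt_of_infty (hh φ) hz) (fun z hz => hb φ z hz) hx hy
    rw [ContinuousLinearMap.sub_apply]
    linarith
  refine (LipschitzOnWith.of_dist_le_mul (K := ⟨C, hC⟩) fun x hx y hy => ?_).continuousOn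
  rw [dist_eq_norm, dist_eq_norm]
  exact hl y hy x hx

theorem eventually_norm_sub_lt {W : Type*} [NormedAddCommGroup W] {L : E → W} {x : E}
    (hL : ContinuousWithinAt L K x) {c : ℝ} (hc : 0 < c) : ∀ᶠ z in 𝓝[K] x, ‖L z - L x‖ < c := by
  have h1 := (hL.sub (continuousWithinAt_const (b := L x))).norm
  have h2 : Tendsto (fun z => ‖L z - L x‖) (𝓝[K] x) (𝓝 ‖L x - L x‖) := h1
  rw [sub_self, norm_zero] at h2
  exact h2.eventually (gt_mem_nhds hc)

theorem exists_hasFDerivWithinAt_of_weakStar [FiniteDimensional ℝ E] (hK : Convex ℝ K)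
    (hc : IsCompact K) (hd : UniqueDiffOn ℝ K) {h : E → X →L[ℂ] ℂ}
    (hh : ∀ φ, ContDiffOn ℝ ∞ (fun y => h y φ) K) {x : E} (hx : x ∈ K) :
    ∃ L : E →L[ℝ] (X →L[ℂ] ℂ), HasFDerivWithinAt h L K x := by
  classical
  obtain ⟨C, hC, hb⟩ := exists_bound_fderivWithin hK hc hd hh
  have hdiff : ∀ φ, ∀ x ∈ K, HasFDerivWithinAt (fun y => h y φ)
      (fderivWithin ℝ (fun y => h y φ) K x) K x := fun φ x hx =>
    hasFDerivWithinAt_of_infty (hh φ) hx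
  let L : E → E →L[ℝ] (X →L[ℂ] ℂ) := fun x => if hx : x ∈ K then
    LinearMap.toContinuousLinearMap
    { toFun := fun v => LinearMap.mkContinuous
        { toFun := fun φ => fderivWithin ℝ (fun y => h y φ) K x v
          map_add' := fun φ ψ => by
            have h1 := ((hdiff φ x hx).add (hdiff ψ x hx)).congr'
              (f₁ := fun y => h y (φ + ψ)) (fun y _ => by simp) hx
            rw [h1.fderivWithin (hd x hx)]; rfl
          map_smul' := fun c φ => by
            have h1 := ((hdiff φ x hx).const_smul c).congr'
              (f₁ := fun y => h y (c • φ)) (fun y _ => by simp) hx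
            rw [h1.fderivWithin (hd x hx)]; rfl } (C * ‖v‖) fun φ => by
        refine (ContinuousLinearMap.le_opNorm _ v).trans ?_
        calc _ ≤ (C * ‖φ‖) * ‖v‖ := by gcongr; exact hb φ x hx
          _ = _ := by ring
      map_add' := fun v w => by ext φ; simp
      map_smul' := fun c v => by ext φ; simp } else 0
  have hL : ∀ x ∈ K, ∀ v φ, L x v φ = fderivWithin ℝ (fun y => h y φ) K x v := fun x hx v φ => by
    simp only [L, dif_pos hx]; rfl
  have hLc : ContinuousOn L K := continuousOn_clm_apply.2 fun v =>
    continuousOn_of_weakStar hK hc hd fun φ =>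
      (ContDiffOn.fderivWithin_infty_apply hd (hh φ) v).congr fun y hy => hL y hy v φ
  refine ⟨L x, ?_⟩
  rw [hasFDerivWithinAt_iff_isLittleO, Asymptotics.isLittleO_iff]
  intro c hc0
  have hLx : ∀ᶠ z in 𝓝[K] x, ‖L z - L x‖ < c :=
    eventually_norm_sub_lt (W := E →L[ℝ] X →L[ℂ] ℂ) (hLc x hx) hc0
  obtain ⟨r, hr, hball⟩ := Metric.mem_nhdsWithin_iff.1 hLx
  filter_upwards [self_mem_nhdsWithin, mem_nhdsWithin_of_mem_nhds (Metric.ball_mem_nhds x hr)]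
    with y hy hyr
  refine ContinuousLinearMap.opNorm_le_bound _ (by positivity) fun φ => ?_
  have hs : Convex ℝ (K ∩ Metric.ball x r) := hK.inter (convex_ball x r)
  have := hs.norm_image_sub_le_of_norm_hasFDerivWithin_le' (C := c * ‖φ‖)
    (φ := fderivWithin ℝ (fun y => h y φ) K x)
    (fun z hz => (hdiff φ z hz.1).mono inter_subset_left) (fun z hz => by
      refine ContinuousLinearMap.opNorm_le_bound _ (by positivity) fun v => ?_
      rw [ContinuousLinearMap.sub_apply, ← hL z hz.1, ← hL x hx]
      have h1 : ‖L z - L x‖ ≤ c := (hball ⟨hz.2, hz.1⟩).le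
      calc ‖L z v φ - L x v φ‖ = ‖(L z - L x) v φ‖ := rfl
        _ ≤ ‖(L z - L x) v‖ * ‖φ‖ := ContinuousLinearMap.le_opNorm _ _
        _ ≤ (c * ‖v‖) * ‖φ‖ := by
          gcongr
          exact (ContinuousLinearMap.le_opNorm _ _).trans (by gcongr)
        _ = _ := by ring) ⟨hx, Metric.mem_ball_self hr⟩ ⟨hy, hyr⟩
  rw [← hL x hx] at this
  calc _ = ‖h y φ - h x φ - L x (y - x) φ‖ := rfl
    _ ≤ _ := this
    _ = _ := by ring

end Dual

theorem hasFDerivWithinAt_of_isometry {Q Z : Type*} [NormedAddCommGroup Q] [NormedSpace ℝ Q]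
    [CompleteSpace Q] [NormedAddCommGroup Z] [NormedSpace ℝ Z] (j : Q → Z)
    (hadd : ∀ p q, j (p + q) = j p + j q) (hsmul : ∀ (c : ℝ) q, j (c • q) = c • j q)
    (hnorm : ∀ q, ‖j q‖ = ‖q‖) {g : E → Q} {x : E} (hx : x ∈ K) (hd : UniqueDiffWithinAt ℝ K x) {D : E →L[ℝ] Z}
    (hD : HasFDerivWithinAt (fun y => j (g y)) D K x) :
    ∃ D' : E →L[ℝ] Q, HasFDerivWithinAt g D' K x := by
  let J : Q →ₗᵢ[ℝ] Z := ⟨⟨⟨j, hadd⟩, hsmul⟩, hnorm⟩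
  change HasFDerivWithinAt (fun y => J (g y)) D K x at hD
  let S : Submodule ℝ Z := LinearMap.range J.toLinearMap
  have hS : IsClosed (S : Set Z) := by
    have := J.isometry.isClosedEmbedding.isClosed_range
    exact this
  have hmem : ∀ v, D v ∈ S := by
    intro v
    have h1 := (S.mkQL).hasFDerivAt.comp_hasFDerivWithinAt x hD
    have h2 : HasFDerivWithinAt (S.mkQL ∘ fun y => J (g y)) (0 : E →L[ℝ] Z ⧸ S) K x := by
      refine (hasFDerivWithinAt_const (0 : Z ⧸ S) x K).congr' (fun y _ => ?_) hx
      exact (Submodule.Quotient.mk_eq_zero S).2 ⟨g y, rfl⟩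
    have h3 := congrArg (fun T : E →L[ℝ] Z ⧸ S => T v) (hd.eq h1 h2)
    exact (Submodule.Quotient.mk_eq_zero S).1 h3
  let e : Q ≃ₗᵢ[ℝ] S := J.equivRange
  let D' : E →L[ℝ] Q := (e.symm : S →L[ℝ] Q) ∘L D.codRestrict S hmem
  have hJD : ∀ v, J (D' v) = D v := fun v =>
    congrArg Subtype.val (e.apply_symm_apply ⟨D v, hmem v⟩)
  refine ⟨D', ?_⟩
  rw [hasFDerivWithinAt_iff_isLittleO] at hD ⊢
  refine (Asymptotics.IsBigO.of_bound 1 (Eventually.of_forall fun y => ?_)).trans_isLittleO hD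
  rw [one_mul, ← J.norm_map, map_sub, map_sub, hJD]

theorem contDiffOn_of_weak [FiniteDimensional ℝ E] {Q : Type*} [NormedAddCommGroup Q]
    [NormedSpace ℂ Q] [CompleteSpace Q] (hK : Convex ℝ K) (hc : IsCompact K)
    (hd : UniqueDiffOn ℝ K) {g : E → Q}
    (hg : ∀ φ : Q →L[ℂ] ℂ, ContDiffOn ℝ ∞ (fun y => φ (g y)) K) : ContDiffOn ℝ ∞ g K := by
  refine contDiffOn_infty.2 fun n => ?_
  induction n generalizing g with
  | zero =>
    have h := continuousOn_of_weakStar hK hc hd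
      (h := fun y => NormedSpace.inclusionInDoubleDualLi ℂ (g y)) hg
    rw [CharP.cast_eq_zero, contDiffOn_zero]
    exact (NormedSpace.inclusionInDoubleDualLi ℂ (E := Q)).isometry.isEmbedding.continuousOn_iff.2 h
  | succ n ih =>
    have hdiff : ∀ x ∈ K, ∃ D' : E →L[ℝ] Q, HasFDerivWithinAt g D' K x := fun x hx => by
      obtain ⟨L, hL⟩ := exists_hasFDerivWithinAt_of_weakStar hK hc hd
        (h := fun y => NormedSpace.inclusionInDoubleDualLi ℂ (g y)) hg hx
      exact hasFDerivWithinAt_of_isometry (Z := (Q →L[ℂ] ℂ) →L[ℂ] ℂ)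
        (NormedSpace.inclusionInDoubleDualLi ℂ)
        (fun p q => (NormedSpace.inclusionInDoubleDualLi ℂ (E := Q)).map_add p q)
        (fun c q => (NormedSpace.inclusionInDoubleDualLi ℂ (E := Q)).map_smul (c : ℂ) q)
        (fun q => (NormedSpace.inclusionInDoubleDualLi ℂ (E := Q)).norm_map q) hx (hd x hx) hL
    have hdOn : DifferentiableOn ℝ g K := fun x hx => (hdiff x hx).choose_spec.differentiableWithinAt
    rw [Nat.cast_succ]
    refine contDiffOn_succ_of_fderivWithin hdOn (fun h => by simp at h)
      (contDiffOn_clm_apply.2 fun v => ih fun φ => ?_)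
    refine (ContDiffOn.fderivWithin_infty_apply hd (hg φ) v).congr fun y hy => ?_
    have := ((φ.restrictScalars ℝ).hasFDerivAt.comp_hasFDerivWithinAt y
      (hdOn y hy).hasFDerivWithinAt).fderivWithin (hd y hy)
    exact (congrArg (fun T : E →L[ℝ] ℂ => T v) this).symm

end WeaklySmooth

section Charts

variable {E : Type*} [NormedAddCommGroup E] [NormedSpace ℝ E] {H : Type*} [TopologicalSpace H]
  (I : ModelWithCorners ℝ E H) {M : Type*} [TopologicalSpace M] [ChartedSpace H M]
  {Q : Type*} [NormedAddCommGroup Q] [NormedSpace ℝ Q]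

/-- A compact convex set with nonempty interior inside the target of the extended chart at `c`. -/
structure NiceChart (c : M) (K : Set E) : Prop where
  compact : IsCompact K
  convex : Convex ℝ K
  nonempty_interior : (interior K).Nonempty
  subset : K ⊆ (extChartAt I c).target

/-- The function `f` in the chart at `c`. -/
def loc (c : M) (f : M → Q) : E → Q := f ∘ (extChartAt I c).symm

variable {I}

theorem NiceChart.unique {c : M} {K : Set E} (hK : NiceChart I c K) : UniqueDiffOn ℝ K :=
  uniqueDiffOn_convex hK.convex hK.nonempty_interior

theorem loc_apply (c : M) (f : M → Q) (y : E) : loc I c f y = f ((extChartAt I c).symm y) := rfl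

theorem loc_extChartAt {c x : M} (hx : x ∈ (extChartAt I c).source) (f : M → Q) :
    loc I c f (extChartAt I c x) = f x := by
  rw [loc_apply, (extChartAt I c).left_inv hx]

theorem contDiffOn_loc [IsManifold I ∞ M] {f : M → Q} (hf : ContMDiff I 𝓘(ℝ, Q) ∞ f) (c : M) :
    ContDiffOn ℝ ∞ (loc I c f) (extChartAt I c).target :=
  (hf.comp_contMDiffOn (contMDiffOn_extChartAt_symm c)).contDiffOn

theorem range_eventuallyEq_target {c : M} {y : E} (hy : y ∈ (extChartAt I c).target) :
    (range I : Set E) =ᶠ[𝓝 y] (extChartAt I c).target := by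
  have h := extChartAt_target_mem_nhdsWithin_of_mem hy
  have h2 := extChartAt_target_subset_range (I := I) c
  rw [mem_nhdsWithin_iff_eventually] at h
  filter_upwards [h] with z hz
  exact propext ⟨fun h => hz h, fun h => h2 h⟩

theorem iteratedFDerivWithin_range_eq {c : M} {y : E} (hy : y ∈ (extChartAt I c).target) (k : ℕ)
    (g : E → Q) : iteratedFDerivWithin ℝ k g (range I) y =
      iteratedFDerivWithin ℝ k g (extChartAt I c).target y :=
  iteratedFDerivWithin_congr_set (range_eventuallyEq_target hy) k

theorem fderivWithin_range_eq {c : M} {y : E} (hy : y ∈ (extChartAt I c).target)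
    (g : E → Q) : fderivWithin ℝ g (range I) y = fderivWithin ℝ g (extChartAt I c).target y :=
  fderivWithin_congr_set (range_eventuallyEq_target hy)

theorem NiceChart.iteratedFDerivWithin_eq {c : M} {K : Set E} (hK : NiceChart I c K) {g : E → Q}
    (hg : ContDiffOn ℝ ∞ g (extChartAt I c).target) {y : E} (hy : y ∈ K) (k : ℕ) :
    iteratedFDerivWithin ℝ k g (range I) y = iteratedFDerivWithin ℝ k g K y := by
  rw [iteratedFDerivWithin_range_eq (hK.subset hy)]
  exact (iteratedFDerivWithin_subset hK.subset hK.unique (uniqueDiffOn_extChartAt_target c)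
    (hg.of_le (by exact_mod_cast le_top)) hy).symm

theorem NiceChart.fderivWithin_eq {c : M} {K : Set E} (hK : NiceChart I c K) {g : E → Q}
    (hg : ContDiffOn ℝ ∞ g (extChartAt I c).target) {y : E} (hy : y ∈ K) :
    fderivWithin ℝ g (range I) y = fderivWithin ℝ g K y := by
  rw [fderivWithin_range_eq (hK.subset hy)]
  exact (fderivWithin_subset hK.subset (hK.unique y hy)
    (hg.differentiableOn (by simp) y (hK.subset hy))).symm

theorem exists_niceChart [FiniteDimensional ℝ E] {c x : M} (hx : x ∈ (extChartAt I c).source) :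
    ∃ K : Set E, NiceChart I c K ∧ ∃ U : Set M, IsOpen U ∧ x ∈ U ∧ U ⊆ (extChartAt I c).source ∧
      ∀ z ∈ U, K ∈ 𝓝[range I] (extChartAt I c z) := by
  have hT := extChartAt_target_mem_nhdsWithin_of_mem ((extChartAt I c).map_source hx)
  obtain ⟨r, hr, hrT⟩ := (nhdsWithin_hasBasis Metric.nhds_basis_closedBall _).mem_iff.1 hT
  set y := extChartAt I c x
  have hyR : y ∈ range I := extChartAt_target_subset_range c ((extChartAt I c).map_source hx)
  refine ⟨Metric.closedBall y r ∩ range I,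
    ⟨(isCompact_closedBall y r).inter_right I.isClosed_range,
      (convex_closedBall y r).inter I.convex_range, ?_, hrT⟩,
    (extChartAt I c).source ∩ extChartAt I c ⁻¹' Metric.ball y r, ?_, ⟨hx, ?_⟩, inter_subset_left,
      ?_⟩
  · have h1 : y ∈ closure (interior (range I)) := by
      rw [I.convex_range.closure_interior_eq_closure_of_nonempty_interior I.nonempty_interior]
      exact subset_closure hyR
    obtain ⟨z, hz1, hz2⟩ := mem_closure_iff.1 h1 (Metric.ball y r) Metric.isOpen_ball
      (Metric.mem_ball_self hr)
    rw [interior_inter]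
    exact ⟨z, Metric.ball_subset_interior_closedBall hz1, hz2⟩
  · exact (continuousOn_extChartAt c).isOpen_inter_preimage (isOpen_extChartAt_source c)
      Metric.isOpen_ball
  · exact Metric.mem_ball_self hr
  · rintro z ⟨-, hz⟩
    exact inter_mem (mem_nhdsWithin_of_mem_nhds (mem_of_superset (Metric.isOpen_ball.mem_nhds hz)
      Metric.ball_subset_closedBall)) self_mem_nhdsWithin

theorem contMDiff_of_loc [IsManifold I ∞ M] {f : M → Q}
    (h : ∀ x : M, ∃ (c : M) (K : Set E), x ∈ (extChartAt I c).source ∧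
      K ∈ 𝓝[range I] (extChartAt I c x) ∧ ContDiffOn ℝ ∞ (loc I c f) K) :
    ContMDiff I 𝓘(ℝ, Q) ∞ f := by
  intro x
  obtain ⟨c, K, hx, hK, hf⟩ := h x
  rw [contMDiffAt_iff_source_of_mem_source (by simpa using hx), contMDiffWithinAt_iff_contDiffWithinAt]
  have hxR : extChartAt I c x ∈ range I :=
    extChartAt_target_subset_range c ((extChartAt I c).map_source hx)
  exact (hf _ (mem_of_mem_nhdsWithin hxR hK)).mono_of_mem_nhdsWithin hK

variable (I M) in
/-- A finite family of chart centres and nice sets whose relative interiors cover the manifold. -/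
theorem exists_niceCover [FiniteDimensional ℝ E] [CompactSpace M] :
    ∃ (t : Finset M) (K : M → Set E), (∀ c, NiceChart I c (K c)) ∧
      ∀ x : M, ∃ c ∈ t, x ∈ (extChartAt I c).source ∧ K c ∈ 𝓝[range I] (extChartAt I c x) := by
  choose K hK U hU hxU hUs hKU using fun c : M => exists_niceChart (mem_extChartAt_source (I := I) c)
  obtain ⟨t, ht⟩ := isCompact_univ.elim_finite_subcover U hU fun x _ => mem_iUnion.2 ⟨x, hxU x⟩
  refine ⟨t, K, hK, fun x => ?_⟩
  obtain ⟨c, hc, hx⟩ := mem_iUnion₂.1 (ht (mem_univ x))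
  exact ⟨c, hc, hUs c hx, hKU c x hx⟩

theorem exists_niceChart_cover [FiniteDimensional ℝ E] {c : M} {L : Set E} (hL : IsCompact L)
    (hLT : L ⊆ (extChartAt I c).target) : ∃ t : Finset (Set E), (∀ K ∈ t, NiceChart I c K) ∧
      L ⊆ ⋃ K ∈ t, K := by
  have h : ∀ y ∈ L, ∃ K : Set E, NiceChart I c K ∧ K ∈ 𝓝[L] y := fun y hy => by
    obtain ⟨K, hK, U, hU, hxU, hUs, hKU⟩ :=
      exists_niceChart ((extChartAt I c).map_target (hLT hy))
    refine ⟨K, hK, ?_⟩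
    have := hKU _ hxU
    rw [(extChartAt I c).right_inv (hLT hy)] at this
    exact nhdsWithin_mono y (hLT.trans (extChartAt_target_subset_range c)) this
  choose! K hK hKL using h
  obtain ⟨t, ht, htL⟩ := hL.elim_nhdsWithin_subcover K hKL
  classical
  refine ⟨t.image K, fun K' hK' => ?_, fun y hy => ?_⟩
  · obtain ⟨y, hy, rfl⟩ := Finset.mem_image.1 hK'
    exact hK y (ht y hy)
  · obtain ⟨z, hz, hyz⟩ := mem_iUnion₂.1 (htL hy)
    exact mem_iUnion₂.2 ⟨K z, Finset.mem_image_of_mem K hz, hyz⟩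

end Charts

section SmoothSeminorms

theorem le_nhds_iff_of_withSeminorms {X ι : Type*} [AddCommGroup X] [Module ℂ X]
    (τ : TopologicalSpace X) {q : SeminormFamily ℂ X ι} (h : WithSeminorms q) (l : Filter X)
    (x : X) : l ≤ 𝓝 x ↔ ∀ (i : ι) (ε : ℝ), 0 < ε → ∀ᶠ g in l, q i (g - x) < ε :=
  h.tendsto_nhds id x

theorem withSeminorms_of_le_nhds_iff {X ι : Type*} [AddCommGroup X] [Module ℂ X]
    {τ : TopologicalSpace X} (q : SeminormFamily ℂ X ι)
    (h : ∀ (l : Filter X) (x : X),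
      l ≤ 𝓝 x ↔ ∀ (i : ι) (ε : ℝ), 0 < ε → ∀ᶠ g in l, q i (g - x) < ε) :
    WithSeminorms q := by
  refine ⟨TopologicalSpace.ext_nhds fun f => ?_⟩
  have h1 := fun l : Filter X => le_nhds_iff_of_withSeminorms
    q.moduleFilterBasis.topology (@WithSeminorms.mk _ _ _ _ _ _ q q.moduleFilterBasis.topology rfl)
    l f
  exact le_antisymm ((h1 _).2 ((h _ _).1 le_rfl)) ((h _ _).2 ((h1 _).1 le_rfl))

theorem bddAbove_norm_image {X W : Type*} [TopologicalSpace X] [NormedAddCommGroup W] {K : Set X}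
    (hK : IsCompact K) {g : X → W} (hg : ContinuousOn g K) :
    BddAbove (range fun y : K => ‖g y‖) := by
  obtain ⟨C, hC⟩ := hK.exists_bound_of_continuousOn hg
  exact ⟨C, by rintro _ ⟨y, rfl⟩; exact hC y y.2⟩

variable {E : Type*} [NormedAddCommGroup E] [NormedSpace ℝ E] {H : Type*} [TopologicalSpace H]
  (I : ModelWithCorners ℝ E H) (M : Type*) [TopologicalSpace M] [ChartedSpace H M]
  [IsManifold I ∞ M] [CompactSpace M] (Q : Type*) [CStarAlgebra Q]

/-- Pairs of a chart and a compact subset of its target. -/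
abbrev ChartCompact : Type _ :=
  {p : M × Set E // IsCompact p.2 ∧ p.2 ⊆ (extChartAt I p.1).target}

/-- The pre-C*-algebra `C^∞(M, Q)`, with the algebraic structure of its pre-C*-algebra structure
only. -/
def SmoothAlg : Type _ := SmoothMaps I M Q

instance smoothAlgPreCStar : PreCStarAlgebra (SmoothAlg I M Q) :=
  preCStarOfSubalgebra (SmoothMaps I M Q)

instance smoothAlgFunLike : FunLike (SmoothAlg I M Q) M Q where
  coe f := (Subtype.val f : C(M, Q))
  coe_injective f g h := Subtype.ext (DFunLike.coe_injective h)

/-- The usual topology of `C^∞(M, Q)`. -/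
@[reducible] def smoothAlgTopology : TopologicalSpace (SmoothAlg I M Q) := smoothTopology I M Q

variable {I M Q}

namespace SmoothAlg

/-- A smooth map as an element of `C^∞(M, Q)`. -/
def mk (f : M → Q) (hf : ContMDiff I 𝓘(ℝ, Q) ∞ f) : SmoothAlg I M Q :=
  (⟨⟨f, hf.continuous⟩, hf⟩ : SmoothMaps I M Q)

/-- The underlying continuous map. -/
def toC (f : SmoothAlg I M Q) : C(M, Q) := Subtype.val f

@[simp] theorem coe_mk (f : M → Q) (hf : ContMDiff I 𝓘(ℝ, Q) ∞ f) : ⇑(mk f hf) = f := rfl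

theorem contMDiff (f : SmoothAlg I M Q) : ContMDiff I 𝓘(ℝ, Q) ∞ f := Subtype.prop f

theorem continuous (f : SmoothAlg I M Q) : Continuous f := f.contMDiff.continuous

theorem ext {f g : SmoothAlg I M Q} (h : ∀ x, f x = g x) : f = g := DFunLike.ext f g h

theorem add_apply (f g : SmoothAlg I M Q) (x : M) : (f + g) x = f x + g x := rfl

theorem sub_apply (f g : SmoothAlg I M Q) (x : M) : (f - g) x = f x - g x := rfl

theorem mul_apply (f g : SmoothAlg I M Q) (x : M) : (f * g) x = f x * g x := rfl

theorem smul_apply (z : ℂ) (f : SmoothAlg I M Q) (x : M) : (z • f) x = z • f x := rfl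

theorem star_apply (f : SmoothAlg I M Q) (x : M) : (star f) x = star (f x) := rfl

theorem zero_apply (x : M) : (0 : SmoothAlg I M Q) x = 0 := rfl

theorem norm_def (f : SmoothAlg I M Q) : ‖f‖ = ‖toC f‖ := rfl

theorem toC_sub (f g : SmoothAlg I M Q) : toC (f - g) = toC f - toC g := rfl

theorem norm_apply_le (f : SmoothAlg I M Q) (x : M) : ‖f x‖ ≤ ‖f‖ :=
  ContinuousMap.norm_coe_le_norm (toC f) x

theorem norm_le {f : SmoothAlg I M Q} {C : ℝ} (hC : 0 ≤ C) (h : ∀ x, ‖f x‖ ≤ C) : ‖f‖ ≤ C :=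
  (ContinuousMap.norm_le (toC f) hC).2 h

/-- Evaluation at a point, as a linear map. -/
def evalₗ (x : M) : SmoothAlg I M Q →ₗ[ℂ] Q where
  toFun f := f x
  map_add' _ _ := rfl
  map_smul' _ _ := rfl

end SmoothAlg

theorem contDiffOn_loc_coe (f : SmoothAlg I M Q) (c : M) :
    ContDiffOn ℝ ∞ (loc I c f) (extChartAt I c).target := contDiffOn_loc f.contMDiff c

/-- The `k`-th derivative of `f` in the chart at `c`. -/
def jet (c : M) (k : ℕ) (f : SmoothAlg I M Q) : E → E [×k]→L[ℝ] Q :=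
  iteratedFDerivWithin ℝ k (loc I c f) (range I)

theorem jet_eq {c : M} {y : E} (hy : y ∈ (extChartAt I c).target) (k : ℕ) (f : SmoothAlg I M Q) :
    jet c k f y = iteratedFDerivWithin ℝ k (loc I c f) (extChartAt I c).target y :=
  iteratedFDerivWithin_range_eq hy k _

theorem jet_eq_of_mem {c : M} {K : Set E} (hK : NiceChart I c K) {y : E} (hy : y ∈ K) (k : ℕ)
    (f : SmoothAlg I M Q) : jet c k f y = iteratedFDerivWithin ℝ k (loc I c f) K y :=
  hK.iteratedFDerivWithin_eq (contDiffOn_loc_coe f c) hy k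

theorem continuousOn_jet (c : M) (k : ℕ) (f : SmoothAlg I M Q) :
    ContinuousOn (jet c k f) (extChartAt I c).target :=
  ((contDiffOn_loc_coe f c).continuousOn_iteratedFDerivWithin (by exact_mod_cast le_top)
    (uniqueDiffOn_extChartAt_target c)).congr fun _ hy => jet_eq hy k f

theorem jet_add {c : M} {y : E} (hy : y ∈ (extChartAt I c).target) (k : ℕ)
    (f g : SmoothAlg I M Q) : jet c k (f + g) y = jet c k f y + jet c k g y := by
  rw [jet_eq hy, jet_eq hy, jet_eq hy]
  exact iteratedFDerivWithin_add_apply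
    ((contDiffOn_loc_coe f c y hy).of_le (by exact_mod_cast le_top))
    ((contDiffOn_loc_coe g c y hy).of_le (by exact_mod_cast le_top))
    (uniqueDiffOn_extChartAt_target c) hy

theorem jet_smul {c : M} {y : E} (hy : y ∈ (extChartAt I c).target) (k : ℕ) (z : ℂ)
    (f : SmoothAlg I M Q) : jet c k (z • f) y = z • jet c k f y := by
  rw [jet_eq hy, jet_eq hy]
  exact iteratedFDerivWithin_const_smul_apply (a := z) (f := loc I c f)
    ((contDiffOn_loc_coe f c y hy).of_le (by exact_mod_cast le_top))
    (uniqueDiffOn_extChartAt_target c) hy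

theorem jet_sub {c : M} {y : E} (hy : y ∈ (extChartAt I c).target) (k : ℕ)
    (f g : SmoothAlg I M Q) : jet c k (f - g) y = jet c k f y - jet c k g y := by
  have := jet_add hy k (f - g) g
  rw [sub_add_cancel] at this
  rw [this, add_sub_cancel_right]

variable (I M Q) in
/-- The seminorm `sup_K ‖D^k f‖`, where `K` is a compact subset of a chart target. -/
def smoothSem (i : ChartCompact I M × ℕ) : Seminorm ℂ (SmoothAlg I M Q) :=
  Seminorm.of (fun f => ⨆ y : i.1.1.2, ‖jet i.1.1.1 i.2 f y‖)
    (fun f g => Real.iSup_le (fun y => by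
        rw [jet_add (i.1.2.2 y.2)]
        exact (norm_add_le _ _).trans (add_le_add
          (le_ciSup (bddAbove_norm_image i.1.2.1 ((continuousOn_jet i.1.1.1 i.2 f).mono i.1.2.2)) y)
          (le_ciSup (bddAbove_norm_image i.1.2.1 ((continuousOn_jet i.1.1.1 i.2 g).mono i.1.2.2))
            y)))
      (add_nonneg (Real.iSup_nonneg fun _ => norm_nonneg _)
        (Real.iSup_nonneg fun _ => norm_nonneg _)))
    (fun z f => by
      rw [Real.mul_iSup_of_nonneg (norm_nonneg z)]
      congr 1
      funext y
      rw [jet_smul (i.1.2.2 y.2), norm_smul])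

theorem norm_jet_le_smoothSem (i : ChartCompact I M × ℕ) (f : SmoothAlg I M Q) {y : E}
    (hy : y ∈ i.1.1.2) : ‖jet i.1.1.1 i.2 f y‖ ≤ smoothSem I M Q i f :=
  le_ciSup (bddAbove_norm_image i.1.2.1 ((continuousOn_jet i.1.1.1 i.2 f).mono i.1.2.2))
    (⟨y, hy⟩ : i.1.1.2)

theorem smoothSem_le {i : ChartCompact I M × ℕ} {f : SmoothAlg I M Q} {C : ℝ} (hC : 0 ≤ C)
    (h : ∀ y ∈ i.1.1.2, ‖jet i.1.1.1 i.2 f y‖ ≤ C) : smoothSem I M Q i f ≤ C :=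
  Real.iSup_le (fun y => h y y.2) hC

theorem le_nhds_smoothTopology_iff_tendstoUniformlyOn {l : Filter (SmoothMaps I M Q)}
    {f : SmoothMaps I M Q} : l ≤ @nhds _ (smoothTopology I M Q) f ↔
      ∀ (c : M) (k : ℕ) (K : Set E), (IsCompact K ∧ K ⊆ (extChartAt I c).target) →
        TendstoUniformlyOn (fun (g : SmoothMaps I M Q) =>
          iteratedFDerivWithin ℝ k ((g : C(M, Q)) ∘ (extChartAt I c).symm) (range I))
          (iteratedFDerivWithin ℝ k ((f : C(M, Q)) ∘ (extChartAt I c).symm) (range I)) l K := by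
  simp only [smoothTopology, nhds_iInf, nhds_induced, le_iInf_iff, ← tendsto_iff_comap,
    UniformOnFun.tendsto_iff_tendstoUniformlyOn]
  rfl

theorem le_nhds_smoothTopology_iff {l : Filter (SmoothAlg I M Q)} {f : SmoothAlg I M Q} :
    l ≤ @nhds _ (smoothAlgTopology I M Q) f ↔
      ∀ (i : ChartCompact I M × ℕ) (ε : ℝ), 0 < ε → ∀ᶠ g in l, smoothSem I M Q i (g - f) < ε := by
  refine (le_nhds_smoothTopology_iff_tendstoUniformlyOn (I := I) (M := M) (Q := Q)).trans ?_
  constructor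
  · rintro h ⟨⟨⟨c, K⟩, hK⟩, k⟩ ε hε
    have := Metric.tendstoUniformlyOn_iff.1 (h c k K hK) (ε / 2) (by linarith)
    filter_upwards [this] with g hg
    refine (smoothSem_le (by linarith) fun y hy => ?_).trans_lt (half_lt_self hε)
    have := hg y hy
    rw [dist_comm, dist_eq_norm] at this
    rw [jet_sub (hK.2 hy)]
    exact this.le
  · intro h c k K hK
    refine Metric.tendstoUniformlyOn_iff.2 fun ε hε => ?_
    filter_upwards [h (⟨(c, K), hK⟩, k) ε hε] with g hg y hy
    rw [dist_comm, dist_eq_norm]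
    refine lt_of_le_of_lt ?_ hg
    have := norm_jet_le_smoothSem (⟨(c, K), hK⟩, k) (g - f) hy
    rwa [jet_sub (hK.2 hy)] at this

variable (I M Q) in
theorem smoothTopology_withSeminorms :
    WithSeminorms (topology := smoothAlgTopology I M Q) (smoothSem I M Q) :=
  withSeminorms_of_le_nhds_iff _ fun _ _ => le_nhds_smoothTopology_iff

end SmoothSeminorms

section Domination

variable {X : Type*} [AddCommGroup X] [Module ℂ X]

theorem DominatedBy.of_sum {ι : Type*} {p : Seminorm ℂ X} {q : ι → Seminorm ℂ X} (s : Finset ι)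
    (h : ∀ x, p x ≤ ∑ i ∈ s, q i x) : DominatedBy p q :=
  ⟨s, 1, zero_le_one, fun x => by rw [one_mul]; exact h x⟩

theorem DominatedBy.self {ι : Type*} (q : ι → Seminorm ℂ X) (i : ι) : DominatedBy (q i) q :=
  .of_le (i := i) zero_le_one fun x => (one_mul _).ge

theorem DominatedBy.trans {ι κ : Type*} {p : Seminorm ℂ X} {q : ι → Seminorm ℂ X}
    {r : κ → Seminorm ℂ X} (h : DominatedBy p q) (h' : ∀ i, DominatedBy (q i) r) :
    DominatedBy p r := by
  classical
  obtain ⟨s, C, hC, h⟩ := h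
  choose t D hD ht using h'
  refine ⟨s.biUnion t, C * ∑ i ∈ s, D i,
    mul_nonneg hC (Finset.sum_nonneg fun i _ => hD i), fun x => (h x).trans ?_⟩
  rw [mul_assoc, Finset.sum_mul]
  refine mul_le_mul_of_nonneg_left (Finset.sum_le_sum fun i hi => (ht i x).trans ?_) hC
  exact mul_le_mul_of_nonneg_left (Finset.sum_le_sum_of_subset_of_nonneg
    (Finset.subset_biUnion_of_mem t hi) fun j _ _ => apply_nonneg (r j) x) (hD i)

theorem DominatedBy.comp {Y ι : Type*} [AddCommGroup Y] [Module ℂ Y] {p : Seminorm ℂ X}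
    {q : ι → Seminorm ℂ X} (h : DominatedBy p q) (T : Y →ₗ[ℂ] X) :
    DominatedBy (p.comp T) fun i => (q i).comp T := by
  obtain ⟨s, C, hC, h⟩ := h
  exact ⟨s, C, hC, fun x => h (T x)⟩

theorem isBounded_of_dominated {ι κ : Type*} {q : SeminormFamily ℂ X ι} {r : SeminormFamily ℂ X κ}
    (h : ∀ j, DominatedBy (r j) q) : Seminorm.IsBounded q r LinearMap.id := by
  intro j
  obtain ⟨s, C, hC, h⟩ := h j
  refine ⟨s, ⟨C * s.card, by positivity⟩, fun x => ?_⟩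
  have h2 : ∀ i ∈ s, q i x ≤ s.sup q x := fun i hi => (Finset.le_sup (f := q) hi : q i ≤ s.sup q) x
  have h3 := Finset.sum_le_card_nsmul s (fun i => q i x) _ h2
  rw [nsmul_eq_mul] at h3
  calc r j x ≤ C * ∑ i ∈ s, q i x := h x
    _ ≤ C * (s.card * s.sup q x) := mul_le_mul_of_nonneg_left h3 hC
    _ = (C * s.card) * s.sup q x := by ring

theorem withSeminorms_of_dominated {ι κ : Type*} {q : SeminormFamily ℂ X ι}
    {r : SeminormFamily ℂ X κ} {τ : TopologicalSpace X} (hq : WithSeminorms q)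
    (h : ∀ j, DominatedBy (r j) q) (h' : ∀ i, DominatedBy (q i) r) : WithSeminorms r :=
  hq.congr (isBounded_of_dominated h) (isBounded_of_dominated h')

end Domination

theorem exists_tendstoUniformlyOn_of_cauchy {X W : Type*} [NormedAddCommGroup W] [CompleteSpace W]
    {K : Set X} {g : ℕ → X → W}
    (h : ∀ ε > 0, ∃ N, ∀ m ≥ N, ∀ n ≥ N, ∀ y ∈ K, ‖g m y - g n y‖ < ε) :
    ∃ p : X → W, TendstoUniformlyOn g p atTop K := by
  have hu : UniformCauchySeqOn g atTop K := Metric.uniformCauchySeqOn_iff.2 fun ε hε => by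
    obtain ⟨N, hN⟩ := h ε hε
    exact ⟨N, fun m hm n hn y hy => by rw [dist_eq_norm]; exact hN m hm n hn y hy⟩
  have hp : ∀ y, ∃ a : W, y ∈ K → Tendsto (fun n => g n y) atTop (𝓝 a) := fun y => by
    by_cases hy : y ∈ K
    · obtain ⟨a, ha⟩ := cauchySeq_tendsto_of_complete (hu.cauchySeq hy)
      exact ⟨a, fun _ => ha⟩
    · exact ⟨0, fun h => absurd h hy⟩
  choose p hp using hp
  exact ⟨p, hu.tendstoUniformlyOn_of_tendsto fun y hy => hp y hy⟩

section SmoothComplete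

variable {E : Type*} [NormedAddCommGroup E] [NormedSpace ℝ E] {H : Type*} [TopologicalSpace H]
  {I : ModelWithCorners ℝ E H} {M : Type*} [TopologicalSpace M] [ChartedSpace H M]
  [IsManifold I ∞ M] [CompactSpace M] {Q : Type*} [CStarAlgebra Q]

/-- The seminorms of a family of nice sets. -/
def niceSem {J : Type*} {c : J → M} {K : J → Set E} (hK : ∀ j, NiceChart I (c j) (K j)) (Q : Type*)
    [CStarAlgebra Q] (i : J × ℕ) : Seminorm ℂ (SmoothAlg I M Q) :=
  smoothSem I M Q (⟨(c i.1, K i.1), (hK i.1).compact, (hK i.1).subset⟩, i.2)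

variable {J : Type*} {c : J → M} {K : J → Set E} (hK : ∀ j, NiceChart I (c j) (K j))

theorem norm_jet_le_niceSem (j : J) (k : ℕ) (f : SmoothAlg I M Q) {y : E} (hy : y ∈ K j) :
    ‖iteratedFDerivWithin ℝ k (loc I (c j) f) (K j) y‖ ≤ niceSem hK Q (j, k) f := by
  rw [← jet_eq_of_mem (hK j) hy]
  exact norm_jet_le_smoothSem (⟨(c j, K j), (hK j).compact, (hK j).subset⟩, k) f hy

theorem norm_apply_le_niceSem {j : J} {x : M} (hx : x ∈ (extChartAt I (c j)).source)
    (hxK : extChartAt I (c j) x ∈ K j) (f : SmoothAlg I M Q) :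
    ‖f x‖ ≤ niceSem hK Q (j, 0) f := by
  have := norm_jet_le_niceSem hK j 0 f hxK
  rwa [norm_iteratedFDerivWithin_zero, loc_extChartAt hx] at this

theorem norm_dominatedBy_niceSem [Fintype J]
    (hc : ∀ x, ∃ j, x ∈ (extChartAt I (c j)).source ∧ K j ∈ 𝓝[range I] (extChartAt I (c j) x)) :
    DominatedBy (normSeminorm ℂ (SmoothAlg I M Q)) (niceSem hK Q) := by
  classical
  refine .of_sum (Finset.univ.image fun j => (j, 0)) fun f => ?_
  refine SmoothAlg.norm_le (Finset.sum_nonneg fun i _ => apply_nonneg _ _) fun x => ?_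
  obtain ⟨j, hx, hxK⟩ := hc x
  have hxR : extChartAt I (c j) x ∈ range I :=
    extChartAt_target_subset_range (c j) ((extChartAt I (c j)).map_source hx)
  refine (norm_apply_le_niceSem hK hx (mem_of_mem_nhdsWithin hxR hxK) f).trans ?_
  exact Finset.single_le_sum (f := fun i => niceSem hK Q i f) (fun i _ => apply_nonneg _ _)
    (Finset.mem_image_of_mem _ (Finset.mem_univ j))

theorem seqComplete_niceSem [Fintype J]
    (hc : ∀ x, ∃ j, x ∈ (extChartAt I (c j)).source ∧ K j ∈ 𝓝[range I] (extChartAt I (c j) x)) :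
    SeqComplete (niceSem hK Q) := by
  intro f hf
  have hcauchy : CauchySeq fun n => (f n).toC := by
    obtain ⟨s, C, hC, hs⟩ := norm_dominatedBy_niceSem hK (Q := Q) hc
    have hpos : 0 < C * (s.card + 1) + 1 := by positivity
    refine Metric.cauchySeq_iff.2 fun ε hε => ?_
    choose N hN using fun i => hf i (ε / (C * (s.card + 1) + 1)) (by positivity)
    refine ⟨s.sup N, fun m hm n hn => ?_⟩
    rw [dist_eq_norm, ← SmoothAlg.toC_sub, ← SmoothAlg.norm_def]
    have h1 : ‖f m - f n‖ ≤ C * ∑ i ∈ s, niceSem hK Q i (f m - f n) := hs (f m - f n)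
    have h2 : ∑ i ∈ s, niceSem hK Q i (f m - f n) ≤ s.card * (ε / (C * (s.card + 1) + 1)) := by
      rw [← nsmul_eq_mul]
      exact Finset.sum_le_card_nsmul _ _ _ fun i hi =>
        (hN i m ((Finset.le_sup hi).trans hm) n ((Finset.le_sup hi).trans hn)).le
    refine lt_of_le_of_lt (h1.trans (mul_le_mul_of_nonneg_left h2 hC)) ?_
    rw [← mul_assoc, mul_div_assoc', div_lt_iff₀ hpos]
    nlinarith
  obtain ⟨g, hg⟩ := cauchySeq_tendsto_of_complete hcauchy
  have hgx : ∀ x, Tendsto (fun n => f n x) atTop (𝓝 (g x)) := fun x =>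
    (continuous_eval_const x : Continuous fun h : C(M, Q) => h x).continuousAt.tendsto.comp hg
  have hj : ∀ j k, ∃ p : E → E [×k]→L[ℝ] Q, TendstoUniformlyOn
      (fun n => iteratedFDerivWithin ℝ k (loc I (c j) (f n)) (K j)) p atTop (K j) :=
    fun j k => exists_tendstoUniformlyOn_of_cauchy fun ε hε => by
      obtain ⟨N, hN⟩ := hf (j, k) ε hε
      refine ⟨N, fun m hm n hn y hy => lt_of_le_of_lt ?_ (hN m hm n hn)⟩
      have := norm_jet_le_niceSem hK j k (f m - f n) hy
      rwa [← jet_eq_of_mem (hK j) hy, jet_sub ((hK j).subset hy), jet_eq_of_mem (hK j) hy,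
        jet_eq_of_mem (hK j) hy] at this
  choose p hp using hj
  have key := fun j => contDiffOn_of_tendstoUniformlyOn (hK j).convex (hK j).unique
    (fun n => (contDiffOn_loc_coe (f n) (c j)).mono (hK j).subset)
    (g := loc I (c j) g) (fun y _ => hgx _) (hp j)
  let G : SmoothAlg I M Q := .mk g (contMDiff_of_loc fun x => by
    obtain ⟨j, hx, hxK⟩ := hc x
    exact ⟨c j, K j, hx, hxK, (key j).1⟩)
  refine ⟨G, fun ⟨j, k⟩ => ?_⟩
  refine Metric.tendsto_atTop.2 fun ε hε => ?_
  obtain ⟨N, hN⟩ := eventually_atTop.1 (Metric.tendstoUniformlyOn_iff.1 (hp j k) (ε / 2)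
    (by linarith))
  refine ⟨N, fun n hn => ?_⟩
  rw [Real.dist_0_eq_abs, abs_of_nonneg (apply_nonneg _ _)]
  refine lt_of_le_of_lt (smoothSem_le (by linarith) fun y hy => ?_) (half_lt_self hε)
  have := hN n hn y hy
  rw [jet_sub ((hK j).subset hy), jet_eq_of_mem (hK j) hy, jet_eq_of_mem (hK j) hy]
  have h3 := (key j).2 k y hy
  rw [dist_comm, dist_eq_norm, ← h3] at this
  exact this.le

end SmoothComplete

section ClosableContinuous

variable {S : Type*} [PreCStarAlgebra S] {ι : Type*} [Countable ι] {q : ι → Seminorm ℂ S}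

/-- Closed graph theorem: a linear map which is closable for the norm is continuous for a
complete topology finer than the norm topology. -/
theorem dominatedBy_of_closable (hq : SeqComplete q) (hn : DominatedBy (normSeminorm ℂ S) q)
    (T : S →ₗ[ℂ] S) (hT : ∀ (x : ℕ → S) (y : S), Tendsto x atTop (𝓝 0) →
      Tendsto (fun n => T (x n)) atTop (𝓝 y) → y = 0) (j : ι) :
    DominatedBy ((q j).comp T) q := by
  refine closedGraph hq hq T (fun x y hx hy => ?_) j
  suffices h : y = 0 by intro j; rw [h, map_zero]
  refine hT x y ?_ ?_
  · exact tendsto_zero_iff_norm_tendsto_zero.2 (tendsto_of_le_mul_sum hn hx)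
  · exact tendsto_iff_norm_sub_tendsto_zero.2 (tendsto_of_le_mul_sum hn hy)

theorem ClosableStarDerivation.dominatedBy (hq : SeqComplete q)
    (hn : DominatedBy (normSeminorm ℂ S) q) (δ : ClosableStarDerivation S) (j : ι) :
    DominatedBy ((q j).comp δ.toLinearMap) q :=
  dominatedBy_of_closable hq hn δ.toLinearMap
    (fun x _ hx hy => tendsto_nhds_unique hy (δ.closable' x hx hy.cauchySeq)) j

theorem iterDer_dominatedBy (hq : SeqComplete q) (hn : DominatedBy (normSeminorm ℂ S) q)
    (l : List (ClosableStarDerivation S)) (j : ι) : DominatedBy ((q j).comp (iterDer l)) q := by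
  induction l generalizing j with
  | nil => exact .self _ _
  | cons δ l ih => exact ((δ.dominatedBy hq hn j).comp (iterDer l)).trans ih

end ClosableContinuous

section SmoothDominated

variable {E : Type*} [NormedAddCommGroup E] [NormedSpace ℝ E] [FiniteDimensional ℝ E]
  {H : Type*} [TopologicalSpace H]
  {I : ModelWithCorners ℝ E H} {M : Type*} [TopologicalSpace M] [ChartedSpace H M]
  [IsManifold I ∞ M] [CompactSpace M] {Q : Type*} [CStarAlgebra Q]

variable (I M) in
/-- The centres of the charts of a finite cover by nice sets. -/
def coverCentres : Finset M := (exists_niceCover I M).choose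

variable (I M) in
/-- The nice sets of the finite cover. -/
def coverSet : M → Set E := (exists_niceCover I M).choose_spec.choose

theorem coverSet_nice (c : M) : NiceChart I c (coverSet I M c) :=
  (exists_niceCover I M).choose_spec.choose_spec.1 c

theorem exists_mem_cover (x : M) : ∃ c : coverCentres I M, x ∈ (extChartAt I (c : M)).source ∧
    coverSet I M c ∈ 𝓝[range I] (extChartAt I (c : M) x) := by
  obtain ⟨c, hc, h⟩ := (exists_niceCover I M).choose_spec.choose_spec.2 x
  exact ⟨⟨c, hc⟩, h⟩

variable (I M Q) in
/-- The seminorms of the finite cover by nice sets. -/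
def coverSem : (coverCentres I M) × ℕ → Seminorm ℂ (SmoothAlg I M Q) :=
  niceSem (fun c : coverCentres I M => coverSet_nice (c : M)) Q

theorem seqComplete_coverSem : SeqComplete (coverSem I M Q) :=
  seqComplete_niceSem _ exists_mem_cover

theorem norm_dominatedBy_coverSem :
    DominatedBy (normSeminorm ℂ (SmoothAlg I M Q)) (coverSem I M Q) :=
  norm_dominatedBy_niceSem _ exists_mem_cover

theorem eq_zero_of_coverSem_eq_zero {f : SmoothAlg I M Q} (h : ∀ i, coverSem I M Q i f = 0) :
    f = 0 := by
  obtain ⟨s, C, hC, hs⟩ := norm_dominatedBy_coverSem (I := I) (M := M) (Q := Q)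
  have := hs f
  simp only [h, Finset.sum_const_zero, mul_zero] at this
  exact norm_le_zero_iff.1 this

theorem niceChart_dominatedBy_coverSem {c : M} {K : Set E} (hK : NiceChart I c K) (k : ℕ) :
    DominatedBy (smoothSem I M Q (⟨(c, K), hK.compact, hK.subset⟩, k)) (coverSem I M Q) := by
  let c' : Option (coverCentres I M) → M := fun j => j.elim c fun j => j
  let K' : Option (coverCentres I M) → Set E := fun j => j.elim K fun j => coverSet I M j
  have hK' : ∀ j, NiceChart I (c' j) (K' j) := fun j => by
    cases j with
    | none => exact hK
    | some j => exact coverSet_nice (j : M)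
  have hc : SeqComplete (niceSem hK' Q) := seqComplete_niceSem hK' fun x => by
    obtain ⟨j, hj⟩ := exists_mem_cover (I := I) x
    exact ⟨some j, hj⟩
  refine closedGraph seqComplete_coverSem hc LinearMap.id (fun x y hx hy => ?_) (none, k)
  suffices h : y = 0 by intro j; rw [h, map_zero]
  refine eq_zero_of_coverSem_eq_zero fun i => ?_
  have h1 : Tendsto (fun n => coverSem I M Q i (x n - y)) atTop (𝓝 0) := hy (some i.1, i.2)
  have h2 := (hx i).add h1
  rw [add_zero] at h2
  refine le_antisymm (ge_of_tendsto' h2 fun n => ?_) (apply_nonneg _ _)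
  calc coverSem I M Q i y = coverSem I M Q i (x n - (x n - y)) := by rw [sub_sub_cancel]
    _ ≤ _ := map_sub_le_add _ _ _

theorem smoothSem_dominatedBy_coverSem (i : ChartCompact I M × ℕ) :
    DominatedBy (smoothSem I M Q i) (coverSem I M Q) := by
  classical
  obtain ⟨⟨⟨c, L⟩, hL⟩, k⟩ := i
  obtain ⟨t, ht, hLt⟩ := exists_niceChart_cover hL.1 hL.2
  let q : t → Seminorm ℂ (SmoothAlg I M Q) := fun K =>
    smoothSem I M Q (⟨(c, K), (ht K K.2).compact, (ht K K.2).subset⟩, k)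
  have h : DominatedBy (smoothSem I M Q (⟨(c, L), hL⟩, k)) q := by
    refine .of_sum Finset.univ fun f => smoothSem_le
      (Finset.sum_nonneg fun i _ => apply_nonneg _ _) fun y hy => ?_
    obtain ⟨K, hK, hyK⟩ := mem_iUnion₂.1 (hLt hy)
    refine le_trans ?_ (Finset.single_le_sum (f := fun i => q i f) (fun i _ => apply_nonneg _ _)
      (Finset.mem_univ ⟨K, hK⟩))
    exact norm_jet_le_smoothSem (⟨(c, K), (ht K hK).compact, (ht K hK).subset⟩, k) f hyK
  exact h.trans fun K => niceChart_dominatedBy_coverSem (ht K K.2) k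

variable (I M Q) in
theorem coverSem_withSeminorms :
    WithSeminorms (topology := smoothAlgTopology I M Q) (coverSem I M Q) :=
  withSeminorms_of_dominated (smoothTopology_withSeminorms I M Q)
    (fun _ => .self _ _) smoothSem_dominatedBy_coverSem

theorem iterDer_dominatedBy_coverSem (l : List (ClosableStarDerivation (SmoothAlg I M Q)))
    (j : coverCentres I M × ℕ) :
    DominatedBy ((coverSem I M Q j).comp (iterDer l)) (coverSem I M Q) :=
  iterDer_dominatedBy seqComplete_coverSem norm_dominatedBy_coverSem l j

theorem derSeminorm_dominatedBy_coverSem (l : List (ClosableStarDerivation (SmoothAlg I M Q))) :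
    DominatedBy (derSeminorm (SmoothAlg I M Q) l) (coverSem I M Q) :=
  (norm_dominatedBy_coverSem.comp (iterDer l)).trans fun j => iterDer_dominatedBy_coverSem l j

theorem contMDiff_of_weak {f : M → Q}
    (hf : ∀ φ : Q →L[ℂ] ℂ, ContMDiff I 𝓘(ℝ, ℂ) ∞ fun m => φ (f m)) :
    ContMDiff I 𝓘(ℝ, Q) ∞ f :=
  contMDiff_of_loc fun x => by
    obtain ⟨c, hx, hK⟩ := exists_mem_cover (I := I) x
    have hn := coverSet_nice (I := I) (c : M)
    exact ⟨c, _, hx, hK, contDiffOn_of_weak hn.convex hn.compact hn.unique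
      fun φ => (contDiffOn_loc (hf φ) c).mono hn.subset⟩

end SmoothDominated

section ChartFields

theorem eq_zero_of_tendsto_directional {E W : Type*} [NormedAddCommGroup E] [NormedSpace ℝ E]
    [NormedAddCommGroup W] [NormedSpace ℝ W] {R T : Set E} (hR : Convex ℝ R)
    (hRi : (interior R).Nonempty) (hTR : T ⊆ R) (hT : ∀ y ∈ T, T ∈ 𝓝[R] y) {g : ℕ → E → W}
    (hg : ∀ n, DifferentiableOn ℝ (g n) T) (hg0 : ∀ y ∈ T, Tendsto (fun n => g n y) atTop (𝓝 0))
    {χ : E → ℝ} (hχ : ContinuousOn χ T) {G : E → W} (hG : ContinuousOn G T) (e : E)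
    (h : TendstoUniformlyOn (fun n y => χ y • fderivWithin ℝ (g n) T y e) G atTop T) :
    ∀ y ∈ T, G y = 0 := by
  have h1 : ∀ y ∈ T, y ∈ interior R → G y = 0 := by
    intro y hy hyi
    have hTy : T ∈ 𝓝 y := by
      have := hT y hy
      rwa [nhdsWithin_eq_nhds.2 (mem_interior_iff_mem_nhds.1 hyi)] at this
    by_cases hχy : χ y = 0
    · have := h.tendsto_at hy
      simp only [hχy, zero_smul] at this
      exact tendsto_nhds_unique this tendsto_const_nhds
    have hN : {z | z ∈ T ∧ |χ y| / 2 < |χ z|} ∈ 𝓝 y := by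
      have h2 : ContinuousAt (fun z => |χ z|) y := (hχ.continuousAt hTy).abs
      exact inter_mem hTy (h2.eventually (lt_mem_nhds (half_lt_self (abs_pos.2 hχy))))
    obtain ⟨U, hUN, hU, hyU⟩ := mem_nhds_iff.1 hN
    let γ : ℝ → E := fun s => y + s • e
    have hγ : Continuous γ := by fun_prop
    have hγ' : ∀ s, HasDerivAt γ e s := fun s =>
      (((hasDerivAt_id s).smul_const e).const_add y).congr_deriv (one_smul ℝ e)
    have h0 : (0 : ℝ) ∈ γ ⁻¹' U := by simpa [γ] using hyU
    have hu : TendstoUniformlyOn (fun n s => fderivWithin ℝ (g n) T (γ s) e)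
        (fun s => (χ (γ s))⁻¹ • G (γ s)) atTop (γ ⁻¹' U) := by
      refine Metric.tendstoUniformlyOn_iff.2 fun ε hε => ?_
      have hc : 0 < |χ y| / 2 := half_pos (abs_pos.2 hχy)
      filter_upwards [Metric.tendstoUniformlyOn_iff.1 h (|χ y| / 2 * ε) (by positivity)] with n hn
      intro s hs
      obtain ⟨hsT, hsχ⟩ := hUN hs
      have h3 := hn (γ s) hsT
      have hne : χ (γ s) ≠ 0 := abs_pos.1 (hc.trans hsχ)
      rw [dist_eq_norm] at h3 ⊢
      have h4 : (χ (γ s))⁻¹ • G (γ s) - fderivWithin ℝ (g n) T (γ s) e =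
          (χ (γ s))⁻¹ • (G (γ s) - χ (γ s) • fderivWithin ℝ (g n) T (γ s) e) := by
        rw [smul_sub, smul_smul, inv_mul_cancel₀ hne, one_smul]
      rw [h4, norm_smul, norm_inv, Real.norm_eq_abs]
      rw [inv_mul_lt_iff₀ (hc.trans hsχ)]
      exact h3.trans (mul_lt_mul_of_pos_right hsχ hε)
    have hd := hasDerivAt_of_tendstoUniformlyOn (g := fun _ : ℝ => (0 : W)) (hU.preimage hγ) hu
      (f := fun n s => g n (γ s)) (Eventually.of_forall fun n s hs => ?_)
      (fun s hs => hg0 _ (hUN hs).1) h0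
    · have h5 := hd.unique (hasDerivAt_const (0 : ℝ) (0 : W))
      have h6 : γ 0 = y := by simp [γ]
      rw [h6] at h5
      exact (smul_eq_zero.1 h5).resolve_left (inv_ne_zero hχy)
    · have hTs : T ∈ 𝓝 (γ s) := mem_of_superset (hU.mem_nhds hs) fun z hz => (hUN hz).1
      have h7 := ((hg n).differentiableAt hTs).hasFDerivAt.comp_hasDerivAt s (hγ' s)
      rw [← fderivWithin_of_mem_nhds hTs] at h7
      exact h7
  intro y hy
  have hyc : y ∈ closure (interior R) := by
    rw [hR.closure_interior_eq_closure_of_nonempty_interior hRi]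
    exact subset_closure (hTR hy)
  have := mem_closure_iff_nhdsWithin_neBot.1 hyc
  have hTi : T ∈ 𝓝[interior R] y := nhdsWithin_mono y interior_subset (hT y hy)
  have h2 : Tendsto G (𝓝[interior R] y) (𝓝 (G y)) :=
    (hG y hy).mono_left (nhdsWithin_le_iff.2 hTi)
  refine tendsto_nhds_unique h2 (tendsto_const_nhds.congr' ?_)
  filter_upwards [hTi, self_mem_nhdsWithin] with z hz hzi
  exact (h1 z hz hzi).symm

variable {E : Type*} [NormedAddCommGroup E] [NormedSpace ℝ E] {H : Type*} [TopologicalSpace H]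
  (I : ModelWithCorners ℝ E H) (M : Type*) [TopologicalSpace M] [ChartedSpace H M]

/-- A coordinate vector field, cut off by a function with support in the chart domain. -/
structure ChartField where
  c : M
  χ : M → ℝ
  smooth : ContMDiff I 𝓘(ℝ, ℝ) ∞ χ
  supp : tsupport χ ⊆ (extChartAt I c).source
  e : E

variable {I M} [IsManifold I ∞ M] [CompactSpace M] {Q : Type*} [CStarAlgebra Q]

namespace ChartField

variable (V : ChartField I M)

theorem χ_eq_zero {x : M} (hx : x ∉ (extChartAt I V.c).source) : V.χ x = 0 :=
  image_eq_zero_of_notMem_tsupport fun h => hx (V.supp h)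

/-- The derivative of `f` in the direction of the vector field. -/
def deriv (f : M → Q) (x : M) : Q :=
  V.χ x • fderivWithin ℝ (loc I V.c f) (range I) (extChartAt I V.c x) V.e

theorem contMDiff_deriv {f : M → Q} (hf : ContMDiff I 𝓘(ℝ, Q) ∞ f) :
    ContMDiff I 𝓘(ℝ, Q) ∞ (V.deriv f) := by
  refine contMDiff_of_tsupport fun x hx => ?_
  have hxs : x ∈ (extChartAt I V.c).source := V.supp (tsupport_smul_subset_left V.χ
    (fun x => fderivWithin ℝ (loc I V.c f) (range I) (extChartAt I V.c x) V.e) hx)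
  have hG : ContDiffOn ℝ ∞ (fun y => fderivWithin ℝ (loc I V.c f) (extChartAt I V.c).target y V.e)
      (extChartAt I V.c).target :=
    ContDiffOn.fderivWithin_infty_apply (uniqueDiffOn_extChartAt_target V.c)
      (contDiffOn_loc hf V.c) V.e
  have h1 : ContMDiffOn I 𝓘(ℝ, Q) ∞ (fun x => fderivWithin ℝ (loc I V.c f)
      (extChartAt I V.c).target (extChartAt I V.c x) V.e) (extChartAt I V.c).source := by
    have h2 := contMDiffOn_extChartAt (I := I) (n := ∞) (x := V.c)
    rw [← extChartAt_source I] at h2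
    exact hG.contMDiffOn.comp h2 fun z hz => (extChartAt I V.c).map_source hz
  have hnhds : (extChartAt I V.c).source ∈ 𝓝 x := (isOpen_extChartAt_source V.c).mem_nhds hxs
  refine (V.smooth x).smul ((h1.contMDiffAt hnhds).congr_of_eventuallyEq ?_)
  filter_upwards [hnhds] with z hz
  rw [fderivWithin_range_eq ((extChartAt I V.c).map_source hz)]

theorem deriv_eq_of_source {x : M} (hx : x ∈ (extChartAt I V.c).source) (f : M → Q) :
    V.deriv f x = V.χ x • fderivWithin ℝ (loc I V.c f) (extChartAt I V.c).target
      (extChartAt I V.c x) V.e := by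
  rw [deriv, fderivWithin_range_eq ((extChartAt I V.c).map_source hx)]

theorem deriv_eq_zero {x : M} (hx : x ∉ (extChartAt I V.c).source) (f : M → Q) :
    V.deriv f x = 0 := by rw [deriv, V.χ_eq_zero hx, zero_smul]

theorem differentiableWithinAt_loc {f : M → Q} (hf : ContMDiff I 𝓘(ℝ, Q) ∞ f) {c x : M}
    (hx : x ∈ (extChartAt I c).source) :
    DifferentiableWithinAt ℝ (loc I c f) (extChartAt I c).target (extChartAt I c x) :=
  (contDiffOn_loc hf c).differentiableOn (by simp) _ ((extChartAt I c).map_source hx)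

theorem deriv_add {f g : M → Q} (hf : ContMDiff I 𝓘(ℝ, Q) ∞ f) (hg : ContMDiff I 𝓘(ℝ, Q) ∞ g)
    (x : M) : V.deriv (fun x => f x + g x) x = V.deriv f x + V.deriv g x := by
  by_cases hx : x ∈ (extChartAt I V.c).source
  · rw [V.deriv_eq_of_source hx, V.deriv_eq_of_source hx, V.deriv_eq_of_source hx, ← smul_add]
    congr 1
    exact congrArg (· V.e) (fderivWithin_add
      (uniqueDiffOn_extChartAt_target V.c _ ((extChartAt I V.c).map_source hx))
      (differentiableWithinAt_loc hf hx) (differentiableWithinAt_loc hg hx))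
  · simp [V.deriv_eq_zero hx]

theorem deriv_smul {f : M → Q} (hf : ContMDiff I 𝓘(ℝ, Q) ∞ f) (z : ℂ)
    (x : M) : V.deriv (fun x => z • f x) x = z • V.deriv f x := by
  by_cases hx : x ∈ (extChartAt I V.c).source
  · rw [V.deriv_eq_of_source hx, V.deriv_eq_of_source hx, smul_comm z]
    congr 1
    exact congrArg (· V.e) (fderivWithin_const_smul (c := z) (f := loc I V.c f)
      (uniqueDiffOn_extChartAt_target V.c _ ((extChartAt I V.c).map_source hx))
      (differentiableWithinAt_loc hf hx))
  · simp [V.deriv_eq_zero hx]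

theorem deriv_mul {f g : M → Q} (hf : ContMDiff I 𝓘(ℝ, Q) ∞ f) (hg : ContMDiff I 𝓘(ℝ, Q) ∞ g)
    (x : M) : V.deriv (fun x => f x * g x) x = V.deriv f x * g x + f x * V.deriv g x := by
  by_cases hx : x ∈ (extChartAt I V.c).source
  · rw [V.deriv_eq_of_source hx, V.deriv_eq_of_source hx, V.deriv_eq_of_source hx,
      smul_mul_assoc, mul_smul_comm, ← smul_add]
    congr 1
    have h := congrArg (· V.e) (fderivWithin_mul'
      (uniqueDiffOn_extChartAt_target V.c _ ((extChartAt I V.c).map_source hx))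
      (differentiableWithinAt_loc hf hx) (differentiableWithinAt_loc hg hx))
    refine h.trans ?_
    simp only [loc_extChartAt hx]
    rw [add_comm]
    rfl
  · simp [V.deriv_eq_zero hx]

theorem deriv_star (f : M → Q) (x : M) : V.deriv (fun x => star (f x)) x = star (V.deriv f x) := by
  by_cases hx : x ∈ (extChartAt I V.c).source
  · rw [V.deriv_eq_of_source hx, V.deriv_eq_of_source hx, star_smul, star_trivial (V.χ x)]
    congr 1
    exact congrArg (· V.e) (fderivWithin_star (f := loc I V.c f)
      (uniqueDiffOn_extChartAt_target V.c _ ((extChartAt I V.c).map_source hx)))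
  · simp [V.deriv_eq_zero hx]

/-- The derivative along the vector field, as a linear map of `C^∞(M, Q)`. -/
def lin (Q : Type*) [CStarAlgebra Q] : SmoothAlg I M Q →ₗ[ℂ] SmoothAlg I M Q where
  toFun f := .mk (V.deriv f) (V.contMDiff_deriv f.contMDiff)
  map_add' f g := SmoothAlg.ext fun x => V.deriv_add f.contMDiff g.contMDiff x
  map_smul' z f := SmoothAlg.ext fun x => V.deriv_smul f.contMDiff z x

theorem eq_zero_of_tendsto {f : ℕ → SmoothAlg I M Q}
    (hf : Tendsto (fun n => ‖f n‖) atTop (𝓝 0)) {G : C(M, Q)}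
    (hG : Tendsto (fun n => (V.lin Q (f n)).toC) atTop (𝓝 G)) : G = 0 := by
  have hu : TendstoUniformly (fun n x => V.deriv (f n) x) G atTop :=
    ContinuousMap.tendsto_iff_tendstoUniformly.1 hG
  ext x
  by_cases hx : x ∈ (extChartAt I V.c).source
  swap
  · have h := hu.tendsto_at x
    simp only [V.deriv_eq_zero hx] at h
    exact tendsto_nhds_unique h tendsto_const_nhds
  have hcs := continuousOn_extChartAt_symm (I := I) V.c
  have key := eq_zero_of_tendsto_directional (T := (extChartAt I V.c).target) I.convex_range
    I.nonempty_interior (extChartAt_target_subset_range V.c)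
    (fun y hy => extChartAt_target_mem_nhdsWithin_of_mem hy)
    (g := fun n => loc I V.c (f n)) (fun n => (contDiffOn_loc_coe (f n) V.c).differentiableOn
      (by simp)) (fun y _ => ?_)
    (χ := V.χ ∘ (extChartAt I V.c).symm) (V.smooth.continuous.comp_continuousOn hcs)
    (G := G ∘ (extChartAt I V.c).symm) (G.continuous.comp_continuousOn hcs) V.e ?_ _
    ((extChartAt I V.c).map_source hx)
  · rw [Function.comp_apply, (extChartAt I V.c).left_inv hx] at key
    exact key
  · exact squeeze_zero_norm (fun n => (f n).norm_apply_le _) hf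
  · refine Metric.tendstoUniformlyOn_iff.2 fun ε hε => ?_
    filter_upwards [Metric.tendstoUniformly_iff.1 hu ε hε] with n hn y hy
    have h := hn ((extChartAt I V.c).symm y)
    rw [V.deriv_eq_of_source ((extChartAt I V.c).map_target hy), (extChartAt I V.c).right_inv hy]
      at h
    exact h

/-- The derivative along the vector field, as a closable `*`-derivation of `C^∞(M, Q)`. -/
def der (Q : Type*) [CStarAlgebra Q] : ClosableStarDerivation (SmoothAlg I M Q) where
  toLinearMap := V.lin Q
  leibniz' f g := SmoothAlg.ext fun x => V.deriv_mul f.contMDiff g.contMDiff x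
  star' f := SmoothAlg.ext fun x => V.deriv_star f x
  closable' f hf hc := by
    have hc1 : CauchySeq fun n => V.lin Q (f n) := hc
    have hc' : CauchySeq fun n => (V.lin Q (f n)).toC := Metric.cauchySeq_iff.2 fun ε hε => by
      obtain ⟨N, hN⟩ := Metric.cauchySeq_iff.1 hc1 ε hε
      refine ⟨N, fun m hm n hn => ?_⟩
      rw [dist_eq_norm, ← SmoothAlg.toC_sub, ← SmoothAlg.norm_def, ← dist_eq_norm]
      exact hN m hm n hn
    obtain ⟨G, hG⟩ := cauchySeq_tendsto_of_complete hc'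
    have h0 := V.eq_zero_of_tendsto (tendsto_zero_iff_norm_tendsto_zero.1 hf) hG
    rw [h0] at hG
    have h1 : Tendsto (fun n => V.lin Q (f n)) atTop (𝓝 0) := by
      rw [tendsto_zero_iff_norm_tendsto_zero] at hG ⊢
      exact hG
    exact h1

theorem der_apply (f : SmoothAlg I M Q) : (V.der Q).toLinearMap f = V.lin Q f := rfl

end ChartField

end ChartFields

section FrechetOfSeminorms

theorem isFrechetStarAlgebra_of_seminorms {S : Type*} [Ring S] [Algebra ℂ S] [StarRing S]
    [τ : TopologicalSpace S] {ι : Type*} [Countable ι] {q : SeminormFamily ℂ S ι}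
    (hq : WithSeminorms q) (hc : SeqComplete q) (hsep : ∀ x, (∀ i, q i x = 0) → x = 0)
    {κ : Type*} {r : SeminormFamily ℂ S κ} (hr : WithSeminorms r)
    (hmul : ∀ k, ∃ L : List (κ × κ), ∀ x y, r k (x * y) ≤ (L.map fun p => r p.1 x * r p.2 y).sum)
    (hstar : ∀ k x, r k (star x) = r k x) : IsFrechetStarAlgebra S τ := by
  have hgrp : IsTopologicalAddGroup S := hq.topologicalAddGroup
  have hcont : ∀ k x, Tendsto (r k) (𝓝 x) (𝓝 (r k x)) := fun k x =>
    (hr.continuous_seminorm k).tendsto x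
  refine ⟨?_, ?_, ?_, ?_, ?_⟩
  · have : T1Space S := hq.T1_of_separating fun x hx => by
      by_contra! h
      exact hx (hsep x h)
    infer_instance
  · obtain ⟨p, -, hp, hp'⟩ := exists_monotone_family q
    refine ⟨p, withSeminorms_of_dominated hq hp fun i => ?_⟩
    obtain ⟨n, hn⟩ := hp' i
    exact .of_le (i := n) zero_le_one fun x => by rw [one_mul]; exact hn x
  · intro x hx
    obtain ⟨a, ha⟩ := hc x fun i ε hε => hx {y | q i y < ε} (by
      have := (hq.continuous_seminorm i).tendsto 0
      rw [map_zero] at this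
      exact this.eventually (gt_mem_nhds hε))
    exact ⟨a, (hq.tendsto_nhds _ _).2 fun i ε hε => (ha i).eventually (gt_mem_nhds hε)⟩
  · have key : ∀ F : Filter (S × S), (∀ i j, Tendsto (fun z : S × S => r i z.1 * r j z.2) F (𝓝 0)) →
        Tendsto (fun z : S × S => z.1 * z.2) F (𝓝 0) := by
      intro F h
      refine (hr.tendsto_nhds _ _).2 fun k ε hε => ?_
      obtain ⟨L, hL⟩ := hmul k
      have hsum : Tendsto (fun z : S × S => (L.map fun p => r p.1 z.1 * r p.2 z.2).sum) F (𝓝 0) := by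
        clear hL
        induction L with
        | nil => simpa using tendsto_const_nhds
        | cons p L ih => simpa using (h p.1 p.2).add ih
      filter_upwards [hsum.eventually (gt_mem_nhds hε)] with z hz
      rw [sub_zero]
      exact (hL z.1 z.2).trans_lt hz
    have : IsTopologicalRing S := by
      refine IsTopologicalRing.of_addGroup_of_nhds_zero ?_ (fun x => ?_) (fun x => ?_)
      · refine key _ fun i j => ?_
        have := ((hcont i 0).comp tendsto_fst).mul ((hcont j 0).comp (tendsto_snd (f := 𝓝 (0 : S))))
        simpa using this
      · have := key (map (fun y => (x, y)) (𝓝 0)) fun i j => by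
          rw [tendsto_map'_iff]
          simpa using! (hcont j 0).const_mul (r i x)
        exact tendsto_map'_iff.1 this
      · have := key (map (fun y => (y, x)) (𝓝 0)) fun i j => by
          rw [tendsto_map'_iff]
          simpa using! (hcont i 0).mul_const (r j x)
        exact tendsto_map'_iff.1 this
    exact continuous_mul
  · refine continuous_iff_continuousAt.2 fun x => (hr.tendsto_nhds _ _).2 fun k ε hε => ?_
    filter_upwards [(hr.tendsto_nhds id x).1 tendsto_id k ε hε] with y hy
    rw [← star_sub, hstar]
    exact hy

theorem iterDer_cons {S : Type*} [PreCStarAlgebra S] (δ : ClosableStarDerivation S)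
    (l : List (ClosableStarDerivation S)) (x : S) :
    iterDer (δ :: l) x = δ.toLinearMap (iterDer l x) := rfl

theorem iterDer_mul {S : Type*} [PreCStarAlgebra S] (l : List (ClosableStarDerivation S)) :
    ∃ L : List (List (ClosableStarDerivation S) × List (ClosableStarDerivation S)),
      ∀ x y : S, iterDer l (x * y) = (L.map fun p => iterDer p.1 x * iterDer p.2 y).sum := by
  induction l with
  | nil => exact ⟨[([], [])], fun x y => by simp [iterDer]⟩
  | cons δ l ih =>
    obtain ⟨L, hL⟩ := ih
    refine ⟨L.map (fun p => (δ :: p.1, p.2)) ++ L.map (fun p => (p.1, δ :: p.2)), fun x y => ?_⟩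
    have h : ∀ x y, δ.toLinearMap (x * y) = δ.toLinearMap x * y + x * δ.toLinearMap y := δ.leibniz'
    rw [iterDer_cons, hL, map_list_sum]
    simp only [List.map_map, List.map_append, List.sum_append, Function.comp_def, h,
      iterDer_cons, List.sum_map_add]

theorem norm_star_eq {S : Type*} [PreCStarAlgebra S] (x : S) : ‖star x‖ = ‖x‖ := norm_star x

theorem isNice_of_seminorms {S : Type*} [PreCStarAlgebra S] {τ : TopologicalSpace S}
    {ι : Type*} [Countable ι] {q : SeminormFamily ℂ S ι}
    (hq : WithSeminorms (topology := τ) q) (hc : SeqComplete q)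
    (hsep : ∀ x, (∀ i, q i x = 0) → x = 0)
    (hd : WithSeminorms (topology := τ) (derSeminorm S)) : IsNice S τ := by
  refine ⟨isFrechetStarAlgebra_of_seminorms (τ := τ) hq hc hsep hd (fun l => ?_) fun l x => ?_, hd⟩
  · obtain ⟨L, hL⟩ := iterDer_mul l
    refine ⟨L, fun x y => ?_⟩
    change ‖iterDer l (x * y)‖ ≤ _
    rw [hL]
    clear hL
    induction L with
    | nil => simp
    | cons p L ih =>
      simp only [List.map_cons, List.sum_cons]
      exact (norm_add_le _ _).trans (add_le_add (norm_mul_le _ _) ih)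
  · change ‖iterDer l (star x)‖ = ‖iterDer l x‖
    rw [iterDer_star, norm_star_eq]

end FrechetOfSeminorms

section SmoothNice

variable {E : Type*} [NormedAddCommGroup E] [NormedSpace ℝ E] [FiniteDimensional ℝ E]
  {H : Type*} [TopologicalSpace H]
  {I : ModelWithCorners ℝ E H} {M : Type*} [TopologicalSpace M] [ChartedSpace H M]
  [IsManifold I ∞ M] [CompactSpace M] [T2Space M] {Q : Type*} [CStarAlgebra Q]

variable (I) in
theorem exists_bump {K U : Set M} (hK : IsCompact K) (hU : IsOpen U) (hKU : K ⊆ U) :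
    ∃ χ : M → ℝ, ContMDiff I 𝓘(ℝ, ℝ) ∞ χ ∧ (∀ᶠ x in 𝓝ˢ K, χ x = 1) ∧ tsupport χ ⊆ U ∧
      ∀ x, χ x ∈ Icc 0 1 := by
  have hcs : LocallyCompactSpace M := inferInstance
  obtain ⟨L, hL, hKL, hLU⟩ := exists_compact_between hK hU hKU
  obtain ⟨f, hf1, hf0, hf⟩ := exists_contMDiffMap_one_nhds_of_subset_interior (n := ⊤) I
    hK.isClosed hKL
  refine ⟨f, f.contMDiff, hf1, ?_, hf⟩
  refine (closure_minimal (fun x hx => ?_) hL.isClosed).trans hLU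
  by_contra h
  exact hx (hf0 x h)

theorem exists_chart_bump {c : M} {K : Set E} (hK : IsCompact K)
    (hKT : K ⊆ (extChartAt I c).target) : ∃ χ : M → ℝ, ContMDiff I 𝓘(ℝ, ℝ) ∞ χ ∧
      (∀ y ∈ K, χ ((extChartAt I c).symm y) = 1) ∧ tsupport χ ⊆ (extChartAt I c).source ∧
      ∀ x, χ x ∈ Icc 0 1 := by
  obtain ⟨χ, h1, h2, h3, h4⟩ := exists_bump I
    (hK.image_of_continuousOn ((continuousOn_extChartAt_symm (I := I) c).mono hKT))
    (isOpen_extChartAt_source c) (by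
      rintro _ ⟨y, hy, rfl⟩
      exact (extChartAt I c).map_target (hKT hy))
  exact ⟨χ, h1, fun y hy => h2.self_of_nhdsSet _ (mem_image_of_mem _ hy), h3, h4⟩

/-- The seminorms `‖D₁ ⋯ Dₖ f‖` for coordinate vector fields. -/
def fieldSem (I : ModelWithCorners ℝ E H) (M : Type*) [TopologicalSpace M] [ChartedSpace H M]
    [IsManifold I ∞ M] [CompactSpace M] (Q : Type*) [CStarAlgebra Q] (l : List (ChartField I M)) :
    Seminorm ℂ (SmoothAlg I M Q) :=
  derSeminorm (SmoothAlg I M Q) (l.map fun V => V.der Q)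

theorem loc_iterDer_eqOn {c : M} {K : Set E} (hK : NiceChart I c K) {χ : M → ℝ}
    (hχ : ContMDiff I 𝓘(ℝ, ℝ) ∞ χ) (hχ1 : ∀ y ∈ K, χ ((extChartAt I c).symm y) = 1)
    (hs : tsupport χ ⊆ (extChartAt I c).source) (f : SmoothAlg I M Q) (l : List E) :
    EqOn (loc I c (iterDer (l.map fun e => (⟨c, χ, hχ, hs, e⟩ : ChartField I M).der Q) f))
      (dirDerivs K l (loc I c f)) K := by
  induction l with
  | nil => exact fun y _ => rfl
  | cons e l ih =>
    intro y hy
    rw [List.map_cons, iterDer_cons, dirDerivs_cons]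
    set g := iterDer (l.map fun e => (⟨c, χ, hχ, hs, e⟩ : ChartField I M).der Q) f
    change χ ((extChartAt I c).symm y) • fderivWithin ℝ (loc I c g) (range I)
      (extChartAt I c ((extChartAt I c).symm y)) e = _
    rw [hχ1 y hy, one_smul, (extChartAt I c).right_inv (hK.subset hy),
      hK.fderivWithin_eq (contDiffOn_loc_coe g c) hy, fderivWithin_congr ih (ih hy)]

theorem niceChart_dominatedBy_fieldSem {c : M} {K : Set E} (hK : NiceChart I c K) (k : ℕ) :
    DominatedBy (smoothSem I M Q (⟨(c, K), hK.compact, hK.subset⟩, k)) (fieldSem I M Q) := by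
  obtain ⟨χ, hχ, hχ1, hs, -⟩ := exists_chart_bump hK.compact hK.subset
  let b := Module.finBasis ℝ E
  obtain ⟨C, hC, h⟩ := exists_multilinear_norm_le (F := Q) b k
  let q : (Fin k → Fin (Module.finrank ℝ E)) → Seminorm ℂ (SmoothAlg I M Q) := fun r =>
    fieldSem I M Q ((List.ofFn fun i => b (r i)).map fun e => ⟨c, χ, hχ, hs, e⟩)
  have h1 : DominatedBy (smoothSem I M Q (⟨(c, K), hK.compact, hK.subset⟩, k)) q := by
    refine ⟨Finset.univ, C, hC, fun f => smoothSem_le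
      (mul_nonneg hC (Finset.sum_nonneg fun i _ => apply_nonneg _ _)) fun y hy => ?_⟩
    refine (h _).trans (mul_le_mul_of_nonneg_left (Finset.sum_le_sum fun r _ => ?_) hC)
    rw [jet_eq_of_mem hK hy, iteratedFDerivWithin_apply_eq_dirDerivs hK.unique
      ((contDiffOn_loc_coe f c).mono hK.subset) _ hy, ← loc_iterDer_eqOn hK hχ hχ1 hs f _ hy]
    refine (SmoothAlg.norm_apply_le _ _).trans_eq ?_
    simp only [q, fieldSem, List.map_map]
    rfl
  exact h1.trans fun r => .self _ _

theorem coverSem_dominatedBy_fieldSem (i : coverCentres I M × ℕ) :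
    DominatedBy (coverSem I M Q i) (fieldSem I M Q) :=
  niceChart_dominatedBy_fieldSem (coverSet_nice (i.1 : M)) i.2

theorem coverSem_dominatedBy_derSeminorm (i : coverCentres I M × ℕ) :
    DominatedBy (coverSem I M Q i) (derSeminorm (SmoothAlg I M Q)) :=
  (coverSem_dominatedBy_fieldSem i).trans fun _ => .self (derSeminorm (SmoothAlg I M Q)) _

variable (I M Q) in
theorem isNice_smoothAlg : IsNice (SmoothAlg I M Q) (smoothAlgTopology I M Q) :=
  isNice_of_seminorms (coverSem_withSeminorms I M Q) seqComplete_coverSem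
    (fun _ h => eq_zero_of_coverSem_eq_zero h)
    (withSeminorms_of_dominated (coverSem_withSeminorms I M Q) derSeminorm_dominatedBy_coverSem
      coverSem_dominatedBy_derSeminorm)

variable (I M Q) in
theorem isNice_smoothMaps : IsNice (SmoothMaps I M Q) (smoothTopology I M Q) :=
  isNice_smoothAlg I M Q

end SmoothNice

section DirDerivs

variable {E : Type*} [NormedAddCommGroup E] [NormedSpace ℝ E]
  {W : Type*} [NormedAddCommGroup W] [NormedSpace ℝ W] {K : Set E}

theorem dirDerivs_add (hd : UniqueDiffOn ℝ K) {f g : E → W} (hf : ContDiffOn ℝ ∞ f K)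
    (hg : ContDiffOn ℝ ∞ g K) (l : List E) :
    EqOn (dirDerivs K l fun y => f y + g y) (fun y => dirDerivs K l f y + dirDerivs K l g y) K := by
  induction l with
  | nil => exact fun y _ => rfl
  | cons v l ih =>
    intro y hy
    rw [dirDerivs_cons, dirDerivs_cons, dirDerivs_cons]
    change fderivWithin ℝ (dirDerivs K l fun y => f y + g y) K y v = _
    rw [fderivWithin_congr ih (ih hy)]
    exact congrArg (· v) (fderivWithin_add (hd y hy)
      ((contDiffOn_dirDerivs hd hf l).differentiableOn (by simp) y hy)
      ((contDiffOn_dirDerivs hd hg l).differentiableOn (by simp) y hy))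

theorem dirDerivs_clm {W' : Type*} [NormedAddCommGroup W'] [NormedSpace ℝ W']
    (hd : UniqueDiffOn ℝ K) {f : E → W} (hf : ContDiffOn ℝ ∞ f K) (T : W →L[ℝ] W') (l : List E) :
    EqOn (dirDerivs K l fun y => T (f y)) (fun y => T (dirDerivs K l f y)) K := by
  induction l with
  | nil => exact fun y _ => rfl
  | cons v l ih =>
    intro y hy
    rw [dirDerivs_cons, dirDerivs_cons]
    change fderivWithin ℝ (dirDerivs K l fun y => T (f y)) K y v = _
    rw [fderivWithin_congr ih (ih hy)]
    have := (T.hasFDerivAt.comp_hasFDerivWithinAt y ((contDiffOn_dirDerivs hd hf l).differentiableOn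
      (by simp) y hy).hasFDerivWithinAt).fderivWithin (hd y hy)
    exact congrArg (· v) this

theorem dirDerivs_const_smul (hd : UniqueDiffOn ℝ K) {f : E → W} (hf : ContDiffOn ℝ ∞ f K) (c : ℝ)
    (l : List E) : EqOn (dirDerivs K l fun y => c • f y) (fun y => c • dirDerivs K l f y) K :=
  dirDerivs_clm hd hf (c • ContinuousLinearMap.id ℝ W) l

theorem dirDerivs_sum {ι : Type*} (hd : UniqueDiffOn ℝ K) (s : Finset ι) {f : ι → E → W}
    (hf : ∀ i ∈ s, ContDiffOn ℝ ∞ (f i) K) (w : ι → ℝ) (l : List E) :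
    EqOn (dirDerivs K l fun y => ∑ i ∈ s, w i • f i y)
      (fun y => ∑ i ∈ s, w i • dirDerivs K l (f i) y) K := by
  classical
  induction s using Finset.induction_on with
  | empty =>
    have := dirDerivs_const_smul hd (contDiffOn_const (c := (0 : W)) (s := K)) 0 l
    simpa only [zero_smul, Finset.sum_empty] using this
  | insert i s hi ih =>
    have hf' : ∀ j ∈ s, ContDiffOn ℝ ∞ (f j) K := fun j hj => hf j (Finset.mem_insert_of_mem hj)
    have hi' := hf i (Finset.mem_insert_self i s)
    simp only [Finset.sum_insert hi]
    intro y hy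
    rw [dirDerivs_add hd (hi'.const_smul (w i))
      (ContDiffOn.sum fun j hj => (hf' j hj).const_smul (w j)) l hy]
    exact congrArg₂ (· + ·) (dirDerivs_const_smul hd hi' (w i) l hy) (ih hf' hy)

theorem dirDerivs_comp_affine (hd : UniqueDiffOn ℝ K) {f : E → W} (hf : ContDiffOn ℝ ∞ f K)
    {a : ℝ} {b : E} (hab : ∀ y ∈ K, a • y + b ∈ K) (l : List E) :
    EqOn (dirDerivs K l fun y => f (a • y + b))
      (fun y => a ^ l.length • dirDerivs K l f (a • y + b)) K := by
  induction l with
  | nil => exact fun y _ => by simp [dirDerivs_nil]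
  | cons v l ih =>
    intro y hy
    rw [dirDerivs_cons, dirDerivs_cons]
    change fderivWithin ℝ (dirDerivs K l fun y => f (a • y + b)) K y v = _
    rw [fderivWithin_congr ih (ih hy)]
    have h1 : HasFDerivWithinAt (fun y : E => a • y + b) (a • ContinuousLinearMap.id ℝ E) K y :=
      (((hasFDerivAt_id y).const_smul a).add_const b).hasFDerivWithinAt
    have h2 := ((contDiffOn_dirDerivs hd hf l).differentiableOn (by simp) _
      (hab y hy)).hasFDerivWithinAt
    have h3 := ((h2.comp y h1 hab).const_smul (a ^ l.length)).fderivWithin (hd y hy)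
    refine (congrArg (· v) h3).trans ?_
    simp [pow_succ, smul_smul]

/-- Uniform limits of all iterated directional derivatives are the derivatives of the limit. -/
theorem contDiffOn_of_tendsto_dirDerivs [FiniteDimensional ℝ E] [CompleteSpace W]
    (hK : Convex ℝ K) (hd : UniqueDiffOn ℝ K) {f : ℕ → E → W} (hf : ∀ n, ContDiffOn ℝ ∞ (f n) K)
    {p : List E → E → W}
    (hp : ∀ l, TendstoUniformlyOn (fun n => dirDerivs K l (f n)) (p l) atTop K) :
    ContDiffOn ℝ ∞ (p []) K ∧ ∀ l, EqOn (dirDerivs K l (p [])) (p l) K := by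
  have hP : ∀ k, ∃ P : E → E [×k]→L[ℝ] W,
      TendstoUniformlyOn (fun n => iteratedFDerivWithin ℝ k (f n) K) P atTop K := fun k => by
    let b := Module.finBasis ℝ E
    obtain ⟨C, hC, h⟩ := exists_multilinear_norm_le (F := W) b k
    refine exists_tendstoUniformlyOn_of_cauchy fun ε hε => ?_
    set c := ε / (C * Fintype.card (Fin k → Fin (Module.finrank ℝ E)) + 1) with hc
    have hden : 0 < C * Fintype.card (Fin k → Fin (Module.finrank ℝ E)) + 1 := by positivity
    have hc0 : 0 < c := by positivity
    have := fun r : Fin k → Fin (Module.finrank ℝ E) => Metric.uniformCauchySeqOn_iff.1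
      (hp (List.ofFn fun i => b (r i))).uniformCauchySeqOn c hc0
    choose N hN using this
    refine ⟨Finset.univ.sup N, fun m hm n hn y hy => ?_⟩
    refine (h _).trans_lt ?_
    have h1 : ∀ r : Fin k → Fin (Module.finrank ℝ E),
        ‖(iteratedFDerivWithin ℝ k (f m) K y - iteratedFDerivWithin ℝ k (f n) K y)
          fun i => b (r i)‖ ≤ c := fun r => by
      have h2 := hN r m ((Finset.le_sup (Finset.mem_univ r)).trans hm) n
        ((Finset.le_sup (Finset.mem_univ r)).trans hn) y hy
      rw [dist_eq_norm] at h2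
      rw [sub_apply, iteratedFDerivWithin_apply_eq_dirDerivs hd (hf m) _ hy,
        iteratedFDerivWithin_apply_eq_dirDerivs hd (hf n) _ hy]
      exact h2.le
    calc _ ≤ C * (Fintype.card (Fin k → Fin (Module.finrank ℝ E)) * c) := by
          refine mul_le_mul_of_nonneg_left ?_ hC
          have := Finset.sum_le_card_nsmul Finset.univ _ c fun r _ => h1 r
          rwa [nsmul_eq_mul, Finset.card_univ] at this
      _ < ε := by
          rw [hc, ← mul_assoc, mul_div_assoc', div_lt_iff₀ hden]
          nlinarith
  choose P hP using hP
  obtain ⟨h1, h2⟩ := contDiffOn_of_tendstoUniformlyOn hK hd hf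
    (fun y hy => (hp []).tendsto_at hy) hP
  refine ⟨h1, fun l y hy => ?_⟩
  have h3 := iteratedFDerivWithin_apply_eq_dirDerivs hd h1 l.get hy
  rw [List.ofFn_get] at h3
  rw [← h3, h2 _ y hy]
  have h4 : Tendsto (fun n => iteratedFDerivWithin ℝ l.length (f n) K y l.get) atTop
      (𝓝 (P l.length y l.get)) :=
    ((ContinuousMultilinearMap.apply ℝ (fun _ : Fin l.length => E) W
      l.get).continuous.tendsto _).comp ((hP l.length).tendsto_at hy)
  refine tendsto_nhds_unique h4 (((hp l).tendsto_at hy).congr fun n => ?_)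
  rw [iteratedFDerivWithin_apply_eq_dirDerivs hd (hf n) _ hy, List.ofFn_get]

end DirDerivs

section ParametricIntegral

open MeasureTheory

theorem exists_simpleFunc_near {Ω : Type*} [MetricSpace Ω] [MeasurableSpace Ω]
    [OpensMeasurableSpace Ω] {Ω₀ : Set Ω} (hc : IsCompact Ω₀) (hne : Ω₀.Nonempty) {δ : ℝ}
    (hδ : 0 < δ) : ∃ s : SimpleFunc Ω Ω, (∀ o, s o ∈ Ω₀) ∧ ∀ o ∈ Ω₀, dist (s o) o < δ := by
  obtain ⟨t, htΩ, htf, ht⟩ := hc.finite_cover_balls hδ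
  have htne : t.Nonempty := by
    obtain ⟨o, ho⟩ := hne
    obtain ⟨x, hx, -⟩ := mem_iUnion₂.1 (ht ho)
    exact ⟨x, hx⟩
  obtain ⟨e, he⟩ := htf.countable.exists_eq_range htne
  have heΩ : ∀ k, e k ∈ Ω₀ := fun k => htΩ (he ▸ mem_range_self k)
  have hk : ∀ x ∈ t, ∃ k, e k = x := fun x hx => by rw [he] at hx; exact hx
  choose! k hk using hk
  refine ⟨SimpleFunc.nearestPt e (htf.toFinset.sup k), fun o => ?_, fun o ho => ?_⟩
  · exact heΩ _
  · obtain ⟨x, hx, hox⟩ := mem_iUnion₂.1 (ht ho)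
    have h1 := SimpleFunc.edist_nearestPt_le e o
      (Finset.le_sup (f := k) (htf.mem_toFinset.2 hx))
    rw [hk x hx] at h1
    rw [Metric.mem_ball, dist_comm] at hox
    rw [edist_dist, edist_dist, ENNReal.ofReal_le_ofReal_iff dist_nonneg] at h1
    exact h1.trans_lt hox

theorem integral_simpleFunc_comp {Ω W : Type*} [MeasurableSpace Ω] {μ : Measure Ω}
    [IsFiniteMeasure μ] [NormedAddCommGroup W] [NormedSpace ℝ W] [CompleteSpace W]
    (s : SimpleFunc Ω Ω) (f : Ω → W) :
    ∫ o, f (s o) ∂μ = ∑ x ∈ s.range, μ.real (s ⁻¹' {x}) • f x := by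
  have h : ∀ o, f (s o) = ∑ x ∈ s.range, (s ⁻¹' {x}).indicator (fun _ => f x) o := fun o => by
    rw [Finset.sum_eq_single_of_mem (s o) (s.mem_range_self o)]
    · exact (indicator_of_mem (show o ∈ s ⁻¹' {s o} from rfl) fun _ => f (s o)).symm
    · intro x _ hx
      exact indicator_of_notMem (fun h => hx (Eq.symm h)) _
  simp_rw [h]
  rw [integral_finset_sum _ fun x _ => (integrable_const (f x)).indicator
    (s.measurableSet_preimage {x})]
  exact Finset.sum_congr rfl fun x _ => integral_indicator_const (f x) (s.measurableSet_preimage _)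

/-- Convergence of all iterated directional derivatives, uniformly on `K`. -/
def TendstoDirDerivs {E W : Type*} [NormedAddCommGroup E] [NormedSpace ℝ E]
    [NormedAddCommGroup W] [NormedSpace ℝ W] (K : Set E) (f : ℕ → E → W) (g : E → W) : Prop :=
  ∀ l, TendstoUniformlyOn (fun n => dirDerivs K l (f n)) (dirDerivs K l g) atTop K

variable {E : Type*} [NormedAddCommGroup E] [NormedSpace ℝ E] [FiniteDimensional ℝ E]
  {W : Type*} [NormedAddCommGroup W] [NormedSpace ℝ W] [CompleteSpace W] {K : Set E}
  {Ω : Type*} [MetricSpace Ω] [MeasurableSpace Ω] [OpensMeasurableSpace Ω]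

/-- Differentiation under the integral sign, with approximation of the integral by finite sums. -/
theorem contDiffOn_integral (μ : Measure Ω) [IsFiniteMeasureOnCompacts μ] {Ω₀ : Set Ω}
    (hΩ : IsCompact Ω₀) (hK : Convex ℝ K) (hKc : IsCompact K) (hd : UniqueDiffOn ℝ K)
    {u : Ω → E → W} (hu : ∀ o ∈ Ω₀, ContDiffOn ℝ ∞ (u o) K)
    (hc : ∀ l, ContinuousOn (fun x : Ω × E => dirDerivs K l (u x.1) x.2) (Ω₀ ×ˢ K)) :
    ContDiffOn ℝ ∞ (fun y => ∫ o in Ω₀, u o y ∂μ) K ∧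
    (∀ l, EqOn (dirDerivs K l fun y => ∫ o in Ω₀, u o y ∂μ)
      (fun y => ∫ o in Ω₀, dirDerivs K l (u o) y ∂μ) K) ∧
    ∃ (s : ℕ → Finset Ω) (w : ℕ → Ω → ℝ), (∀ n, ∀ o ∈ s n, o ∈ Ω₀) ∧
      TendstoDirDerivs K (fun n y => ∑ o ∈ s n, w n o • u o y)
        (fun y => ∫ o in Ω₀, u o y ∂μ) := by
  have hfin : IsFiniteMeasure (μ.restrict Ω₀) := ⟨by
    rw [Measure.restrict_apply_univ]; exact hΩ.measure_lt_top⟩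
  have key : ∃ (s : ℕ → Finset Ω) (w : ℕ → Ω → ℝ), (∀ n, ∀ o ∈ s n, o ∈ Ω₀) ∧
      ∀ l, TendstoUniformlyOn (fun n => dirDerivs K l fun y => ∑ o ∈ s n, w n o • u o y)
        (fun y => ∫ o in Ω₀, dirDerivs K l (u o) y ∂μ) atTop K := by
    rcases Ω₀.eq_empty_or_nonempty with rfl | hne
    · refine ⟨fun _ => ∅, fun _ _ => 0, fun _ _ h => absurd h (Finset.notMem_empty _), fun l => ?_⟩
      refine Metric.tendstoUniformlyOn_iff.2 fun ε hε => Eventually.of_forall fun n y hy => ?_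
      rw [dirDerivs_sum hd ∅ (fun o h => absurd h (Finset.notMem_empty _)) _ l hy]
      simpa using hε
    choose s hsΩ hs using fun n : ℕ =>
      exists_simpleFunc_near hΩ hne (δ := 1 / ((n : ℝ) + 1)) (by positivity)
    have hmem : ∀ n, ∀ o ∈ (s n).range, o ∈ Ω₀ := fun n o ho => by
      obtain ⟨z, rfl⟩ := SimpleFunc.mem_range.1 ho
      exact hsΩ n z
    refine ⟨fun n => (s n).range, fun n x => (μ.restrict Ω₀).real (s n ⁻¹' {x}), hmem, fun l => ?_⟩
    refine Metric.tendstoUniformlyOn_iff.2 fun ε hε => ?_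
    set c := μ.real Ω₀ with hcdef
    have hc0 : 0 ≤ c := measureReal_nonneg
    obtain ⟨δ, hδ, hδc⟩ := Metric.uniformContinuousOn_iff.1
      ((hΩ.prod hKc).uniformContinuousOn_of_continuous (hc l)) (ε / (c + 1)) (by positivity)
    have hlim : Tendsto (fun n : ℕ => 1 / ((n : ℝ) + 1)) atTop (𝓝 0) :=
      tendsto_one_div_add_atTop_nhds_zero_nat
    filter_upwards [hlim.eventually (gt_mem_nhds hδ)] with n hn y hy
    rw [dirDerivs_sum hd _ (fun o ho => hu o (hmem n o ho)) _ l hy, dist_comm, dist_eq_norm]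
    have h1 := integral_simpleFunc_comp (μ := μ.restrict Ω₀) (s n) fun o => dirDerivs K l (u o) y
    beta_reduce
    rw [← h1]
    have hcont : ContinuousOn (fun o => dirDerivs K l (u o) y) Ω₀ :=
      (hc l).comp (by fun_prop : ContinuousOn (fun o => (o, y)) Ω₀) fun o ho => ⟨ho, hy⟩
    have hint2 : IntegrableOn (fun o => dirDerivs K l (u o) y) Ω₀ μ :=
      hcont.integrableOn_compact hΩ
    have hint1 : IntegrableOn (fun o => dirDerivs K l (u (s n o)) y) Ω₀ μ :=
      ((s n).map fun o => dirDerivs K l (u o) y).integrable_of_isFiniteMeasure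
    rw [← integral_sub hint1 hint2]
    refine (norm_setIntegral_le_of_norm_le_const (C := ε / (c + 1)) hΩ.measure_lt_top
      fun o ho => ?_).trans_lt ?_
    · rw [← dist_eq_norm]
      refine (hδc (s n o, y) ⟨hsΩ n o, hy⟩ (o, y) ⟨ho, hy⟩ ?_).le
      rw [Prod.dist_eq, dist_self, max_eq_left dist_nonneg]
      exact (hs n o ho).trans hn
    · rw [← hcdef, div_mul_eq_mul_div, div_lt_iff₀ (by positivity)]
      nlinarith
  obtain ⟨s, w, hs, hsw⟩ := key
  obtain ⟨h1, h2⟩ := contDiffOn_of_tendsto_dirDerivs hK hd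
    (fun n => ContDiffOn.sum fun o ho => (hu o (hs n o ho)).const_smul (w n o)) hsw
  exact ⟨h1, h2, s, w, hs, fun l => (hsw l).congr_right fun y hy => (h2 l hy).symm⟩

end ParametricIntegral

section LocalDensity

open MeasureTheory

variable {E : Type*} [NormedAddCommGroup E] [NormedSpace ℝ E]
  {W : Type*} [NormedAddCommGroup W] [NormedSpace ℝ W] {K : Set E}

theorem exists_dirDerivs_kernel (hd : UniqueDiffOn ℝ K) {κ : E × E → ℝ} (hκ : ContDiff ℝ ∞ κ)
    (l : List E) : ∃ κ' : E × E → ℝ, ContDiff ℝ ∞ κ' ∧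
      ∀ z, ∀ y ∈ K, dirDerivs K l (fun y => κ (y, z)) y = κ' (y, z) := by
  induction l with
  | nil => exact ⟨κ, hκ, fun z y _ => rfl⟩
  | cons v l ih =>
    obtain ⟨κ', hκ', h⟩ := ih
    refine ⟨fun x => fderiv ℝ κ' x (v, 0), hκ'.fderiv_right (by simp) |>.clm_apply contDiff_const,
      fun z y hy => ?_⟩
    rw [dirDerivs_cons]
    change fderivWithin ℝ (dirDerivs K l fun y => κ (y, z)) K y v = _
    rw [fderivWithin_congr (h z) (h z y hy)]
    have h1 : HasFDerivAt (fun y : E => (y, z)) (ContinuousLinearMap.inl ℝ E E) y :=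
      hasFDerivAt_prodMk_left y z
    have h2 : HasFDerivAt κ' (fderiv ℝ κ' (y, z)) (y, z) :=
      (hκ'.differentiable (by simp) _).hasFDerivAt
    have h3 := (h2.comp y h1).hasFDerivWithinAt (s := K) |>.fderivWithin (hd y hy)
    exact congrArg (· v) h3

variable [FiniteDimensional ℝ E] [CompleteSpace W]

/-- Kernel approximation: smooth functions on a compact convex set are limits of finite sums of
products of a smooth scalar function with a vector. -/
theorem exists_sum_tendsto_integral (hK : Convex ℝ K) (hKc : IsCompact K) (hd : UniqueDiffOn ℝ K)
    [MeasurableSpace E] [BorelSpace E] (μ : Measure E) [IsFiniteMeasureOnCompacts μ] {F : E → W}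
    (hF : ContinuousOn F K) {κ : E × E → ℝ} (hκ : ContDiff ℝ ∞ κ) :
    ∃ (s : ℕ → Finset E) (w : ℕ → E → ℝ), TendstoDirDerivs K
      (fun n y => ∑ z ∈ s n, (w n z * κ (y, z)) • F z) (fun y => ∫ z in K, κ (y, z) • F z ∂μ) := by
  have hκz : ∀ z, ContDiff ℝ ∞ fun y => κ (y, z) := fun z => hκ.comp (by fun_prop)
  obtain ⟨-, -, s, w, -, h⟩ := contDiffOn_integral μ hKc hK hKc hd
    (u := fun z y => κ (y, z) • F z) (fun z _ => ((hκz z).smul contDiff_const).contDiffOn)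
    (fun l => by
      obtain ⟨κ', hκ', h⟩ := exists_dirDerivs_kernel hd hκ l
      have h1 : ContinuousOn (fun x : E × E => κ' (x.2, x.1) • F x.1) (K ×ˢ K) :=
        (hκ'.continuous.comp (by fun_prop)).continuousOn.smul
          (hF.comp continuousOn_fst fun x hx => hx.1)
      refine h1.congr fun x hx => ?_
      have h2 := dirDerivs_clm hd (hκz x.1).contDiffOn
        ((ContinuousLinearMap.id ℝ ℝ).smulRight (F x.1)) l hx.2
      refine h2.trans ?_
      simp only [ContinuousLinearMap.smulRight_apply, ContinuousLinearMap.id_apply]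
      rw [h _ _ hx.2])
  refine ⟨s, w, ?_⟩
  simpa only [smul_smul] using h

theorem integral_kernel_eq [MeasurableSpace E] [BorelSpace E] (μ : Measure E)
    [μ.IsAddHaarMeasure] (F : E → W) (hKm : MeasurableSet K) {h : E → ℝ} {r : ℝ}
    (hsupp : ∀ o ∉ Metric.closedBall (0 : E) r, h o = 0) {ε : ℝ} (hε : 0 < ε) (c : E)
    (hc : ∀ o ∈ Metric.closedBall (0 : E) r, c + ε • o ∈ K) :
    ∫ o in Metric.closedBall (0 : E) r, h o • F (c + ε • o) ∂μ =
      ∫ z in K, (|((ε⁻¹) ^ Module.finrank ℝ E)⁻¹|⁻¹ * h (ε⁻¹ • (z - c))) • F z ∂μ := by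
  set d := Module.finrank ℝ E
  let Ψ : E → W := fun o => h o • K.indicator F (c + ε • o)
  have h1 : ∫ o in Metric.closedBall (0 : E) r, h o • F (c + ε • o) ∂μ = ∫ o, Ψ o ∂μ := by
    have h0 : ∫ o in Metric.closedBall (0 : E) r, Ψ o ∂μ = ∫ o, Ψ o ∂μ :=
      setIntegral_eq_integral_of_forall_compl_eq_zero fun o ho => by
        simp only [Ψ, hsupp o ho, zero_smul]
    rw [← h0]
    refine setIntegral_congr_fun (Metric.isClosed_closedBall (x := (0 : E))).measurableSet
      fun o ho => ?_
    simp only [Ψ, indicator_of_mem (hc o ho)]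
  have h2 : ∫ z, Ψ (ε⁻¹ • (z - c)) ∂μ = |((ε⁻¹) ^ d)⁻¹| • ∫ o, Ψ o ∂μ := by
    rw [← Measure.integral_comp_smul μ Ψ ε⁻¹]
    exact integral_sub_right_eq_self (fun z => Ψ (ε⁻¹ • z)) c
  have h3 : ∀ z, Ψ (ε⁻¹ • (z - c)) = K.indicator (fun z => h (ε⁻¹ • (z - c)) • F z) z := fun z => by
    simp only [Ψ]
    rw [smul_smul, mul_inv_cancel₀ hε.ne', one_smul, add_sub_cancel]
    by_cases hz : z ∈ K
    · rw [indicator_of_mem hz, indicator_of_mem hz]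
    · rw [indicator_of_notMem hz, indicator_of_notMem hz, smul_zero]
  have hC : |((ε⁻¹) ^ d)⁻¹| ≠ 0 := by positivity
  simp_rw [mul_smul]
  rw [integral_smul, ← integral_indicator hKm]
  simp_rw [← h3]
  rw [h2, inv_smul_smul₀ hC, h1]

theorem exists_tendsto_averages (hK : Convex ℝ K) (hKc : IsCompact K)
    (hi : (interior K).Nonempty) {F : E → W} (hF : ContDiffOn ℝ ∞ F K) [MeasurableSpace E]
    [BorelSpace E] (μ : Measure E) [μ.IsAddHaarMeasure] : ∃ G : ℕ → E → W,
      TendstoDirDerivs K G F ∧ ∀ n, ∃ κ : E × E → ℝ, ContDiff ℝ ∞ κ ∧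
        EqOn (G n) (fun y => ∫ z in K, κ (y, z) • F z ∂μ) K := by
  have hd := uniqueDiffOn_convex hK hi
  obtain ⟨p, hp⟩ := hi
  obtain ⟨r, hr, hrK⟩ := Metric.nhds_basis_closedBall.mem_iff.1 (mem_interior_iff_mem_nhds.1 hp)
  let φ : ContDiffBump (0 : E) := ⟨r / 2, r, by positivity, by linarith⟩
  let h : E → ℝ := φ.normed μ
  have hh : ContDiff ℝ ∞ h := φ.contDiff_normed
  have hsupp : ∀ o ∉ Metric.closedBall (0 : E) r, h o = 0 := fun o ho => by
    have h1 : o ∉ Function.support (φ.normed μ) := by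
      rw [φ.support_normed_eq]
      exact fun h => ho (Metric.ball_subset_closedBall h)
    exact Function.notMem_support.1 h1
  have hint : ∫ o in Metric.closedBall (0 : E) r, h o ∂μ = 1 := by
    rw [setIntegral_eq_integral_of_forall_compl_eq_zero hsupp]
    exact φ.integral_normed
  set B := Metric.closedBall (0 : E) r with hB
  have hBc : IsCompact B := isCompact_closedBall 0 r
  have hmem : ∀ ε ∈ Icc (0 : ℝ) 1, ∀ o ∈ B, ∀ y ∈ K, (1 - ε) • y + ε • (p + o) ∈ K :=
    fun ε hε o ho y hy => by
      refine hK hy (hrK ?_) (by linarith [hε.2]) hε.1 (by ring)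
      rw [Metric.mem_closedBall, dist_eq_norm, add_sub_cancel_left]
      rwa [hB, mem_closedBall_zero_iff] at ho
  let u : ℝ → E → E → W := fun ε o y => h o • F ((1 - ε) • y + ε • (p + o))
  have hcomp : ∀ ε ∈ Icc (0 : ℝ) 1, ∀ o ∈ B,
      ContDiffOn ℝ ∞ (fun y => F ((1 - ε) • y + ε • (p + o))) K := fun ε hε o ho =>
    hF.comp (by fun_prop) fun y hy => hmem ε hε o ho y hy
  have hu : ∀ ε ∈ Icc (0 : ℝ) 1, ∀ o ∈ B, ContDiffOn ℝ ∞ (u ε o) K := fun ε hε o ho =>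
    contDiffOn_const.smul (hcomp ε hε o ho)
  have hul : ∀ l, ∀ ε ∈ Icc (0 : ℝ) 1, ∀ o ∈ B, ∀ y ∈ K, dirDerivs K l (u ε o) y =
      h o • (1 - ε) ^ l.length • dirDerivs K l F ((1 - ε) • y + ε • (p + o)) :=
    fun l ε hε o ho y hy => by
      rw [dirDerivs_const_smul hd (hcomp ε hε o ho) (h o) l hy]
      exact congrArg (h o • ·) (dirDerivs_comp_affine hd hF (hmem ε hε o ho) l hy)
  have hcont : ∀ l, ContinuousOn (fun x : ℝ × E × E => dirDerivs K l (u x.1 x.2.1) x.2.2)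
      (Icc 0 1 ×ˢ B ×ˢ K) := fun l => by
    have h1 : ContinuousOn (fun x : ℝ × E × E =>
        dirDerivs K l F ((1 - x.1) • x.2.2 + x.1 • (p + x.2.1))) (Icc 0 1 ×ˢ B ×ˢ K) :=
      (contDiffOn_dirDerivs hd hF l).continuousOn.comp (by fun_prop)
        fun x hx => hmem x.1 hx.1 x.2.1 hx.2.1 x.2.2 hx.2.2
    have h2 : ContinuousOn (fun x : ℝ × E × E => h x.2.1) (Icc 0 1 ×ˢ B ×ˢ K) :=
      (hh.continuous.comp (by fun_prop)).continuousOn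
    refine (h2.smul ((by fun_prop : ContinuousOn (fun x : ℝ × E × E => (1 - x.1) ^ l.length)
      _).smul h1)).congr fun x hx => ?_
    exact hul l x.1 hx.1 x.2.1 hx.2.1 x.2.2 hx.2.2
  have hcont' : ∀ ε ∈ Icc (0 : ℝ) 1, ∀ l,
      ContinuousOn (fun x : E × E => dirDerivs K l (u ε x.1) x.2) (B ×ˢ K) := fun ε hε l =>
    (hcont l).comp (by fun_prop : ContinuousOn (fun x : E × E => (ε, x)) _) fun x hx => ⟨hε, hx⟩
  let e : ℕ → ℝ := fun n => 1 / ((n : ℝ) + 1)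
  have he : ∀ n, 0 < e n := fun n => by positivity
  have heI : ∀ n, e n ∈ Icc (0 : ℝ) 1 := fun n => ⟨(he n).le, by
    rw [div_le_one (by positivity)]; linarith [(Nat.cast_nonneg n : (0 : ℝ) ≤ n)]⟩
  have key := fun n => contDiffOn_integral μ hBc hK hKc hd (hu (e n) (heI n)) (hcont' (e n) (heI n))
  refine ⟨fun n y => ∫ o in B, u (e n) o y ∂μ, fun l => ?_, fun n => ?_⟩
  · refine Metric.tendstoUniformlyOn_iff.2 fun δ hδ => ?_
    set c := μ.real B with hcdef
    have hc0 : 0 ≤ c := measureReal_nonneg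
    obtain ⟨η, hη, hηc⟩ := Metric.uniformContinuousOn_iff.1
      ((isCompact_Icc.prod (hBc.prod hKc)).uniformContinuousOn_of_continuous (hcont l))
      (δ / (c + 1)) (by positivity)
    have hlim : Tendsto e atTop (𝓝 0) := tendsto_one_div_add_atTop_nhds_zero_nat
    filter_upwards [hlim.eventually (gt_mem_nhds hη)] with n hn y hy
    rw [(key n).2.1 l hy, dist_comm, dist_eq_norm]
    have h0 : (0 : ℝ) ∈ Icc (0 : ℝ) 1 := ⟨le_rfl, zero_le_one⟩
    have h1 : dirDerivs K l F y = ∫ o in B, dirDerivs K l (u 0 o) y ∂μ := by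
      have h2 : ∫ o in B, dirDerivs K l (u 0 o) y ∂μ = ∫ o in B, h o • dirDerivs K l F y ∂μ := by
        refine setIntegral_congr_fun hBc.measurableSet fun o ho => ?_
        rw [hul l 0 h0 o ho y hy]
        simp
      rw [h2, integral_smul_const, hint, one_smul]
    have hi : ∀ ε ∈ Icc (0 : ℝ) 1, IntegrableOn (fun o => dirDerivs K l (u ε o) y) B μ :=
      fun ε hε => ((hcont' ε hε l).comp (by fun_prop : ContinuousOn (fun o => (o, y)) B)
        fun o ho => ⟨ho, hy⟩).integrableOn_compact hBc
    rw [h1, ← integral_sub (hi _ (heI n)) (hi 0 h0)]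
    refine (norm_setIntegral_le_of_norm_le_const (C := δ / (c + 1)) hBc.measure_lt_top
      fun o ho => ?_).trans_lt ?_
    · rw [← dist_eq_norm]
      refine (hηc (e n, o, y) ⟨heI n, ho, hy⟩ (0, o, y) ⟨h0, ho, hy⟩ ?_).le
      rw [Prod.dist_eq, dist_self, max_eq_left dist_nonneg, Real.dist_0_eq_abs,
        abs_of_pos (he n)]
      exact hn
    · rw [← hcdef, div_mul_eq_mul_div, div_lt_iff₀ (by positivity)]
      nlinarith
  · refine ⟨fun x => |(((e n)⁻¹) ^ Module.finrank ℝ E)⁻¹|⁻¹ *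
      h ((e n)⁻¹ • (x.2 - ((1 - e n) • x.1 + e n • p))), ?_, fun y hy => ?_⟩
    · exact contDiff_const.mul (hh.comp (by fun_prop))
    · have h1 := integral_kernel_eq μ F hKc.measurableSet hsupp (he n)
        ((1 - e n) • y + e n • p) fun o ho => by
          rw [add_assoc, ← smul_add]; exact hmem (e n) (heI n) o ho y hy
      refine Eq.trans ?_ h1
      simp only [u, smul_add, add_assoc, hB]

/-- Smooth functions on a compact convex set with nonempty interior are approximated, with all
derivatives, by finite sums of products of a smooth scalar function with a vector. -/
theorem exists_dirDerivs_approx (hK : Convex ℝ K) (hKc : IsCompact K)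
    (hi : (interior K).Nonempty) {F : E → W} (hF : ContDiffOn ℝ ∞ F K) (L : Finset (List E))
    {δ : ℝ} (hδ : 0 < δ) : ∃ (s : Finset E) (κ : E → E → ℝ), (∀ z, ContDiff ℝ ∞ (κ z)) ∧
      ∀ l ∈ L, ∀ y ∈ K, ‖dirDerivs K l F y - dirDerivs K l (fun y => ∑ z ∈ s, κ z y • F z) y‖ < δ := by
  borelize E
  let μ : Measure E := Measure.addHaar
  have hd := uniqueDiffOn_convex hK hi
  obtain ⟨G, hG, hGκ⟩ := exists_tendsto_averages hK hKc hi hF μ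
  have h1 : ∀ᶠ n in atTop, ∀ l ∈ L, ∀ y ∈ K,
      ‖dirDerivs K l F y - dirDerivs K l (G n) y‖ < δ / 2 :=
    (Finset.eventually_all L).2 fun l _ => by
      simpa only [dist_eq_norm] using Metric.tendstoUniformlyOn_iff.1 (hG l) (δ / 2) (half_pos hδ)
  obtain ⟨n, hn⟩ := h1.exists
  obtain ⟨κ, hκ, hGn⟩ := hGκ n
  obtain ⟨s, w, hs⟩ := exists_sum_tendsto_integral hK hKc hd μ hF.continuousOn hκ
  have h2 : ∀ᶠ k in atTop, ∀ l ∈ L, ∀ y ∈ K, ‖dirDerivs K l (G n) y -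
      dirDerivs K l (fun y => ∑ z ∈ s k, (w k z * κ (y, z)) • F z) y‖ < δ / 2 :=
    (Finset.eventually_all L).2 fun l _ => by
      filter_upwards [Metric.tendstoUniformlyOn_iff.1 (hs l) (δ / 2) (half_pos hδ)] with k hk y hy
      rw [dirDerivs_congr hd hGn l hy, ← dist_eq_norm]
      exact hk y hy
  obtain ⟨k, hk⟩ := h2.exists
  refine ⟨s k, fun z y => w k z * κ (y, z), fun z => contDiff_const.mul (hκ.comp (by fun_prop)),
    fun l hl y hy => ?_⟩
  calc _ ≤ _ := norm_sub_le_norm_sub_add_norm_sub _ (dirDerivs K l (G n) y) _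
    _ < δ / 2 + δ / 2 := add_lt_add (hn l hl y hy) (hk l hl y hy)
    _ = δ := add_halves δ

end LocalDensity

section ApproxBy

variable {X ι : Type*} [AddCommGroup X] [Module ℂ X]

/-- The vector `x` is in the closure of `N` for the topology of the seminorms `q`. -/
def ApproxBy (N : Submodule ℂ X) (q : ι → Seminorm ℂ X) (x : X) : Prop :=
  ∀ (J : Finset ι) (δ : ℝ), 0 < δ → ∃ y ∈ N, ∀ j ∈ J, q j (x - y) < δ

variable {N : Submodule ℂ X} {q : ι → Seminorm ℂ X}

theorem ApproxBy.add {x y : X} (hx : ApproxBy N q x) (hy : ApproxBy N q y) :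
    ApproxBy N q (x + y) := by
  intro J δ hδ
  obtain ⟨a, ha, hxa⟩ := hx J (δ / 2) (half_pos hδ)
  obtain ⟨b, hb, hyb⟩ := hy J (δ / 2) (half_pos hδ)
  refine ⟨a + b, N.add_mem ha hb, fun j hj => ?_⟩
  rw [add_sub_add_comm]
  linarith [map_add_le_add (q j) (x - a) (y - b), hxa j hj, hyb j hj]

theorem ApproxBy.of_mem {x : X} (hx : x ∈ N) : ApproxBy N q x :=
  fun _ δ hδ => ⟨x, hx, fun j _ => by rw [sub_self, map_zero]; exact hδ⟩

theorem ApproxBy.sum {κ : Type*} (s : Finset κ) {f : κ → X} (h : ∀ i ∈ s, ApproxBy N q (f i)) :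
    ApproxBy N q (∑ i ∈ s, f i) := by
  classical
  induction s using Finset.induction_on with
  | empty => rw [Finset.sum_empty]; exact .of_mem N.zero_mem
  | insert i s hi ih =>
    rw [Finset.sum_insert hi]
    exact (h i (Finset.mem_insert_self i s)).add (ih fun j hj => h j (Finset.mem_insert_of_mem hj))

theorem ApproxBy.of_tendsto {x : X} {y : ℕ → X} (hy : ∀ n, ApproxBy N q (y n))
    (h : ∀ j, Tendsto (fun n => q j (x - y n)) atTop (𝓝 0)) : ApproxBy N q x := by
  intro J δ hδ
  have h1 : ∀ᶠ n in atTop, ∀ j ∈ J, q j (x - y n) < δ / 2 :=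
    (Finset.eventually_all J).2 fun j _ => (h j).eventually (gt_mem_nhds (half_pos hδ))
  obtain ⟨n, hn⟩ := h1.exists
  obtain ⟨a, ha, hna⟩ := hy n J (δ / 2) (half_pos hδ)
  refine ⟨a, ha, fun j hj => ?_⟩
  have := map_add_le_add (q j) (x - y n) (y n - a)
  rw [sub_add_sub_cancel] at this
  linarith [hn j hj, hna j hj]

end ApproxBy

section Glue

variable {E : Type*} [NormedAddCommGroup E] [NormedSpace ℝ E]
  {H : Type*} [TopologicalSpace H]
  {I : ModelWithCorners ℝ E H} {M : Type*} [TopologicalSpace M] [ChartedSpace H M]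
  [IsManifold I ∞ M]

theorem contMDiff_glue {W : Type*} [NormedAddCommGroup W] [NormedSpace ℝ W] {c : M} {K : Set E}
    {ρ : M → ℝ} (hρ : ContMDiff I 𝓘(ℝ, ℝ) ∞ ρ)
    (hs : ∀ x ∈ tsupport ρ, x ∈ (extChartAt I c).source ∧ K ∈ 𝓝[range I] (extChartAt I c x))
    {g : E → W} (hg : ContDiffOn ℝ ∞ g K) :
    ContMDiff I 𝓘(ℝ, W) ∞ fun x => ρ x • g (extChartAt I c x) := by
  refine contMDiff_of_tsupport fun x hx => ?_
  obtain ⟨hxs, hxK⟩ := hs x (tsupport_smul_subset_left ρ (fun x => g (extChartAt I c x)) hx)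
  have hxR : extChartAt I c x ∈ range I :=
    extChartAt_target_subset_range c ((extChartAt I c).map_source hxs)
  refine (hρ x).smul ?_
  have h1 : ContMDiffWithinAt 𝓘(ℝ, E) 𝓘(ℝ, W) ∞ g (range I) (extChartAt I c x) :=
    ((hg _ (mem_of_mem_nhdsWithin hxR hxK)).mono_of_mem_nhdsWithin hxK).contMDiffWithinAt
  have h2 : ContMDiffWithinAt I 𝓘(ℝ, E) ∞ (extChartAt I c) univ x :=
    (contMDiffAt_extChartAt' (by rwa [← extChartAt_source I])).contMDiffWithinAt
  exact (h1.comp x h2 fun z _ => mem_range_self _).contMDiffAt univ_mem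

theorem isOpen_niceRegion (c : M) (K : Set E) :
    IsOpen {x | x ∈ (extChartAt I c).source ∧ K ∈ 𝓝[range I] (extChartAt I c x)} := by
  refine isOpen_iff_mem_nhds.2 fun x hx => ?_
  have h1 : Tendsto (extChartAt I c) (𝓝 x) (𝓝[range I] (extChartAt I c x)) :=
    tendsto_nhdsWithin_iff.2 ⟨continuousAt_extChartAt' hx.1,
      Eventually.of_forall fun z => mem_range_self _⟩
  filter_upwards [(isOpen_extChartAt_source c).mem_nhds hx.1,
    h1.eventually (eventually_eventually_nhdsWithin.2 hx.2)] with z hz1 hz2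
  exact ⟨hz1, hz2⟩

end Glue

section LocalSmooth

variable {E : Type*} [NormedAddCommGroup E] [NormedSpace ℝ E] [FiniteDimensional ℝ E]

/-- Functions which are smooth on `K`. -/
def LocalSmooth (K : Set E) (Q : Type*) [NormedAddCommGroup Q] [NormedSpace ℂ Q] :
    Submodule ℂ (E → Q) where
  carrier := {g | ContDiffOn ℝ ∞ g K}
  add_mem' hf hg := ContDiffOn.add hf hg
  zero_mem' := contDiffOn_const
  smul_mem' c _ hf := ContDiffOn.const_smul c hf

/-- The uniform norms of the derivatives on `K`. -/
def localSem {K : Set E} (hc : IsCompact K) (hd : UniqueDiffOn ℝ K) (Q : Type*)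
    [NormedAddCommGroup Q] [NormedSpace ℂ Q] (k : ℕ) : Seminorm ℂ (LocalSmooth K Q) :=
  have hb : ∀ f : LocalSmooth K Q, BddAbove (range fun y : K => ‖iteratedFDerivWithin ℝ k f.1 K y‖) :=
    fun f => bddAbove_norm_image hc
      (f.2.continuousOn_iteratedFDerivWithin (by exact_mod_cast le_top) hd)
  Seminorm.of (fun f => ⨆ y : K, ‖iteratedFDerivWithin ℝ k f.1 K y‖)
    (fun f g => Real.iSup_le (fun y => by
        have : iteratedFDerivWithin ℝ k (f + g).1 K y = iteratedFDerivWithin ℝ k f.1 K y +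
            iteratedFDerivWithin ℝ k g.1 K y :=
          iteratedFDerivWithin_add_apply ((f.2 y y.2).of_le (by exact_mod_cast le_top))
            ((g.2 y y.2).of_le (by exact_mod_cast le_top)) hd y.2
        rw [this]
        exact (norm_add_le _ _).trans (add_le_add (le_ciSup (hb f) y) (le_ciSup (hb g) y)))
      (add_nonneg (Real.iSup_nonneg fun _ => norm_nonneg _)
        (Real.iSup_nonneg fun _ => norm_nonneg _)))
    (fun z f => by
      rw [Real.mul_iSup_of_nonneg (norm_nonneg z)]
      congr 1
      funext y
      have : iteratedFDerivWithin ℝ k (z • f).1 K y = z • iteratedFDerivWithin ℝ k f.1 K y :=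
        iteratedFDerivWithin_const_smul_apply (a := z) (f := f.1)
          ((f.2 y y.2).of_le (by exact_mod_cast le_top)) hd y.2
      rw [this, norm_smul])

variable {K : Set E} (hc : IsCompact K) (hd : UniqueDiffOn ℝ K) {Q : Type*}
  [NormedAddCommGroup Q] [NormedSpace ℂ Q]

theorem norm_le_localSem (k : ℕ) (f : LocalSmooth K Q) {y : E} (hy : y ∈ K) :
    ‖iteratedFDerivWithin ℝ k f.1 K y‖ ≤ localSem hc hd Q k f :=
  le_ciSup (bddAbove_norm_image hc
      (f.2.continuousOn_iteratedFDerivWithin (by exact_mod_cast le_top) hd)) (⟨y, hy⟩ : K)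

theorem localSem_le {k : ℕ} {f : LocalSmooth K Q} {C : ℝ} (hC : 0 ≤ C)
    (h : ∀ y ∈ K, ‖iteratedFDerivWithin ℝ k f.1 K y‖ ≤ C) : localSem hc hd Q k f ≤ C :=
  Real.iSup_le (fun y => h y y.2) hC

theorem iteratedFDerivWithin_sub_local (k : ℕ) (f g : LocalSmooth K Q) {y : E} (hd : UniqueDiffOn ℝ K)
    (hy : y ∈ K) : iteratedFDerivWithin ℝ k (f - g).1 K y = iteratedFDerivWithin ℝ k f.1 K y -
      iteratedFDerivWithin ℝ k g.1 K y :=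
  iteratedFDerivWithin_sub_apply ((f.2 y hy).of_le (by exact_mod_cast le_top))
    ((g.2 y hy).of_le (by exact_mod_cast le_top)) hd hy

theorem seqComplete_localSem [CompleteSpace Q] (hK : Convex ℝ K) :
    SeqComplete (localSem hc hd Q) := by
  intro f hf
  have hj : ∀ k, ∃ p : E → E [×k]→L[ℝ] Q, TendstoUniformlyOn
      (fun n => iteratedFDerivWithin ℝ k (f n).1 K) p atTop K :=
    fun k => exists_tendstoUniformlyOn_of_cauchy fun ε hε => by
      obtain ⟨N, hN⟩ := hf k ε hε
      refine ⟨N, fun m hm n hn y hy => lt_of_le_of_lt ?_ (hN m hm n hn)⟩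
      rw [← iteratedFDerivWithin_sub_local k _ _ hd hy]
      exact norm_le_localSem hc hd k (f m - f n) hy
  choose p hp using hj
  have key := contDiffOn_of_tendstoUniformlyOn hK hd (fun n => (f n).2)
    (g := fun y => p 0 y 0) (fun y hy => by
      have h1 : Tendsto (fun n => iteratedFDerivWithin ℝ 0 (f n).1 K y 0) atTop (𝓝 (p 0 y 0)) :=
        ((ContinuousMultilinearMap.apply ℝ (fun _ : Fin 0 => E) Q 0).continuous.tendsto _).comp
          ((hp 0).tendsto_at hy)
      exact h1) hp
  refine ⟨⟨_, key.1⟩, fun k => Metric.tendsto_atTop.2 fun ε hε => ?_⟩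
  obtain ⟨N, hN⟩ := eventually_atTop.1 (Metric.tendstoUniformlyOn_iff.1 (hp k) (ε / 2)
    (by linarith))
  refine ⟨N, fun n hn => ?_⟩
  rw [Real.dist_0_eq_abs, abs_of_nonneg (apply_nonneg _ _)]
  refine lt_of_le_of_lt (localSem_le hc hd (by linarith) fun y hy => ?_) (half_lt_self hε)
  have := hN n hn y hy
  rw [iteratedFDerivWithin_sub_local k _ _ hd hy]
  rw [dist_comm, dist_eq_norm, ← key.2 k y hy] at this
  exact this.le

/-- The approximations of a smooth function by sums of products of a scalar function and a
vector, as a sequence. -/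
theorem exists_localSem_approx [CompleteSpace Q] (hK : Convex ℝ K) (hi : (interior K).Nonempty)
    (F : LocalSmooth K Q) : ∃ (s : ℕ → Finset E) (κ : ℕ → E → E → ℝ)
      (hκ : ∀ n z, ContDiff ℝ ∞ (κ n z)), ∀ k, Tendsto (fun n => localSem hc hd Q k
        (F - ∑ z ∈ s n, ⟨fun y => κ n z y • F.1 z, ((hκ n z).smul contDiff_const).contDiffOn⟩))
        atTop (𝓝 0) := by
  classical
  let b := Module.finBasis ℝ E
  choose C hC hCk using fun k => exists_multilinear_norm_le (F := Q) b k
  let L : ℕ → Finset (List E) := fun n => (Finset.range n).biUnion fun k =>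
    Finset.univ.image fun r : Fin k → Fin (Module.finrank ℝ E) => List.ofFn fun i => b (r i)
  choose s κ hκ h using fun n : ℕ => exists_dirDerivs_approx hK hc hi F.2 (L n)
    (δ := 1 / ((n : ℝ) + 1)) (by positivity)
  let P : ℕ → LocalSmooth K Q := fun n =>
    ∑ z ∈ s n, ⟨fun y => κ n z y • F.1 z, ((hκ n z).smul contDiff_const).contDiffOn⟩
  have hP : ∀ n, (P n).1 = fun y => ∑ z ∈ s n, κ n z y • F.1 z := fun n => by
    funext y
    simp [P, Finset.sum_apply, AddSubmonoidClass.coe_finset_sum]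
  refine ⟨s, κ, hκ, fun k => ?_⟩
  change Tendsto (fun n => localSem hc hd Q k (F - P n)) atTop (𝓝 0)
  have hlim : Tendsto (fun n : ℕ => C k * (Fintype.card (Fin k → Fin (Module.finrank ℝ E)) *
      (1 / ((n : ℝ) + 1)))) atTop (𝓝 0) := by
    have h0 : Tendsto (fun n : ℕ => 1 / ((n : ℝ) + 1)) atTop (𝓝 0) :=
      tendsto_one_div_add_atTop_nhds_zero_nat
    simpa using (h0.const_mul _).const_mul _
  refine squeeze_zero' (Eventually.of_forall fun n => apply_nonneg _ _) ?_ hlim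
  filter_upwards [eventually_gt_atTop k] with n hn
  refine localSem_le hc hd (mul_nonneg (hC k) (by positivity)) fun y hy => ?_
  refine (hCk k _).trans (mul_le_mul_of_nonneg_left ?_ (hC k))
  rw [← Finset.card_univ, ← nsmul_eq_mul]
  refine Finset.sum_le_card_nsmul _ _ _ fun r _ => ?_
  have h1 := h n (List.ofFn fun i => b (r i)) (Finset.mem_biUnion.2
    ⟨k, Finset.mem_range.2 hn, Finset.mem_image_of_mem _ (Finset.mem_univ r)⟩) y hy
  rw [iteratedFDerivWithin_sub_local k _ _ hd hy, sub_apply,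
    iteratedFDerivWithin_apply_eq_dirDerivs hd F.2 _ hy,
    iteratedFDerivWithin_apply_eq_dirDerivs hd (P n).2 _ hy, hP]
  exact h1.le

end LocalSmooth

section GlobalDensity

theorem seqComplete_norm (Q : Type*) [NormedAddCommGroup Q] [NormedSpace ℂ Q] [CompleteSpace Q] :
    SeqComplete (fun _ : Unit => normSeminorm ℂ Q) := by
  intro x hx
  have hc : CauchySeq x := Metric.cauchySeq_iff.2 fun ε hε => by
    obtain ⟨N, hN⟩ := hx () ε hε
    exact ⟨N, fun m hm n hn => by rw [dist_eq_norm]; exact hN m hm n hn⟩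
  obtain ⟨a, ha⟩ := cauchySeq_tendsto_of_complete hc
  exact ⟨a, fun _ => tendsto_iff_norm_sub_tendsto_zero.1 ha⟩

/-- Closed graph theorem for maps into a space with complete seminorms dominating a norm. -/
theorem dominatedBy_of_tendsto_zero {X S ι κ : Type*} [AddCommGroup X] [Module ℂ X]
    [PreCStarAlgebra S] [Countable ι] [Countable κ] {q : ι → Seminorm ℂ X} {r : κ → Seminorm ℂ S}
    (hq : SeqComplete q) (hr : SeqComplete r) (hn : DominatedBy (normSeminorm ℂ S) r)
    (T : X →ₗ[ℂ] S) (hT : DominatedBy ((normSeminorm ℂ S).comp T) q) (j : κ) :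
    DominatedBy ((r j).comp T) q := by
  refine closedGraph hq hr T (fun x y hx hy => ?_) j
  suffices h : y = 0 by intro j; rw [h, map_zero]
  have h1 := tendsto_of_le_mul_sum hT hx
  have h2 := tendsto_of_le_mul_sum hn hy
  have h3 : ∀ n, ‖y‖ ≤ ‖T (x n)‖ + ‖T (x n) - y‖ := fun n => by
    have := norm_sub_le (T (x n)) (T (x n) - y)
    rwa [sub_sub_cancel] at this
  have h4 := ge_of_tendsto' (h1.add h2) h3
  rw [add_zero] at h4
  exact norm_le_zero_iff.1 h4

variable {E : Type*} [NormedAddCommGroup E] [NormedSpace ℝ E] [FiniteDimensional ℝ E]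
  {H : Type*} [TopologicalSpace H]
  {I : ModelWithCorners ℝ E H} {M : Type*} [TopologicalSpace M] [ChartedSpace H M]
  [IsManifold I ∞ M] [CompactSpace M] {Q : Type*} [CStarAlgebra Q]

/-- Extension by zero of a local smooth function multiplied with a cut-off function. -/
def glue {c : M} {K : Set E} {ρ : M → ℝ} (hρ : ContMDiff I 𝓘(ℝ, ℝ) ∞ ρ)
    (hs : ∀ x ∈ tsupport ρ, x ∈ (extChartAt I c).source ∧ K ∈ 𝓝[range I] (extChartAt I c x))
    (Q : Type*) [CStarAlgebra Q] : LocalSmooth K Q →ₗ[ℂ] SmoothAlg I M Q where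
  toFun g := .mk (fun x => ρ x • g.1 (extChartAt I c x)) (contMDiff_glue hρ hs g.2)
  map_add' f g := SmoothAlg.ext fun x => smul_add (ρ x) _ _
  map_smul' z f := SmoothAlg.ext fun x => smul_comm (ρ x) z _

theorem glue_apply {c : M} {K : Set E} {ρ : M → ℝ} (hρ : ContMDiff I 𝓘(ℝ, ℝ) ∞ ρ)
    (hs : ∀ x ∈ tsupport ρ, x ∈ (extChartAt I c).source ∧ K ∈ 𝓝[range I] (extChartAt I c x))
    (g : LocalSmooth K Q) (x : M) : glue hρ hs Q g x = ρ x • g.1 (extChartAt I c x) := rfl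

theorem exists_abs_le {ρ : M → ℝ} (hρ : Continuous ρ) : ∃ C, 0 ≤ C ∧ ∀ x, |ρ x| ≤ C := by
  obtain ⟨C, hC⟩ := isCompact_univ.exists_bound_of_continuousOn hρ.continuousOn
  exact ⟨max C 0, le_max_right _ _, fun x => (hC x (mem_univ x)).trans (le_max_left _ _)⟩

theorem glue_dominatedBy {c : M} {K : Set E} (hK : NiceChart I c K) {ρ : M → ℝ}
    (hρ : ContMDiff I 𝓘(ℝ, ℝ) ∞ ρ)
    (hs : ∀ x ∈ tsupport ρ, x ∈ (extChartAt I c).source ∧ K ∈ 𝓝[range I] (extChartAt I c x))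
    (j : coverCentres I M × ℕ) :
    DominatedBy ((coverSem I M Q j).comp (glue hρ hs Q)) (localSem hK.compact hK.unique Q) := by
  refine dominatedBy_of_tendsto_zero (seqComplete_localSem _ _ hK.convex) seqComplete_coverSem
    norm_dominatedBy_coverSem _ ?_ j
  obtain ⟨C, hC0, hC⟩ := exists_abs_le hρ.continuous
  refine .of_le (i := 0) hC0 fun g => SmoothAlg.norm_le (mul_nonneg hC0 (apply_nonneg _ _))
    fun x => ?_
  change ‖ρ x • g.1 (extChartAt I c x)‖ ≤ _
  rw [norm_smul]
  by_cases hx : x ∈ tsupport ρ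
  · refine mul_le_mul (hC x) ?_ (norm_nonneg _) hC0
    obtain ⟨hxs, hxK⟩ := hs x hx
    have hxR : extChartAt I c x ∈ range I :=
      extChartAt_target_subset_range c ((extChartAt I c).map_source hxs)
    have := norm_le_localSem hK.compact hK.unique 0 g (mem_of_mem_nhdsWithin hxR hxK)
    rwa [norm_iteratedFDerivWithin_zero] at this
  · rw [image_eq_zero_of_notMem_tsupport hx, norm_zero, zero_mul]
    exact mul_nonneg hC0 (apply_nonneg _ _)

/-- The map `q ↦ f • q` for a scalar smooth function `f`. -/
def smulVec {f : M → ℝ} (hf : ContMDiff I 𝓘(ℝ, ℝ) ∞ f) (Q : Type*) [CStarAlgebra Q] :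
    Q →ₗ[ℂ] SmoothAlg I M Q where
  toFun q := .mk (fun x => f x • q) (hf.smul contMDiff_const)
  map_add' p q := SmoothAlg.ext fun x => smul_add (f x) p q
  map_smul' z q := SmoothAlg.ext fun x => smul_comm (f x) z q

theorem smulVec_apply {f : M → ℝ} (hf : ContMDiff I 𝓘(ℝ, ℝ) ∞ f) (q : Q) (x : M) :
    smulVec hf Q q x = f x • q := rfl

theorem smulVec_dominatedBy {f : M → ℝ} (hf : ContMDiff I 𝓘(ℝ, ℝ) ∞ f)
    (j : coverCentres I M × ℕ) :
    DominatedBy ((coverSem I M Q j).comp (smulVec hf Q)) (fun _ : Unit => normSeminorm ℂ Q) := by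
  refine dominatedBy_of_tendsto_zero (seqComplete_norm Q) seqComplete_coverSem
    norm_dominatedBy_coverSem _ ?_ j
  obtain ⟨C, hC0, hC⟩ := exists_abs_le hf.continuous
  refine .of_le (i := ()) hC0 fun q => SmoothAlg.norm_le (mul_nonneg hC0 (apply_nonneg _ _))
    fun x => ?_
  change ‖f x • q‖ ≤ _
  rw [norm_smul]
  exact mul_le_mul_of_nonneg_right (hC x) (norm_nonneg q)

theorem approxBy_smulVec {N : Submodule ℂ (SmoothAlg I M Q)} {D : Set Q} (hD : Dense D)
    (hN : ∀ (f : M → ℝ) (hf : ContMDiff I 𝓘(ℝ, ℝ) ∞ f), ∀ q ∈ D, smulVec hf Q q ∈ N)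
    {f : M → ℝ} (hf : ContMDiff I 𝓘(ℝ, ℝ) ∞ f) (q : Q) :
    ApproxBy N (coverSem I M Q) (smulVec hf Q q) := by
  obtain ⟨p, hpD, hp⟩ := mem_closure_iff_seq_limit.1 (hD q)
  have h1 := tendsto_iff_norm_sub_tendsto_zero.1 hp
  refine .of_tendsto (y := fun n => smulVec hf Q (p n))
    (fun n => .of_mem (hN f hf (p n) (hpD n))) fun j => ?_
  obtain ⟨s, C, hC0, hC⟩ := smulVec_dominatedBy (Q := Q) hf j
  have h2 : ∀ n, coverSem I M Q j (smulVec hf Q q - smulVec hf Q (p n)) ≤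
      C * (s.card * ‖p n - q‖) := fun n => by
    rw [← map_sub, norm_sub_rev]
    refine (hC (q - p n)).trans_eq ?_
    rw [Finset.sum_const, nsmul_eq_mul]
    rfl
  refine squeeze_zero (fun n => apply_nonneg _ _) h2 ?_
  simpa using (h1.const_mul (s.card : ℝ)).const_mul C

theorem approxBy_glue {N : Submodule ℂ (SmoothAlg I M Q)}
    (hN : ∀ (f : M → ℝ) (hf : ContMDiff I 𝓘(ℝ, ℝ) ∞ f) (q : Q),
      ApproxBy N (coverSem I M Q) (smulVec hf Q q))
    {c : M} {K : Set E} (hK : NiceChart I c K) {ρ : M → ℝ} (hρ : ContMDiff I 𝓘(ℝ, ℝ) ∞ ρ)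
    (hs : ∀ x ∈ tsupport ρ, x ∈ (extChartAt I c).source ∧ K ∈ 𝓝[range I] (extChartAt I c x))
    (F : LocalSmooth K Q) : ApproxBy N (coverSem I M Q) (glue hρ hs Q F) := by
  obtain ⟨s, κ, hκ, h⟩ := exists_localSem_approx hK.compact hK.unique hK.convex
    hK.nonempty_interior F
  refine .of_tendsto (y := fun n => glue hρ hs Q
      (∑ z ∈ s n, ⟨fun y => κ n z y • F.1 z, ((hκ n z).smul contDiff_const).contDiffOn⟩))
      (fun n => ?_) fun j => ?_
  · rw [map_sum]
    refine .sum _ fun z _ => ?_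
    have h1 : ContMDiff I 𝓘(ℝ, ℝ) ∞ fun x => ρ x • κ n z (extChartAt I c x) :=
      contMDiff_glue hρ hs (hκ n z).contDiffOn
    have h2 : glue hρ hs Q ⟨fun y => κ n z y • F.1 z, ((hκ n z).smul contDiff_const).contDiffOn⟩ =
        smulVec h1 Q (F.1 z) := SmoothAlg.ext fun x => by
      rw [glue_apply, smulVec_apply, smul_assoc]
    rw [h2]
    exact hN _ h1 _
  · simp_rw [← map_sub]
    exact tendsto_of_le_mul_sum (glue_dominatedBy hK hρ hs j) h

variable [T2Space M]

variable (I M) in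
/-- A smooth partition of unity subordinate to the interiors of the nice sets of the cover. -/
theorem exists_cover_partition : ∃ ρ : coverCentres I M → M → ℝ,
    (∀ c, ContMDiff I 𝓘(ℝ, ℝ) ∞ (ρ c)) ∧ (∀ c, ∀ x ∈ tsupport (ρ c),
      x ∈ (extChartAt I (c : M)).source ∧ coverSet I M c ∈ 𝓝[range I] (extChartAt I (c : M) x)) ∧
    ∀ x, ∑ c, ρ c x = 1 := by
  obtain ⟨f, hf⟩ := SmoothPartitionOfUnity.exists_isSubordinate I (isClosed_univ (X := M))
    (fun c : coverCentres I M => {x | x ∈ (extChartAt I (c : M)).source ∧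
      coverSet I M c ∈ 𝓝[range I] (extChartAt I (c : M) x)})
    (fun c => isOpen_niceRegion (c : M) _) fun x _ => mem_iUnion.2 (exists_mem_cover x)
  refine ⟨fun c => f c, fun c => (f c).contMDiff, fun c x hx => hf c hx, fun x => ?_⟩
  rw [← finsum_eq_sum_of_fintype]
  exact f.sum_eq_one (mem_univ x)

/-- Functions `f • q`, with `f` a scalar smooth function and `q` in a dense set, span a dense
subspace of `C^∞(M, Q)`. -/
theorem approxBy_of_smulVec_mem {N : Submodule ℂ (SmoothAlg I M Q)} {D : Set Q} (hD : Dense D)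
    (hN : ∀ (f : M → ℝ) (hf : ContMDiff I 𝓘(ℝ, ℝ) ∞ f), ∀ q ∈ D, smulVec hf Q q ∈ N)
    (F : SmoothAlg I M Q) : ApproxBy N (coverSem I M Q) F := by
  obtain ⟨ρ, hρ, hs, hsum⟩ := exists_cover_partition I M
  have hF : F = ∑ c, glue (hρ c) (hs c) Q
      ⟨loc I (c : M) F, (contDiffOn_loc_coe F c).mono (coverSet_nice (c : M)).subset⟩ := by
    refine SmoothAlg.ext fun x => ?_
    have h1 : ∀ s : Finset (coverCentres I M), ∀ G : coverCentres I M → SmoothAlg I M Q,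
        (∑ c ∈ s, G c) x = ∑ c ∈ s, G c x := fun s G => map_sum (SmoothAlg.evalₗ x) G s
    rw [h1]
    have h2 : ∀ c : coverCentres I M, glue (hρ c) (hs c) Q ⟨loc I (c : M) F,
        (contDiffOn_loc_coe F c).mono (coverSet_nice (c : M)).subset⟩ x = ρ c x • F x := fun c => by
      rw [glue_apply]
      by_cases hx : x ∈ tsupport (ρ c)
      · change ρ c x • loc I (c : M) F (extChartAt I (c : M) x) = _
        rw [loc_extChartAt (hs c x hx).1]
      · rw [image_eq_zero_of_notMem_tsupport hx, zero_smul, zero_smul]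
    simp_rw [h2]
    rw [← Finset.sum_smul, hsum, one_smul]
  rw [hF]
  exact .sum _ fun c _ => approxBy_glue (fun f hf q => approxBy_smulVec hD hN hf q)
    (coverSet_nice (c : M)) (hρ c) (hs c) _

end GlobalDensity

section Hadamard

variable {E : Type*} [NormedAddCommGroup E] [NormedSpace ℝ E] [FiniteDimensional ℝ E]
  {W : Type*} [NormedAddCommGroup W] [NormedSpace ℝ W] [CompleteSpace W] {K : Set E}

open MeasureTheory in
/-- Hadamard's lemma on a compact convex set. -/
theorem exists_hadamard (hK : Convex ℝ K) (hKc : IsCompact K) (hd : UniqueDiffOn ℝ K)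
    {ι : Type*} [Fintype ι] (b : Module.Basis ι ℝ E) {F : E → W} (hF : ContDiffOn ℝ ∞ F K) {m : E}
    (hm : m ∈ K) : ∃ g : ι → E → W, (∀ j, ContDiffOn ℝ ∞ (g j) K) ∧
      (∀ j, g j m = fderivWithin ℝ F K m (b j)) ∧
      ∀ y ∈ K, F y - F m = ∑ j, b.repr (y - m) j • g j y := by
  have hmem : ∀ t ∈ Icc (0 : ℝ) 1, ∀ y ∈ K, t • y + (1 - t) • m ∈ K := fun t ht y hy =>
    hK hy hm ht.1 (by linarith [ht.2]) (by ring)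
  have hu : ∀ j, ContDiffOn ℝ ∞ (fun y => fderivWithin ℝ F K y (b j)) K := fun j =>
    ContDiffOn.fderivWithin_infty_apply hd hF (b j)
  have hmaps : MapsTo (fun x : ℝ × E => x.1 • x.2 + (1 - x.1) • m) (Icc 0 1 ×ˢ K) K :=
    fun x hx => hmem x.1 hx.1 x.2 hx.2
  have hc : ∀ j l, ContinuousOn (fun x : ℝ × E => dirDerivs K l
      (fun y => fderivWithin ℝ F K (x.1 • y + (1 - x.1) • m) (b j)) x.2) (Icc 0 1 ×ˢ K) := by
    intro j l
    have h1 : ContinuousOn (fun x : ℝ × E => x.1 ^ l.length • dirDerivs K l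
        (fun y => fderivWithin ℝ F K y (b j)) (x.1 • x.2 + (1 - x.1) • m)) (Icc 0 1 ×ˢ K) :=
      ContinuousOn.smul (by fun_prop) (((contDiffOn_dirDerivs hd (hu j) l).continuousOn).comp
        (by fun_prop) hmaps)
    exact h1.congr fun x hx => dirDerivs_comp_affine hd (hu j) (hmem x.1 hx.1) l hx.2
  have key := fun j => contDiffOn_integral volume (Ω₀ := Icc (0 : ℝ) 1) isCompact_Icc hK hKc hd
    (u := fun t y => fderivWithin ℝ F K (t • y + (1 - t) • m) (b j))
    (fun t ht => (hu j).comp (by fun_prop) fun y hy => hmem t ht y hy) (hc j)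
  refine ⟨fun j y => ∫ t in Icc (0 : ℝ) 1, fderivWithin ℝ F K (t • y + (1 - t) • m) (b j),
    fun j => (key j).1, fun j => ?_, fun y hy => ?_⟩
  · have h1 : ∀ t : ℝ, t • m + (1 - t) • m = m := fun t => by rw [← add_smul]; simp
    simp [h1]
  · have hcont : ∀ j, ContinuousOn
        (fun t : ℝ => fderivWithin ℝ F K (t • y + (1 - t) • m) (b j)) (Icc 0 1) := fun j =>
      (hu j).continuousOn.comp (by fun_prop) fun t ht => hmem t ht y hy
    have hFd : DifferentiableOn ℝ F K := hF.differentiableOn (by simp)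
    have hder : ∀ t ∈ Icc (0 : ℝ) 1, HasDerivWithinAt (fun t : ℝ => F (t • y + (1 - t) • m))
        (∑ j, b.repr (y - m) j • fderivWithin ℝ F K (t • y + (1 - t) • m) (b j)) (Icc 0 1) t := by
      intro t ht
      have h1 : HasDerivWithinAt (fun t : ℝ => t • y + (1 - t) • m) (y - m) (Icc 0 1) t := by
        have h2 := ((hasDerivAt_id t).smul_const y).add
          (((hasDerivAt_id t).const_sub 1).smul_const m)
        refine (h2.congr_deriv ?_).hasDerivWithinAt
        simp [sub_eq_add_neg]
      have h3 := (hFd _ (hmem t ht y hy)).hasFDerivWithinAt.comp_hasDerivWithinAt t h1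
        fun s hs => hmem s hs y hy
      refine h3.congr_deriv ?_
      conv_lhs => rw [← b.sum_repr (y - m)]
      rw [map_sum]
      exact Finset.sum_congr rfl fun j _ => map_smul _ _ _
    have h4 := intervalIntegral.integral_eq_sub_of_hasDerivAt_of_le zero_le_one
      (fun t ht => (hder t ht).continuousWithinAt)
      (fun t ht => (hder t (Ioo_subset_Icc_self ht)).hasDerivAt (Icc_mem_nhds ht.1 ht.2))
      (ContinuousOn.intervalIntegrable_of_Icc zero_le_one
        (continuousOn_finset_sum _ fun j _ => (hcont j).const_smul _))
    rw [intervalIntegral.integral_of_le zero_le_one, ← integral_Icc_eq_integral_Ioc,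
      integral_finset_sum (f := fun j t => b.repr (y - m) j •
        fderivWithin ℝ F K (t • y + (1 - t) • m) (b j)) _ fun j _ =>
          ((hcont j).const_smul _).integrableOn_compact isCompact_Icc] at h4
    simp only [one_smul, sub_self, zero_smul, add_zero, sub_zero, zero_add] at h4
    rw [← h4]
    exact Finset.sum_congr rfl fun j _ => integral_smul _ _

end Hadamard

section DerivationStructure

theorem DominatedBy.add {X ι : Type*} [AddCommGroup X] [Module ℂ X] {p p₁ p₂ : Seminorm ℂ X}
    {q : ι → Seminorm ℂ X} (h₁ : DominatedBy p₁ q) (h₂ : DominatedBy p₂ q)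
    (h : ∀ x, p x ≤ p₁ x + p₂ x) : DominatedBy p q := by
  have h3 : DominatedBy p ![p₁, p₂] := .of_sum Finset.univ fun x => (h x).trans_eq (by
    rw [Fin.sum_univ_two]; rfl)
  refine h3.trans fun i => ?_
  fin_cases i
  · exact h₁
  · exact h₂

section Commutator

variable {S : Type*} [PreCStarAlgebra S]

/-- The commutator of two linear maps. -/
def commutator (δ δ' : S →ₗ[ℂ] S) : S →ₗ[ℂ] S := δ ∘ₗ δ' - δ' ∘ₗ δ

theorem commutator_apply (δ δ' : S →ₗ[ℂ] S) (f : S) :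
    commutator δ δ' f = δ (δ' f) - δ' (δ f) := rfl

theorem commutator_leibniz {δ δ' : S →ₗ[ℂ] S} (h : ∀ f g, δ (f * g) = δ f * g + f * δ g)
    (h' : ∀ f g, δ' (f * g) = δ' f * g + f * δ' g) (f g : S) :
    commutator δ δ' (f * g) = commutator δ δ' f * g + f * commutator δ δ' g := by
  simp only [commutator_apply, h, h', map_add]
  noncomm_ring

theorem commutator_star {δ δ' : S →ₗ[ℂ] S} (h : ∀ f, δ (star f) = star (δ f))
    (h' : ∀ f, δ' (star f) = star (δ' f)) (f : S) :
    commutator δ δ' (star f) = star (commutator δ δ' f) := by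
  simp only [commutator_apply, h, h', star_sub]

theorem commutator_dominatedBy {ι : Type*} {q : ι → Seminorm ℂ S} {δ δ' : S →ₗ[ℂ] S}
    (h : ∀ j, DominatedBy ((q j).comp δ) q) (h' : ∀ j, DominatedBy ((q j).comp δ') q) (j : ι) :
    DominatedBy ((q j).comp (commutator δ δ')) q :=
  .add (p₁ := ((q j).comp δ).comp δ') (p₂ := ((q j).comp δ').comp δ)
    (((h j).comp δ').trans h') (((h' j).comp δ).trans h)
    fun f => map_sub_le_add (q j) (δ (δ' f)) (δ' (δ f))

theorem map_one_of_leibniz {δ : S →ₗ[ℂ] S} (h : ∀ f g, δ (f * g) = δ f * g + f * δ g) :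
    δ 1 = 0 := by
  have := h 1 1
  rw [one_mul, one_mul, mul_one] at this
  exact left_eq_add.1 this

end Commutator

variable {E : Type*} [NormedAddCommGroup E] [NormedSpace ℝ E] [FiniteDimensional ℝ E]
  {H : Type*} [TopologicalSpace H]
  {I : ModelWithCorners ℝ E H} {M : Type*} [TopologicalSpace M] [ChartedSpace H M]
  [IsManifold I ∞ M] [CompactSpace M] {Q : Type*} [CStarAlgebra Q]

namespace SmoothAlg

/-- Evaluation at a point. -/
def eval (x : M) : SmoothAlg I M Q →⋆ₐ[ℂ] Q where
  toFun f := f x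
  map_one' := rfl
  map_mul' _ _ := rfl
  map_zero' := rfl
  map_add' _ _ := rfl
  commutes' _ := rfl
  map_star' _ := rfl

variable (I M Q) in
/-- Constant functions. -/
def const : Q →⋆ₐ[ℂ] SmoothAlg I M Q where
  toFun q := .mk (fun _ => q) contMDiff_const
  map_one' := rfl
  map_mul' _ _ := rfl
  map_zero' := rfl
  map_add' _ _ := rfl
  commutes' _ := rfl
  map_star' _ := rfl

theorem const_apply (q : Q) (x : M) : const I M Q q x = q := rfl

theorem norm_const_le (q : Q) : ‖const I M Q q‖ ≤ ‖q‖ := norm_le (norm_nonneg q) fun _ => le_rfl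

end SmoothAlg

/-- A `*`-derivation of `C^∞(M, Q)` which is continuous for the smooth topology. -/
structure IsSmoothDerivation (δ : SmoothAlg I M Q →ₗ[ℂ] SmoothAlg I M Q) : Prop where
  leibniz : ∀ f g, δ (f * g) = δ f * g + f * δ g
  star : ∀ f, δ (star f) = star (δ f)
  dominated : ∀ j, DominatedBy ((coverSem I M Q j).comp δ) (coverSem I M Q)

theorem ClosableStarDerivation.isSmoothDerivation
    (δ : ClosableStarDerivation (SmoothAlg I M Q)) : IsSmoothDerivation δ.toLinearMap :=
  ⟨δ.leibniz', δ.star', δ.dominatedBy seqComplete_coverSem norm_dominatedBy_coverSem⟩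

namespace IsSmoothDerivation

variable {δ δ' : SmoothAlg I M Q →ₗ[ℂ] SmoothAlg I M Q}

theorem commutator (h : IsSmoothDerivation δ) (h' : IsSmoothDerivation δ') :
    IsSmoothDerivation (NiceAlg.commutator δ δ') :=
  ⟨commutator_leibniz h.leibniz h'.leibniz, commutator_star h.star h'.star,
    commutator_dominatedBy h.dominated h'.dominated⟩

theorem map_one (h : IsSmoothDerivation δ) : δ 1 = 0 := map_one_of_leibniz h.leibniz

theorem exists_norm_const_le (h : IsSmoothDerivation δ) :
    ∃ C, 0 ≤ C ∧ ∀ q : Q, ‖δ (SmoothAlg.const I M Q q)‖ ≤ C * ‖q‖ := by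
  have h1 : DominatedBy (((normSeminorm ℂ (SmoothAlg I M Q)).comp δ).comp
      (smulVec (contMDiff_const (c := (1 : ℝ))) Q)) (fun _ : Unit => normSeminorm ℂ Q) :=
    (((norm_dominatedBy_coverSem.comp δ).trans h.dominated).comp _).trans
      (smulVec_dominatedBy (Q := Q) _)
  obtain ⟨s, C, hC, hs⟩ := h1
  refine ⟨C * s.card, by positivity, fun q => ?_⟩
  have h2 : SmoothAlg.const I M Q q = smulVec (contMDiff_const (c := (1 : ℝ))) Q q :=
    SmoothAlg.ext fun x => (one_smul ℝ q).symm
  rw [h2]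
  refine (hs q).trans_eq ?_
  rw [Finset.sum_const, nsmul_eq_mul, mul_assoc]
  rfl

end IsSmoothDerivation

variable [T2Space M]

theorem exists_coverBump (c : M) : ∃ χ : M → ℝ, ContMDiff I 𝓘(ℝ, ℝ) ∞ χ ∧
    (∀ y ∈ coverSet I M c, χ ((extChartAt I c).symm y) = 1) ∧
    tsupport χ ⊆ (extChartAt I c).source := by
  obtain ⟨χ, h1, h2, h3, -⟩ := exists_chart_bump (coverSet_nice (I := I) c).compact
    (coverSet_nice (I := I) c).subset
  exact ⟨χ, h1, h2, h3⟩

variable (I) in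
/-- A cut-off function equal to `1` on the nice set of the cover. -/
def coverBump (c : M) : M → ℝ := (exists_coverBump (I := I) c).choose

theorem contMDiff_coverBump (c : M) : ContMDiff I 𝓘(ℝ, ℝ) ∞ (coverBump I c) :=
  (exists_coverBump (I := I) c).choose_spec.1

theorem coverBump_eq_one {c : M} {x : M} (hx : x ∈ (extChartAt I c).source)
    (hK : extChartAt I c x ∈ coverSet I M c) : coverBump I c x = 1 := by
  have := (exists_coverBump (I := I) c).choose_spec.2.1 _ hK
  rwa [(extChartAt I c).left_inv hx] at this

theorem tsupport_coverBump (c : M) : tsupport (coverBump I c) ⊆ (extChartAt I c).source :=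
  (exists_coverBump (I := I) c).choose_spec.2.2

variable (I) in
/-- The coordinate vector fields of the cover. -/
def coverField (c : M) (j : Fin (Module.finrank ℝ E)) : ChartField I M :=
  ⟨c, coverBump I c, contMDiff_coverBump c, tsupport_coverBump c, Module.finBasis ℝ E j⟩

variable (I Q) in
/-- The coordinate functions of the cover, cut off. -/
def coverCoord (c : M) (j : Fin (Module.finrank ℝ E)) : SmoothAlg I M Q :=
  .mk (fun x => coverBump I c x • ((Module.finBasis ℝ E).coord j (extChartAt I c x) • (1 : Q)))
    (contMDiff_glue (contMDiff_coverBump c) (K := (extChartAt I c).target)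
      (g := fun y => (Module.finBasis ℝ E).coord j y • (1 : Q))
      (fun x hx => ⟨tsupport_coverBump c hx, extChartAt_target_mem_nhdsWithin_of_mem
        ((extChartAt I c).map_source (tsupport_coverBump c hx))⟩)
      ((LinearMap.toContinuousLinearMap ((Module.finBasis ℝ E).coord j)).contDiff.smul
        contDiff_const).contDiffOn)

/-- A derivation of `C^∞(M, Q)` is a combination of the coordinate vector fields and a derivation
of the values. -/
theorem IsSmoothDerivation.apply_eq {δ : SmoothAlg I M Q →ₗ[ℂ] SmoothAlg I M Q}
    (h : IsSmoothDerivation δ) {c m : M} (hm : m ∈ (extChartAt I c).source)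
    (hmK : coverSet I M c ∈ 𝓝[range I] (extChartAt I c m)) (F : SmoothAlg I M Q) :
    δ F m = δ (SmoothAlg.const I M Q (F m)) m +
      ∑ j, δ (coverCoord I Q c j) m * (coverField I c j).lin Q F m := by
  set K := coverSet I M c
  have hK : NiceChart I c K := coverSet_nice c
  set p := extChartAt I c m
  have hpK : p ∈ K := mem_of_mem_nhdsWithin
    (extChartAt_target_subset_range c ((extChartAt I c).map_source hm)) hmK
  let b := Module.finBasis ℝ E
  have hF : ContDiffOn ℝ ∞ (loc I c F) K := (contDiffOn_loc_coe F c).mono hK.subset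
  obtain ⟨g, hg, hgp, hgF⟩ := exists_hadamard hK.convex hK.compact hK.unique b hF hpK
  obtain ⟨ρ, hρ, hρ1, hρs, -⟩ := exists_bump I (isCompact_singleton (x := m))
    (isOpen_niceRegion (I := I) c K) (singleton_subset_iff.2 ⟨hm, hmK⟩)
  have hρm : ρ m = 1 := hρ1.self_of_nhdsSet m rfl
  have hs : ∀ x ∈ tsupport ρ, x ∈ (extChartAt I c).source ∧
    K ∈ 𝓝[range I] (extChartAt I c x) := fun x hx => hρs hx
  let R : SmoothAlg I M Q := smulVec hρ Q 1
  let G : Fin (Module.finrank ℝ E) → SmoothAlg I M Q := fun j => glue hρ hs Q ⟨g j, hg j⟩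
  let X : Fin (Module.finrank ℝ E) → SmoothAlg I M Q := fun j =>
    coverCoord I Q c j - SmoothAlg.const I M Q (b.coord j p • 1)
  have hX : ∀ j, ∀ x, x ∈ (extChartAt I c).source → extChartAt I c x ∈ K →
      X j x = b.repr (extChartAt I c x - p) j • (1 : Q) := fun j x hx hxK => by
    change coverBump I c x • (b.coord j (extChartAt I c x) • (1 : Q)) - b.coord j p • 1 = _
    rw [coverBump_eq_one hx hxK, one_smul, ← sub_smul, ← map_sub]
    rfl
  have hRm : R m = 1 := by
    change ρ m • (1 : Q) = 1
    rw [hρm, one_smul]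
  have hXm : ∀ j, X j m = 0 := fun j => by
    rw [hX j m hm hpK]
    change b.repr (p - p) j • (1 : Q) = 0
    rw [sub_self, map_zero, Finsupp.zero_apply, zero_smul]
  have hXδ : ∀ j, δ (X j) m = δ (coverCoord I Q c j) m := fun j => by
    have h1 : SmoothAlg.const I M Q (b.coord j p • 1) =
        ((b.coord j p : ℝ) : ℂ) • (1 : SmoothAlg I M Q) := SmoothAlg.ext fun x =>
      (RCLike.real_smul_eq_coe_smul (K := ℂ) (b.coord j p) (1 : Q))
    rw [map_sub, h1, map_smul, h.map_one, smul_zero, sub_zero]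
  have hid : R * R * (F - SmoothAlg.const I M Q (F m)) = ∑ j, R * X j * G j := by
    refine SmoothAlg.ext fun x => ?_
    rw [show (∑ j, R * X j * G j) x = ∑ j, (R * X j * G j) x from
      map_sum (SmoothAlg.evalₗ x) _ _]
    change (ρ x • (1 : Q)) * (ρ x • (1 : Q)) * (F x - F m) =
      ∑ j, (ρ x • (1 : Q)) * X j x * (ρ x • g j (extChartAt I c x))
    by_cases hx : x ∈ tsupport ρ
    · obtain ⟨hxs, hxK⟩ := hs x hx
      have hxR : extChartAt I c x ∈ K := mem_of_mem_nhdsWithin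
        (extChartAt_target_subset_range c ((extChartAt I c).map_source hxs)) hxK
      have h2 := hgF _ hxR
      rw [loc_extChartAt hxs, loc_extChartAt hm] at h2
      rw [h2, Finset.mul_sum]
      refine Finset.sum_congr rfl fun j _ => ?_
      rw [hX j x hxs hxR]
      simp only [smul_mul_assoc, one_mul, mul_smul_comm, smul_smul]
      congr 1
      ring
    · simp [image_eq_zero_of_notMem_tsupport hx]
  have h3 := congrArg (fun f => δ f m) hid
  beta_reduce at h3
  rw [map_sum, show (∑ j, δ (R * X j * G j)) m = ∑ j, δ (R * X j * G j) m from
    map_sum (SmoothAlg.evalₗ m) _ _] at h3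
  simp only [h.leibniz, SmoothAlg.add_apply, SmoothAlg.mul_apply, SmoothAlg.sub_apply,
    SmoothAlg.const_apply, hRm, hXm, hXδ, map_sub, sub_self, mul_zero, zero_add, one_mul,
    mul_one, zero_mul, add_zero] at h3
  rw [sub_eq_iff_eq_add'] at h3
  rw [h3]
  congr 1
  refine Finset.sum_congr rfl fun j _ => ?_
  congr 1
  change ρ m • g j p = coverBump I c m • fderivWithin ℝ (loc I c F) (range I) p (b j)
  rw [hρm, one_smul, hgp, coverBump_eq_one hm hpK, one_smul,
    hK.fderivWithin_eq (contDiffOn_loc_coe F c) hpK]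

end DerivationStructure

section MinNormLocal

theorem norm_sum_conj_le {V : Type*} [NormedAddCommGroup V] [InnerProductSpace ℂ V] {ι : Type*}
    (t : Finset ι) {P Z : ι → V →L[ℂ] V} (hP : ∀ i ∈ t, ∀ x y, ⟪P i x, y⟫_ℂ = ⟪x, P i y⟫_ℂ)
    (hsum : ∀ x, ∑ i ∈ t, P i (P i x) = x) {L : ℝ} (hL0 : 0 ≤ L) (hL : ∀ i ∈ t, ‖Z i‖ ≤ L) (x : V) :
    ‖∑ i ∈ t, P i (Z i (P i x))‖ ≤ L * ‖x‖ := by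
  have hsq : ∀ v, ∑ i ∈ t, ‖P i v‖ ^ 2 = ‖v‖ ^ 2 := fun v => by
    have h3 : ∑ i ∈ t, ((‖P i v‖ : ℂ)) ^ 2 = (‖v‖ : ℂ) ^ 2 := by
      have h1 : ∀ i ∈ t, ((‖P i v‖ : ℂ)) ^ 2 = ⟪P i (P i v), v⟫_ℂ := fun i hi => by
        rw [hP i hi]
        exact (inner_self_eq_norm_sq_to_K (𝕜 := ℂ) (P i v)).symm
      rw [Finset.sum_congr rfl h1, ← sum_inner, hsum]
      exact inner_self_eq_norm_sq_to_K (𝕜 := ℂ) v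
    exact_mod_cast h3
  set v : V := ∑ i ∈ t, P i (Z i (P i x)) with hv
  have h1 : ⟪v, v⟫_ℂ = ∑ i ∈ t, ⟪Z i (P i x), P i v⟫_ℂ := by
    conv_lhs => rw [hv, sum_inner]
    exact Finset.sum_congr rfl fun i hi => hP i hi _ _
  have h2 : ‖⟪v, v⟫_ℂ‖ ≤ L * (‖x‖ * ‖v‖) := by
    rw [h1]
    calc _ ≤ ∑ i ∈ t, L * (‖P i x‖ * ‖P i v‖) := by
          refine norm_sum_le_of_le _ fun i hi => (norm_inner_le_norm _ _).trans ?_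
          rw [← mul_assoc]
          exact mul_le_mul_of_nonneg_right (((Z i).le_opNorm _).trans
            (mul_le_mul_of_nonneg_right (hL i hi) (norm_nonneg _))) (norm_nonneg _)
      _ ≤ _ := by
          rw [← Finset.mul_sum]
          refine mul_le_mul_of_nonneg_left ?_ hL0
          have h4 := Finset.sum_mul_sq_le_sq_mul_sq t (fun i => ‖P i x‖) fun i => ‖P i v‖
          rw [hsq, hsq, ← mul_pow] at h4
          exact abs_le_of_sq_le_sq' h4 (by positivity) |>.2
  rw [inner_self_eq_norm_sq_to_K, norm_pow, RCLike.norm_ofReal, abs_norm, sq, ← mul_assoc] at h2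
  rcases (norm_nonneg v).eq_or_lt with h0 | h0
  · rw [← h0]; positivity
  · exact le_of_mul_le_mul_right h2 h0

theorem minNorm_sum_conj_le {S B : Type*} [PreCStarAlgebra S] [PreCStarAlgebra B]
    {ι : Type*} (t : Finset ι) {T : ι → S ⊗[ℂ] B}
    (hT : ∀ i ∈ t, star (T i) = T i) (hsum : ∑ i ∈ t, T i * T i = 1) {Z : ι → S ⊗[ℂ] B} {L : ℝ}
    (hL : ∀ i ∈ t, minNorm (Z i) ≤ L) (hL0 : 0 ≤ L) :
    minNorm (∑ i ∈ t, T i * Z i * T i) ≤ L := by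
  refine minNorm_le hL0 fun π ρ => ContinuousLinearMap.opNorm_le_bound _ hL0 fun x => ?_
  have h := norm_sum_conj_le t (P := fun i => tensorRep π ρ (T i))
    (Z := fun i => tensorRep π ρ (Z i)) (fun i hi x y => by
      have := tensorRep_star π ρ (T i) x y
      rwa [hT i hi] at this) (fun x => by
      have h1 : tensorRep π ρ (∑ i ∈ t, T i * T i) x = x := by rw [hsum, map_one]; rfl
      rw [map_sum, sum_apply] at h1
      simp only [map_mul] at h1
      exact h1) hL0 (fun i hi => (le_minNorm (Z i) π ρ).trans (hL i hi)) x
  rw [map_sum, sum_apply]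
  simp only [map_mul]
  exact h

section Conj

variable {S B : Type*} [PreCStarAlgebra S] [PreCStarAlgebra B]

/-- The algebraic tensor product of two pre-C*-algebras. -/
abbrev PreTensor (S B : Type*) [PreCStarAlgebra S] [PreCStarAlgebra B] : Type _ := S ⊗[ℂ] B

@[elab_as_elim]
theorem PreTensor.induction {p : PreTensor S B → Prop} (X : PreTensor S B) (zero : p 0)
    (tmul : ∀ (a : S) (b : B), p (a ⊗ₜ[ℂ] b)) (add : ∀ X Y, p X → p Y → p (X + Y)) : p X :=
  TensorProduct.induction_on X zero tmul add

/-- The sum of the elements `(s i ⊗ 1) (Z i) (s i ⊗ 1)`. -/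
def conjSum {ι : Type*} (t : Finset ι) (s : ι → S) (Z : ι → PreTensor S B) : PreTensor S B :=
  ∑ i ∈ t, (s i ⊗ₜ[ℂ] (1 : B)) * Z i * (s i ⊗ₜ[ℂ] (1 : B))

theorem conjSum_zero {ι : Type*} (t : Finset ι) (s : ι → S) :
    conjSum t s (fun _ => (0 : PreTensor S B)) = 0 := by simp [conjSum]

theorem conjSum_add {ι : Type*} (t : Finset ι) (s : ι → S) (Z Z' : ι → PreTensor S B) :
    conjSum t s (fun i => Z i + Z' i) = conjSum t s Z + conjSum t s Z' := by
  simp [conjSum, mul_add, add_mul, Finset.sum_add_distrib]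

theorem conjSum_tmul {ι : Type*} (t : Finset ι) (s q : ι → S) (b : B) :
    conjSum t s (fun i => q i ⊗ₜ[ℂ] b) = (∑ i ∈ t, s i * q i * s i) ⊗ₜ[ℂ] b := by
  simp only [conjSum, Algebra.TensorProduct.tmul_mul_tmul, one_mul, mul_one]
  rw [← TensorProduct.sum_tmul]

theorem minNorm_conjSum_le {ι : Type*} (t : Finset ι) {s : ι → S}
    (hs : ∀ i ∈ t, star (s i) = s i) (hsum : ∑ i ∈ t, s i * s i = 1) {Z : ι → PreTensor S B}
    {L : ℝ} (hL : ∀ i ∈ t, minNorm (Z i) ≤ L) (hL0 : 0 ≤ L) : minNorm (conjSum t s Z) ≤ L := by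
  refine minNorm_sum_conj_le t (fun i hi => ?_) ?_ hL hL0
  · rw [TensorProduct.star_tmul, star_one, hs i hi]
  · simp only [Algebra.TensorProduct.tmul_mul_tmul, mul_one]
    rw [← TensorProduct.sum_tmul, hsum, Algebra.TensorProduct.one_def]

theorem minNorm_sub_tmul_le (f g : S) (b : B) :
    minNorm ((f ⊗ₜ[ℂ] b - g ⊗ₜ[ℂ] b : PreTensor S B)) ≤ ‖f - g‖ * ‖b‖ := by
  rw [← TensorProduct.sub_tmul]
  exact minNorm_tmul_le _ b

theorem minNorm_zero : minNorm (0 : PreTensor S B) = 0 := map_zero (minSeminorm S B)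

theorem minNorm_add_le (X Y : PreTensor S B) : minNorm (X + Y) ≤ minNorm X + minNorm Y :=
  map_add_le_add (minSeminorm S B) X Y

end Conj

variable {E : Type*} [NormedAddCommGroup E] [NormedSpace ℝ E] [FiniteDimensional ℝ E]
  {H : Type*} [TopologicalSpace H]
  {I : ModelWithCorners ℝ E H} {M : Type*} [TopologicalSpace M] [ChartedSpace H M]
  [IsManifold I ∞ M] [CompactSpace M]

variable (I) in
/-- A partition of unity into squares. -/
theorem exists_square_partition [T2Space M] {U : M → Set M} (hU : ∀ x, IsOpen (U x))
    (hx : ∀ x, x ∈ U x) : ∃ (t : Finset M) (ψ : M → M → ℝ),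
      (∀ i, ContMDiff I 𝓘(ℝ, ℝ) ∞ (ψ i)) ∧ (∀ i ∈ t, ∀ x, ψ i x ≠ 0 → x ∈ U i) ∧
      ∀ x, ∑ i ∈ t, ψ i x * ψ i x = 1 := by
  classical
  obtain ⟨t, ht⟩ := isCompact_univ.elim_finite_subcover U hU fun x _ => mem_iUnion.2 ⟨x, hx x⟩
  obtain ⟨f, hf⟩ := SmoothPartitionOfUnity.exists_isSubordinate I (isClosed_univ (X := M))
    (fun i : t => U i) (fun i => hU i) fun x hx => by
      obtain ⟨i, hi, hxi⟩ := mem_iUnion₂.1 (ht hx)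
      exact mem_iUnion.2 ⟨⟨i, hi⟩, hxi⟩
  have hf1 : ∀ x, ∑ i, f i x = 1 := fun x => by
    rw [← finsum_eq_sum_of_fintype]
    exact f.sum_eq_one (mem_univ x)
  let s : M → ℝ := fun x => ∑ i, f i x * f i x
  have hs : ∀ x, 0 < s x := fun x => by
    refine lt_of_le_of_ne (Finset.sum_nonneg fun i _ => mul_self_nonneg _) fun h => ?_
    have h2 := (Finset.sum_eq_zero_iff_of_nonneg fun i _ => mul_self_nonneg (f i x)).1 h.symm
    have h3 := hf1 x
    rw [Finset.sum_eq_zero fun i hi => mul_self_eq_zero.1 (h2 i hi)] at h3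
    exact zero_ne_one h3
  have hsm : ContMDiff I 𝓘(ℝ, ℝ) ∞ s := contMDiff_finset_sum fun i _ =>
    (f i).contMDiff.mul (f i).contMDiff
  have hr : ContMDiff I 𝓘(ℝ, ℝ) ∞ fun x => (√(s x))⁻¹ := fun x =>
    ((Real.contDiffAt_sqrt (hs x).ne').inv (Real.sqrt_pos.2 (hs x)).ne').contMDiffAt.comp x (hsm x)
  refine ⟨t, fun i x => (if h : i ∈ t then f ⟨i, h⟩ x else 0) * (√(s x))⁻¹, fun i => ?_,
    fun i hi x hne => ?_, fun x => ?_⟩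
  · by_cases hi : i ∈ t
    · simp only [hi, dif_pos]
      exact (f ⟨i, hi⟩).contMDiff.mul hr
    · simp only [hi, dif_neg, not_false_eq_true, zero_mul]
      exact contMDiff_const
  · simp only [dif_pos hi] at hne
    exact hf ⟨i, hi⟩ (subset_tsupport _ (left_ne_zero_of_mul hne))
  · rw [← Finset.sum_coe_sort]
    have h1 : ∀ i : t, f i x * (√(s x))⁻¹ * (f i x * (√(s x))⁻¹) = f i x * f i x * (s x)⁻¹ :=
      fun i => by
        rw [mul_mul_mul_comm, ← mul_inv, Real.mul_self_sqrt (hs x).le]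
    have h2 : ∀ i : t, (if h : (i : M) ∈ t then f ⟨i, h⟩ x else 0) = f i x := fun i => dif_pos i.2
    simp_rw [h2, h1]
    rw [← Finset.sum_mul]
    exact mul_inv_cancel₀ (hs x).ne'

variable {Q : Type*} [CStarAlgebra Q] {B : Type*} [PreCStarAlgebra B]

/-- Evaluation at a point on `C^∞(M, Q) ⊗ B`. -/
def evalTensor (B : Type*) [PreCStarAlgebra B] (x : M) :
    PreTensor (SmoothAlg I M Q) B →ₗ[ℂ] PreTensor Q B :=
  ((SmoothAlg.eval x : SmoothAlg I M Q →⋆ₐ[ℂ] Q) : SmoothAlg I M Q →ₐ[ℂ] Q).toLinearMap.rTensor B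

/-- Constant functions in `C^∞(M, Q) ⊗ B`. -/
def constTensor (I : ModelWithCorners ℝ E H) (M : Type*) [TopologicalSpace M] [ChartedSpace H M]
    [IsManifold I ∞ M] [CompactSpace M] (Q B : Type*) [CStarAlgebra Q] [PreCStarAlgebra B] :
    PreTensor Q B →ₗ[ℂ] PreTensor (SmoothAlg I M Q) B :=
  ((SmoothAlg.const I M Q : Q →⋆ₐ[ℂ] SmoothAlg I M Q) : Q →ₐ[ℂ] SmoothAlg I M Q).toLinearMap.rTensor B

theorem evalTensor_tmul (x : M) (f : SmoothAlg I M Q) (b : B) :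
    evalTensor B x (f ⊗ₜ[ℂ] b) = f x ⊗ₜ[ℂ] b := rfl

theorem minNorm_evalTensor_le (x : M) (X : PreTensor (SmoothAlg I M Q) B) :
    minNorm (evalTensor B x X) ≤ minNorm X :=
  minNorm_rTensor_le _ (fun f => f.norm_apply_le x) X

theorem minNorm_constTensor_le (Y : PreTensor Q B) :
    minNorm (constTensor I M Q B Y) ≤ minNorm Y :=
  minNorm_rTensor_le _ SmoothAlg.norm_const_le Y

theorem SmoothAlg.sum_apply {ι : Type*} (t : Finset ι) (f : ι → SmoothAlg I M Q) (x : M) :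
    (∑ i ∈ t, f i) x = ∑ i ∈ t, f i x := map_sum (SmoothAlg.evalₗ x) f t

/-- The element of `C^∞(M, Q) ⊗ B` glued from the values of `X` at finitely many points. -/
def localApprox (t : Finset M) {ψ : M → M → ℝ} (hψ : ∀ i, ContMDiff I 𝓘(ℝ, ℝ) ∞ (ψ i))
    (X : PreTensor (SmoothAlg I M Q) B) : PreTensor (SmoothAlg I M Q) B :=
  conjSum t (fun i => smulVec (hψ i) Q 1) fun i => constTensor I M Q B (evalTensor B i X)

theorem localApprox_zero (t : Finset M) {ψ : M → M → ℝ}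
    (hψ : ∀ i, ContMDiff I 𝓘(ℝ, ℝ) ∞ (ψ i)) :
    localApprox t hψ (0 : PreTensor (SmoothAlg I M Q) B) = 0 := by
  simp only [localApprox, map_zero]
  exact conjSum_zero _ _

theorem localApprox_add (t : Finset M) {ψ : M → M → ℝ}
    (hψ : ∀ i, ContMDiff I 𝓘(ℝ, ℝ) ∞ (ψ i)) (X Y : PreTensor (SmoothAlg I M Q) B) :
    localApprox t hψ (X + Y) = localApprox t hψ X + localApprox t hψ Y := by
  simp only [localApprox, map_add]
  exact conjSum_add _ _ _ _

theorem localApprox_tmul (t : Finset M) {ψ : M → M → ℝ}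
    (hψ : ∀ i, ContMDiff I 𝓘(ℝ, ℝ) ∞ (ψ i)) (f : SmoothAlg I M Q) (b : B) :
    localApprox t hψ (f ⊗ₜ[ℂ] b) = (∑ i ∈ t,
      smulVec (hψ i) Q 1 * SmoothAlg.const I M Q (f i) * smulVec (hψ i) Q 1) ⊗ₜ[ℂ] b :=
  conjSum_tmul t _ (fun i => SmoothAlg.const I M Q (f i)) b

theorem norm_sub_localApprox_le {t : Finset M} {ψ : M → M → ℝ}
    (hψ : ∀ i, ContMDiff I 𝓘(ℝ, ℝ) ∞ (ψ i)) (hψ1 : ∀ x, ∑ i ∈ t, ψ i x * ψ i x = 1)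
    {f : SmoothAlg I M Q} {ε : ℝ} (hε : 0 ≤ ε) (hf : ∀ i ∈ t, ∀ x, ψ i x ≠ 0 → ‖f x - f i‖ ≤ ε) :
    ‖f - ∑ i ∈ t, smulVec (hψ i) Q 1 * SmoothAlg.const I M Q (f i) * smulVec (hψ i) Q 1‖ ≤ ε := by
  refine SmoothAlg.norm_le hε fun x => ?_
  have h1 : (f - ∑ i ∈ t, smulVec (hψ i) Q 1 * SmoothAlg.const I M Q (f i) * smulVec (hψ i) Q 1) x
      = ∑ i ∈ t, (ψ i x * ψ i x) • (f x - f i) := by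
    rw [SmoothAlg.sub_apply, SmoothAlg.sum_apply]
    simp_rw [smul_sub]
    rw [Finset.sum_sub_distrib, ← Finset.sum_smul, hψ1, one_smul]
    congr 1
    refine Finset.sum_congr rfl fun i _ => ?_
    change (ψ i x • (1 : Q)) * f i * (ψ i x • (1 : Q)) = _
    rw [smul_mul_assoc, one_mul, mul_smul_comm, mul_one, smul_smul]
  rw [h1]
  calc _ ≤ ∑ i ∈ t, (ψ i x * ψ i x) * ε := norm_sum_le_of_le _ fun i hi => by
        rw [norm_smul, Real.norm_eq_abs, abs_mul_self]
        by_cases h0 : ψ i x = 0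
        · simp [h0]
        · exact mul_le_mul_of_nonneg_left (hf i hi x h0) (mul_self_nonneg _)
    _ = ε := by rw [← Finset.sum_mul, hψ1, one_mul]

/-- Elements of `C^∞(M, Q) ⊗ B` are approximated by gluing their values with a fine partition. -/
theorem exists_minNorm_sub_localApprox_le (X : PreTensor (SmoothAlg I M Q) B) : ∀ ε : ℝ, 0 < ε →
    ∃ U : M → Set M, (∀ x, IsOpen (U x)) ∧ (∀ x, x ∈ U x) ∧
      ∀ (t : Finset M) (ψ : M → M → ℝ) (hψ : ∀ i, ContMDiff I 𝓘(ℝ, ℝ) ∞ (ψ i)),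
        (∀ i ∈ t, ∀ x, ψ i x ≠ 0 → x ∈ U i) → (∀ x, ∑ i ∈ t, ψ i x * ψ i x = 1) →
        minNorm (X - localApprox t hψ X) ≤ ε := by
  induction X using PreTensor.induction with
  | zero =>
    refine fun ε hε => ⟨fun _ => univ, fun _ => isOpen_univ, fun _ => mem_univ _,
      fun t ψ hψ _ _ => ?_⟩
    rw [localApprox_zero, sub_zero]
    exact minNorm_zero.trans_le hε.le
  | add X Y hX hY =>
    intro ε hε
    obtain ⟨U, hU, hxU, hUX⟩ := hX (ε / 2) (half_pos hε)
    obtain ⟨V, hV, hxV, hVY⟩ := hY (ε / 2) (half_pos hε)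
    refine ⟨fun x => U x ∩ V x, fun x => (hU x).inter (hV x), fun x => ⟨hxU x, hxV x⟩,
      fun t ψ hψ ht h1 => ?_⟩
    rw [localApprox_add, add_sub_add_comm]
    refine (minNorm_add_le _ _).trans ?_
    rw [← add_halves ε]
    exact add_le_add (hUX t ψ hψ (fun i hi x hx => (ht i hi x hx).1) h1)
      (hVY t ψ hψ (fun i hi x hx => (ht i hi x hx).2) h1)
  | tmul f b =>
    intro ε hε
    refine ⟨fun x => {y | ‖f y - f x‖ < ε / (‖b‖ + 1)}, fun x => ?_, fun x => ?_,
      fun t ψ hψ ht h1 => ?_⟩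
    · exact isOpen_lt (f.continuous.sub continuous_const).norm continuous_const
    · change ‖f x - f x‖ < _
      rw [sub_self, norm_zero]
      positivity
    · rw [localApprox_tmul]
      refine (minNorm_sub_tmul_le _ _ b).trans ((mul_le_mul_of_nonneg_right
        (norm_sub_localApprox_le hψ h1 (ε := ε / (‖b‖ + 1)) (by positivity)
          (fun i hi x hx => (ht i hi x hx).le)) (norm_nonneg b)).trans ?_)
      rw [div_mul_eq_mul_div, div_le_iff₀ (by positivity)]
      nlinarith [norm_nonneg b]

/-- The minimal norm on `C^∞(M, Q) ⊗ B` is the supremum of the minimal norms of the values. -/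
theorem minNorm_le_of_evalTensor_le [T2Space M] {X : PreTensor (SmoothAlg I M Q) B} {L : ℝ}
    (hL0 : 0 ≤ L) (hL : ∀ x : M, minNorm (evalTensor B x X) ≤ L) : minNorm X ≤ L := by
  refine le_of_forall_pos_le_add fun ε hε => ?_
  obtain ⟨U, hU, hxU, h⟩ := exists_minNorm_sub_localApprox_le X ε hε
  obtain ⟨t, ψ, hψ, ht, h1⟩ := exists_square_partition I hU hxU
  have h2 := h t ψ hψ ht h1
  have h3 : minNorm (localApprox t hψ X) ≤ L := by
    refine minNorm_conjSum_le t (fun i _ => SmoothAlg.ext fun x => ?_) (SmoothAlg.ext fun x => ?_)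
      (fun i _ => (minNorm_constTensor_le _).trans (hL i)) hL0
    · change star (ψ i x • (1 : Q)) = ψ i x • 1
      rw [star_smul, star_one, star_trivial]
    · rw [SmoothAlg.sum_apply]
      change ∑ i ∈ t, (ψ i x • (1 : Q)) * (ψ i x • (1 : Q)) = 1
      simp_rw [smul_mul_smul_comm, one_mul]
      rw [← Finset.sum_smul, h1, one_smul]
  have h4 := minNorm_add_le (X - localApprox t hψ X) (localApprox t hψ X)
  rw [sub_add_cancel] at h4
  exact h4.trans ((add_le_add h2 h3).trans_eq (add_comm _ _))

end MinNormLocal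

section TensorDominated

section DerTensor

variable {S B : Type*} [PreCStarAlgebra S] [PreCStarAlgebra B]

/-- The operator `T ⊗ id`. -/
def derTensor (B : Type*) [PreCStarAlgebra B] (T : S →ₗ[ℂ] S) : PreTensor S B →ₗ[ℂ] PreTensor S B :=
  T.rTensor B

theorem derTensor_tmul (T : S →ₗ[ℂ] S) (a : S) (b : B) :
    derTensor B T (a ⊗ₜ[ℂ] b) = T a ⊗ₜ[ℂ] b := rfl

theorem derTensor_comp (T U : S →ₗ[ℂ] S) (X : PreTensor S B) :
    derTensor B (T ∘ₗ U) X = derTensor B T (derTensor B U X) :=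
  LinearMap.rTensor_comp_apply B T U X

theorem derTensor_id (X : PreTensor S B) : derTensor B (LinearMap.id : S →ₗ[ℂ] S) X = X :=
  LinearMap.rTensor_id_apply B S X

theorem derTensor_commutator (T U : S →ₗ[ℂ] S) (X : PreTensor S B) :
    derTensor B (commutator T U) X =
      derTensor B T (derTensor B U X) - derTensor B U (derTensor B T X) := by
  rw [← derTensor_comp, ← derTensor_comp]
  exact congrArg (fun F : PreTensor S B →ₗ[ℂ] PreTensor S B => F X)
    (LinearMap.rTensor_sub (T ∘ₗ U) (U ∘ₗ T))

/-- The seminorm `‖(T ⊗ id) X‖`. -/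
def minDerSem (B : Type*) [PreCStarAlgebra B] (T : S →ₗ[ℂ] S) : Seminorm ℂ (PreTensor S B) :=
  (minSeminorm S B).comp (derTensor B T)

theorem minNorm_mul_tmul_one_le (a : S) (X : PreTensor S B) :
    minNorm ((a ⊗ₜ[ℂ] (1 : B)) * X) ≤ ‖a‖ * ‖(1 : B)‖ * minNorm X :=
  (minNorm_mul_le _ _).trans (mul_le_mul_of_nonneg_right (minNorm_tmul_le a 1) (minNorm_nonneg X))

theorem minNorm_sum_le {ι : Type*} (t : Finset ι) (X : ι → PreTensor S B) :
    minNorm (∑ i ∈ t, X i) ≤ ∑ i ∈ t, minNorm (X i) := by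
  classical
  induction t using Finset.induction_on with
  | empty => simp only [Finset.sum_empty]; exact minNorm_zero.le
  | insert i t hi ih =>
    rw [Finset.sum_insert hi, Finset.sum_insert hi]
    exact (minNorm_add_le _ _).trans (add_le_add_right ih _)

/-- Iterated composition with a list of maps, the operators `l` coming last. -/
theorem iterDer_append_singleton (l : List (ClosableStarDerivation S))
    (δ : ClosableStarDerivation S) : iterDer (l ++ [δ]) = iterDer l ∘ₗ δ.toLinearMap := by
  induction l with
  | nil => rfl
  | cons η l ih => exact congrArg (fun T => η.toLinearMap ∘ₗ T) ih

theorem tensorDer_nil_right (l : List (ClosableStarDerivation S)) (X : PreTensor S B) :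
    tensorDer (l, []) X = derTensor B (iterDer l) X := by
  induction X using PreTensor.induction with
  | zero => rw [map_zero, map_zero]
  | tmul a b => rw [derTensor_tmul]; simp [tensorDer, iterDer]
  | add X Y hX hY => rw [map_add, map_add, hX, hY]

end DerTensor

variable {E : Type*} [NormedAddCommGroup E] [NormedSpace ℝ E] [FiniteDimensional ℝ E]
  {H : Type*} [TopologicalSpace H]
  {I : ModelWithCorners ℝ E H} {M : Type*} [TopologicalSpace M] [ChartedSpace H M]
  [IsManifold I ∞ M] [CompactSpace M] {Q : Type*} [CStarAlgebra Q] {B : Type*} [PreCStarAlgebra B]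

/-- The derivation of the values of a derivation at a point. -/
def IsSmoothDerivation.valueDer {δ : SmoothAlg I M Q →ₗ[ℂ] SmoothAlg I M Q} {C : ℝ}
    (hC : ∀ q : Q, ‖δ (SmoothAlg.const I M Q q)‖ ≤ C * ‖q‖) (m : M) : Q →L[ℂ] Q :=
  LinearMap.mkContinuous
    { toFun := fun q => δ (SmoothAlg.const I M Q q) m
      map_add' := fun p q => by rw [map_add, map_add, SmoothAlg.add_apply]
      map_smul' := fun z q => by rw [map_smul, map_smul, SmoothAlg.smul_apply]; rfl }
    C fun q => (SmoothAlg.norm_apply_le _ m).trans (hC q)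

theorem IsSmoothDerivation.valueDer_apply {δ : SmoothAlg I M Q →ₗ[ℂ] SmoothAlg I M Q} {C : ℝ}
    (hC : ∀ q : Q, ‖δ (SmoothAlg.const I M Q q)‖ ≤ C * ‖q‖) (m : M) (q : Q) :
    IsSmoothDerivation.valueDer hC m q = δ (SmoothAlg.const I M Q q) m := rfl

variable [T2Space M]

variable (I M) in
/-- The coordinate vector fields of the cover, as a finite family. -/
def coverFields (i : coverCentres I M × Fin (Module.finrank ℝ E)) : ChartField I M :=
  coverField I (i.1 : M) i.2

theorem evalTensor_derTensor {δ : SmoothAlg I M Q →ₗ[ℂ] SmoothAlg I M Q}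
    (h : IsSmoothDerivation δ) {C : ℝ} (hC : ∀ q : Q, ‖δ (SmoothAlg.const I M Q q)‖ ≤ C * ‖q‖)
    {c m : M} (hm : m ∈ (extChartAt I c).source)
    (hmK : coverSet I M c ∈ 𝓝[range I] (extChartAt I c m)) (X : PreTensor (SmoothAlg I M Q) B) :
    evalTensor B m (derTensor B δ X) =
      (IsSmoothDerivation.valueDer hC m).toLinearMap.rTensor B (evalTensor B m X) +
      ∑ j, (δ (coverCoord I Q c j) m ⊗ₜ[ℂ] (1 : B)) *
        evalTensor B m (derTensor B ((coverField I c j).lin Q) X) := by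
  induction X using PreTensor.induction with
  | zero => simp only [map_zero, mul_zero, Finset.sum_const_zero, add_zero]
  | add X Y hX hY =>
    simp only [map_add, mul_add, Finset.sum_add_distrib, hX, hY]
    abel
  | tmul f b =>
    simp only [derTensor_tmul, evalTensor_tmul, Algebra.TensorProduct.tmul_mul_tmul, one_mul]
    rw [h.apply_eq hm hmK f, TensorProduct.add_tmul, TensorProduct.sum_tmul]
    rfl

/-- A derivation of `C^∞(M, Q)`, tensored with `B`, is dominated by the coordinate vector
fields. -/
theorem IsSmoothDerivation.minDerSem_dominatedBy {δ : SmoothAlg I M Q →ₗ[ℂ] SmoothAlg I M Q}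
    (h : IsSmoothDerivation δ) : ∃ C, 0 ≤ C ∧ ∀ X : PreTensor (SmoothAlg I M Q) B,
      minNorm (derTensor B δ X) ≤ C * (minNorm X +
        ∑ i, minNorm (derTensor B ((coverFields I M i).lin Q) X)) := by
  obtain ⟨C, hC0, hC⟩ := h.exists_norm_const_le
  let a : coverCentres I M × Fin (Module.finrank ℝ E) → ℝ := fun i =>
    ‖δ (coverCoord I Q (i.1 : M) i.2)‖ * ‖(1 : B)‖
  have ha : ∀ i, 0 ≤ a i := fun i => by positivity
  have hsum : 0 ≤ ∑ i, a i := Finset.sum_nonneg fun i _ => ha i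
  refine ⟨Real.exp C + ∑ i, a i, add_nonneg (Real.exp_pos C).le hsum, fun X => ?_⟩
  let n : coverCentres I M × Fin (Module.finrank ℝ E) → ℝ := fun i =>
    minNorm (derTensor B ((coverFields I M i).lin Q) X)
  have hn0 : ∀ i, 0 ≤ n i := fun i => minNorm_nonneg _
  have hX0 := minNorm_nonneg X
  have hnsum : 0 ≤ ∑ i, n i := Finset.sum_nonneg fun i _ => hn0 i
  have hR : 0 ≤ (Real.exp C + ∑ i, a i) * (minNorm X + ∑ i, n i) :=
    mul_nonneg (add_nonneg (Real.exp_pos C).le hsum) (add_nonneg hX0 hnsum)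
  refine minNorm_le_of_evalTensor_le hR fun m => ?_
  obtain ⟨c, hm, hmK⟩ := exists_mem_cover (I := I) m
  rw [evalTensor_derTensor h hC hm hmK]
  have h1 : minNorm ((IsSmoothDerivation.valueDer hC m).toLinearMap.rTensor B (evalTensor B m X)) ≤
      Real.exp C * minNorm X := by
    refine (minNorm_rTensor_derivation_le _ (fun p q => ?_) (fun q => ?_) _).trans
      (mul_le_mul (Real.exp_le_exp.2 (LinearMap.mkContinuous_norm_le _ hC0 _))
        (minNorm_evalTensor_le m X) (minNorm_nonneg _) (Real.exp_pos _).le)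
    · simp only [IsSmoothDerivation.valueDer_apply, map_mul, h.leibniz, SmoothAlg.add_apply,
        SmoothAlg.mul_apply, SmoothAlg.const_apply]
    · simp only [IsSmoothDerivation.valueDer_apply, map_star, h.star, SmoothAlg.star_apply]
  have h2 : minNorm (∑ j, (δ (coverCoord I Q (c : M) j) m ⊗ₜ[ℂ] (1 : B)) *
      evalTensor B m (derTensor B ((coverField I (c : M) j).lin Q) X)) ≤ ∑ j, a (c, j) * n (c, j) := by
    refine (minNorm_sum_le _ _).trans (Finset.sum_le_sum fun j _ => ?_)
    refine (minNorm_mul_tmul_one_le _ _).trans (mul_le_mul (mul_le_mul_of_nonneg_right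
      (SmoothAlg.norm_apply_le _ m) (norm_nonneg _)) (minNorm_evalTensor_le m _)
      (minNorm_nonneg _) (ha _))
  have h3 : ∑ j, a (c, j) * n (c, j) ≤ (∑ i, a i) * ∑ i, n i := by
    have h4 : ∑ j, a (c, j) * n (c, j) ≤ ∑ j, (∑ i, a i) * n (c, j) :=
      Finset.sum_le_sum fun j _ => mul_le_mul_of_nonneg_right
        (Finset.single_le_sum (fun i _ => ha i) (Finset.mem_univ (c, j))) (hn0 _)
    refine h4.trans ?_
    rw [← Finset.mul_sum]
    refine mul_le_mul_of_nonneg_left ?_ hsum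
    rw [Fintype.sum_prod_type]
    exact Finset.single_le_sum (f := fun c => ∑ j, n (c, j))
      (fun c _ => Finset.sum_nonneg fun j _ => hn0 _) (Finset.mem_univ c)
  refine (minNorm_add_le _ _).trans ((add_le_add h1 (h2.trans h3)).trans ?_)
  have h5 := mul_nonneg hsum hX0
  have h6 := mul_nonneg (Real.exp_pos C).le hnsum
  change _ ≤ (Real.exp C + ∑ i, a i) * (minNorm X + ∑ i, n i)
  rw [add_mul, mul_add, mul_add]
  linarith

/-- The seminorms `‖(D₁ ⋯ Dₖ ⊗ id) X‖` for coordinate vector fields. -/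
def tensorFieldSem (I : ModelWithCorners ℝ E H) (M : Type*) [TopologicalSpace M] [ChartedSpace H M]
    [IsManifold I ∞ M] [CompactSpace M] (Q B : Type*) [CStarAlgebra Q] [PreCStarAlgebra B]
    (l : List (ChartField I M)) : Seminorm ℂ (PreTensor (SmoothAlg I M Q) B) :=
  minDerSem B (iterDer (l.map fun V => V.der Q))

theorem tensorFieldSem_apply (l : List (ChartField I M)) (X : PreTensor (SmoothAlg I M Q) B) :
    tensorFieldSem I M Q B l X = minNorm (derTensor B (iterDer (l.map fun V => V.der Q)) X) := rfl

theorem tensorFieldSem_nil (X : PreTensor (SmoothAlg I M Q) B) :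
    tensorFieldSem I M Q B [] X = minNorm X := by
  rw [tensorFieldSem_apply]
  exact congrArg minNorm (derTensor_id X)

theorem tensorFieldSem_append (l : List (ChartField I M)) (V : ChartField I M)
    (X : PreTensor (SmoothAlg I M Q) B) :
    tensorFieldSem I M Q B (l ++ [V]) X = tensorFieldSem I M Q B l (derTensor B (V.lin Q) X) := by
  rw [tensorFieldSem_apply, tensorFieldSem_apply, List.map_append, List.map_singleton,
    iterDer_append_singleton, derTensor_comp]
  rfl

theorem tensorFieldSem_dominatedBy (l : List (ChartField I M))
    {δ : SmoothAlg I M Q →ₗ[ℂ] SmoothAlg I M Q} (h : IsSmoothDerivation δ) :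
    DominatedBy ((tensorFieldSem I M Q B l).comp (derTensor B δ)) (tensorFieldSem I M Q B) := by
  induction l using List.reverseRecOn generalizing δ with
  | nil =>
    obtain ⟨C, hC, hX⟩ := h.minDerSem_dominatedBy (B := B)
    let q : Option (coverCentres I M × Fin (Module.finrank ℝ E)) →
        Seminorm ℂ (PreTensor (SmoothAlg I M Q) B) := fun o =>
      tensorFieldSem I M Q B (o.elim [] fun i => [coverFields I M i])
    have h1 : DominatedBy ((tensorFieldSem I M Q B []).comp (derTensor B δ)) q := by
      refine ⟨Finset.univ, C, hC, fun X => ?_⟩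
      rw [Fintype.sum_option]
      refine (tensorFieldSem_nil (derTensor B δ X)).trans_le ((hX X).trans_eq ?_)
      rw [show q none X = minNorm X from tensorFieldSem_nil X]
      congr 2
    exact h1.trans fun o => .self _ _
  | append_singleton l V ih =>
    have hV : IsSmoothDerivation (V.lin Q) := (V.der Q).isSmoothDerivation
    have h1 : DominatedBy (((tensorFieldSem I M Q B l).comp (derTensor B δ)).comp
        (derTensor B (V.lin Q))) (tensorFieldSem I M Q B) :=
      ((ih h).comp (derTensor B (V.lin Q))).trans fun l' =>
        .of_le (i := l' ++ [V]) zero_le_one fun X => by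
          rw [one_mul, tensorFieldSem_append]
          rfl
    refine .add h1 (ih (hV.commutator h)) fun X => ?_
    change tensorFieldSem I M Q B (l ++ [V]) (derTensor B δ X) ≤
      tensorFieldSem I M Q B l (derTensor B δ (derTensor B (V.lin Q) X)) +
      tensorFieldSem I M Q B l (derTensor B (commutator (V.lin Q) δ) X)
    rw [tensorFieldSem_append, derTensor_commutator]
    refine le_trans (le_of_eq ?_) (map_add_le_add (tensorFieldSem I M Q B l) _ _)
    rw [add_sub_cancel]

theorem tensorFieldSem_iterDer_dominatedBy (d : List (ClosableStarDerivation (SmoothAlg I M Q)))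
    (l : List (ChartField I M)) : DominatedBy ((tensorFieldSem I M Q B l).comp
      (derTensor B (iterDer d))) (tensorFieldSem I M Q B) := by
  induction d generalizing l with
  | nil =>
    refine .of_le (i := l) zero_le_one fun X => ?_
    rw [one_mul]
    exact (congrArg (tensorFieldSem I M Q B l) (derTensor_id X)).le
  | cons δ d ih =>
    have h1 := ((tensorFieldSem_dominatedBy (B := B) l δ.isSmoothDerivation).comp
      (derTensor B (iterDer d))).trans ih
    obtain ⟨s, C, hC, hs⟩ := h1
    refine ⟨s, C, hC, fun X => (le_of_eq ?_).trans (hs X)⟩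
    exact congrArg (tensorFieldSem I M Q B l) (derTensor_comp δ.toLinearMap (iterDer d) X)

/-- The topology of `C^∞(M, Q) ⊗ B` is given by the coordinate vector fields. -/
theorem tensorSeminorm_dominatedBy {B : Type*} [CStarAlgebra B]
    (i : List (ClosableStarDerivation (SmoothAlg I M Q)) × List (ClosableStarDerivation B)) :
    DominatedBy (tensorSeminorm (SmoothAlg I M Q) B i) (tensorFieldSem I M Q B) := by
  obtain ⟨d, e⟩ := i
  induction e with
  | nil =>
    obtain ⟨s, C, hC, hs⟩ := tensorFieldSem_iterDer_dominatedBy (B := B) d []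
    refine ⟨s, C, hC, fun X => (le_of_eq ?_).trans (hs X)⟩
    change minNorm (tensorDer (d, []) X) = tensorFieldSem I M Q B [] (derTensor B (iterDer d) X)
    rw [tensorFieldSem_nil]
    exact congrArg minNorm (tensorDer_nil_right d X)
  | cons η e ih =>
    obtain ⟨D, hD, h⟩ := η.exists_minNorm_lTensor_le (A := SmoothAlg I M Q)
    obtain ⟨s, C, hC, hs⟩ := ih
    refine ⟨s, D * C, mul_nonneg hD hC, fun X => ?_⟩
    change minNorm (tensorDer (d, η :: e) X) ≤ _
    rw [tensorDer_cons_right, mul_assoc]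
    exact (h _).trans (mul_le_mul_of_nonneg_left (hs X) hD)

theorem tensorFieldSem_dominatedBy_tensorSeminorm {B : Type*} [CStarAlgebra B]
    (l : List (ChartField I M)) :
    DominatedBy (tensorFieldSem I M Q B l) (tensorSeminorm (SmoothAlg I M Q) B) :=
  .of_le (i := (l.map fun V => V.der Q, [])) zero_le_one fun X => by
    rw [one_mul]
    exact (congrArg minNorm (tensorDer_nil_right _ X)).ge

end TensorDominated

section CompletionEquiv

open UniformSpace

theorem isInducing_of_withSeminorms {X Y ι : Type*} [AddCommGroup X] [Module ℂ X]
    [AddCommGroup Y] [Module ℂ Y] [TopologicalSpace X] [TopologicalSpace Y]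
    {p : SeminormFamily ℂ X ι} {q : SeminormFamily ℂ Y ι} (hp : WithSeminorms p)
    (hq : WithSeminorms q) (φ : X →ₗ[ℂ] Y) (h : ∀ i x, p i x = q i (φ x)) : IsInducing φ := by
  refine isInducing_iff_nhds.2 fun x => ?_
  have key : ∀ l : Filter X, l ≤ 𝓝 x ↔ l ≤ comap φ (𝓝 (φ x)) := fun l => by
    rw [← map_le_iff_le_comap, le_nhds_iff_of_withSeminorms _ hp, le_nhds_iff_of_withSeminorms _ hq]
    simp only [eventually_map, h, map_sub]
  exact le_antisymm ((key _).1 le_rfl) ((key _).2 le_rfl)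

theorem dense_of_approxBy {X ι : Type*} [AddCommGroup X] [Module ℂ X] [TopologicalSpace X]
    {q : SeminormFamily ℂ X ι} (hq : WithSeminorms q) {N : Submodule ℂ X}
    (h : ∀ x, ApproxBy N q x) : Dense (N : Set X) := by
  intro x
  refine (mem_closure_iff_nhds_basis hq.hasBasis_ball).2 fun ⟨s, r⟩ hr => ?_
  obtain ⟨y, hy, hxy⟩ := h x s r hr
  refine ⟨y, hy, ?_⟩
  rw [Seminorm.mem_ball, map_sub_rev]
  exact Seminorm.finset_sup_apply_lt hr hxy

theorem completeSpace_of_frechet {T : Type*} [Ring T] [Algebra ℂ T] [StarRing T] [UniformSpace T]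
    [IsUniformAddGroup T] (hT : IsFrechetStarAlgebra T inferInstance) : CompleteSpace T := by
  obtain ⟨p, hp⟩ := hT.countable_seminorms
  have := hp.firstCountableTopology
  have := IsUniformAddGroup.uniformity_countably_generated (α := T)
  refine UniformSpace.complete_of_cauchySeq_tendsto fun x hx => hT.complete x fun U hU => ?_
  have h1 : {z : T × T | z.1 - z.2 ∈ U} ∈ uniformity T := by
    rw [uniformity_eq_comap_nhds_zero_swapped]
    exact preimage_mem_comap hU
  obtain ⟨N, hN⟩ := cauchySeq_iff.1 hx _ h1
  exact ⟨N, fun m hm n hn => hN m hm n hn⟩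

/-- A Fréchet `*`-algebra containing `R` densely, with the topology of `R`, is the completion
of `R`. -/
theorem exists_completion_equiv {R : Type*} [UniformSpace R] [Ring R] [Algebra ℂ R] [StarRing R]
    [IsUniformAddGroup R] [IsTopologicalRing R] [ContinuousStar R] [UniformContinuousConstSMul ℂ R]
    {T : Type*} [Ring T] [Algebra ℂ T] [StarRing T] {τ : TopologicalSpace T}
    (hT : IsFrechetStarAlgebra T τ) (φ : R →⋆ₐ[ℂ] T) (hi : IsInducing φ) (hd : DenseRange φ) :
    ∃ Φ : Completion R ≃⋆ₐ[ℂ] T, (∀ x : R, Φ (x : Completion R) = φ x) ∧ Continuous Φ ∧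
      Continuous Φ.symm := by
  obtain ⟨p, hp⟩ := hT.countable_seminorms
  have := hp.topologicalAddGroup
  have := hp.continuousSMul
  letI : UniformSpace T := IsTopologicalAddGroup.rightUniformSpace T
  have : IsUniformAddGroup T := isUniformAddGroup_of_addCommGroup
  have := completeSpace_of_frechet hT
  have := hT.t2
  let pkg : AbstractCompletion R := ⟨T, φ, inferInstance, inferInstance, inferInstance,
    AddMonoidHom.isUniformInducing_of_isInducing hi, hd⟩
  let e : Completion R ≃ᵤ T := Completion.cPkg.compareEquiv pkg
  have he : ∀ x : R, e (x : Completion R) = φ x := fun x =>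
    AbstractCompletion.compare_coe Completion.cPkg pkg x
  have hec : Continuous e := e.continuous
  refine ⟨{ e.toEquiv with
      map_mul' := fun x y => ?_
      map_add' := fun x y => ?_
      map_star' := fun x => ?_
      map_smul' := fun z x => ?_ }, he, hec, e.symm.continuous⟩
  · change e (x * y) = e x * e y
    induction x, y using Completion.induction_on₂ with
    | hp => exact isClosed_eq (by fun_prop) (hT.continuous_mul.comp
        ((hec.comp continuous_fst).prodMk (hec.comp continuous_snd)))
    | ih x y => rw [← Completion.coe_mul, he, he, he, map_mul]
  · change e (x + y) = e x + e y
    induction x, y using Completion.induction_on₂ with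
    | hp => exact isClosed_eq (by fun_prop) (by fun_prop)
    | ih x y => rw [← Completion.coe_add, he, he, he, map_add]
  · change e (star x) = star (e x)
    induction x using Completion.induction_on with
    | hp => exact isClosed_eq (hec.comp continuous_star) (hT.continuous_star.comp hec)
    | ih x => rw [completion_star_coe, he, he, map_star]
  · change e (z • x) = z • e x
    induction x using Completion.induction_on with
    | hp => exact isClosed_eq (hec.comp (continuous_const_smul z)) (hec.const_smul z)
    | ih x => rw [← Completion.coe_smul, he, he, map_smul]

theorem exists_niceTensorProduct_equiv {S B T : Type*} [PreCStarAlgebra S] [PreCStarAlgebra B]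
    [PreCStarAlgebra T] {τ : TopologicalSpace T} (hT : IsNice T τ) (φ : NiceTensor S B →⋆ₐ[ℂ] T)
    (hi : @IsInducing _ _ inferInstance τ φ) (hd : @DenseRange _ τ _ φ) :
    ∃ Φ : NiceTensorProduct S B ≃⋆ₐ[ℂ] T, (∀ (a : S) (b : B), Φ (niceTmul a b) = φ (a ⊗ₜ[ℂ] b)) ∧
      Continuous[inferInstance, τ] Φ ∧ Continuous[τ, inferInstance] Φ.symm := by
  obtain ⟨Φ, h1, h2, h3⟩ := exists_completion_equiv (τ := τ) hT.frechet φ hi hd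
  exact ⟨Φ, fun a b => h1 (a ⊗ₜ[ℂ] b), h2, h3⟩

theorem isInducing_niceTensor {S B T ι : Type*} [PreCStarAlgebra S] [PreCStarAlgebra B]
    [PreCStarAlgebra T] {τ : TopologicalSpace T} {p : ι → Seminorm ℂ (NiceTensor S B)}
    {q : ι → Seminorm ℂ T} (hp : ∀ i, DominatedBy (p i) (niceSeminorm S B))
    (hp' : ∀ i, DominatedBy (niceSeminorm S B i) p) (hq : WithSeminorms (topology := τ) q)
    (φ : NiceTensor S B →ₗ[ℂ] T) (h : ∀ i x, p i x = q i (φ x)) :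
    @IsInducing _ _ inferInstance τ φ :=
  isInducing_of_withSeminorms (withSeminorms_of_dominated niceTensor_withSeminorms hp hp') hq φ h

end CompletionEquiv

section SmoothTensor

section MinCoe

variable {A B : Type*} [PreCStarAlgebra A] [PreCStarAlgebra B]

open UniformSpace

/-- The inclusion of the algebraic tensor product in the minimal tensor product. -/
def minCoe (A B : Type*) [PreCStarAlgebra A] [PreCStarAlgebra B] :
    PreTensor A B →⋆ₐ[ℂ] MinTensorProduct A B where
  toFun X := Completion.coe' (α := MinTensor A B) X
  map_one' := Completion.coe_one (MinTensor A B)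
  map_mul' X Y := Completion.coe_mul (α := MinTensor A B) X Y
  map_zero' := Completion.coe_zero (α := MinTensor A B)
  map_add' X Y := Completion.coe_add (α := MinTensor A B) X Y
  commutes' z := by
    rw [Algebra.algebraMap_eq_smul_one, Algebra.algebraMap_eq_smul_one]
    exact (Completion.coe_smul z (1 : MinTensor A B)).trans
      (congrArg (fun x : Completion (MinTensor A B) => z • x) (Completion.coe_one (MinTensor A B)))
  map_star' X := (completion_star_coe (R := MinTensor A B) X).symm

theorem norm_minCoe (X : PreTensor A B) : ‖minCoe A B X‖ = minNorm X :=
  Completion.norm_coe (E := MinTensor A B) X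

theorem dense_range_minCoe : Dense (range (minCoe A B)) :=
  Completion.denseRange_coe (α := MinTensor A B)

/-- The map `a ↦ a ⊗ b`. -/
def minTmulL (A : Type*) {B : Type*} [PreCStarAlgebra A] [PreCStarAlgebra B] (b : B) :
    A →L[ℂ] MinTensorProduct A B :=
  LinearMap.mkContinuous
    { toFun := fun a => minCoe A B (a ⊗ₜ[ℂ] b)
      map_add' := fun a a' => by rw [TensorProduct.add_tmul, map_add]
      map_smul' := fun z a => by
        rw [RingHom.id_apply, ← TensorProduct.smul_tmul', map_smul] }
    ‖b‖ fun a => by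
      change ‖minCoe A B (a ⊗ₜ[ℂ] b)‖ ≤ _
      rw [norm_minCoe, mul_comm]
      exact minNorm_tmul_le a b

theorem rTensor_star {S : Type*} [PreCStarAlgebra S] (φ : S →⋆ₐ[ℂ] A) (X : NiceTensor S B) :
    (φ : S →ₐ[ℂ] A).toLinearMap.rTensor B (star X : NiceTensor S B) =
      star ((φ : S →ₐ[ℂ] A).toLinearMap.rTensor B X) := by
  have h : ∀ X : PreTensor S B, (φ : S →ₐ[ℂ] A).toLinearMap.rTensor B (star X) =
      star ((φ : S →ₐ[ℂ] A).toLinearMap.rTensor B X) := fun X => by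
    induction X using PreTensor.induction with
    | zero => rw [star_zero, map_zero, star_zero]
    | tmul f b =>
      rw [TensorProduct.star_tmul, LinearMap.rTensor_tmul, LinearMap.rTensor_tmul,
        TensorProduct.star_tmul]
      congr 1
      exact map_star φ f
    | add X Y hX hY => rw [star_add, map_add, map_add, star_add, hX, hY]
  exact h X

theorem rTensor_mul {S : Type*} [PreCStarAlgebra S] (φ : S →⋆ₐ[ℂ] A) (X Y : NiceTensor S B) :
    (φ : S →ₐ[ℂ] A).toLinearMap.rTensor B (X * Y : NiceTensor S B) =
      (φ : S →ₐ[ℂ] A).toLinearMap.rTensor B X * (φ : S →ₐ[ℂ] A).toLinearMap.rTensor B Y :=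
  map_mul (Algebra.TensorProduct.map (φ : S →ₐ[ℂ] A) (AlgHom.id ℂ B)) X Y

theorem rTensor_one {S : Type*} [PreCStarAlgebra S] (φ : S →⋆ₐ[ℂ] A) :
    (φ : S →ₐ[ℂ] A).toLinearMap.rTensor B (1 : NiceTensor S B) = 1 :=
  map_one (Algebra.TensorProduct.map (φ : S →ₐ[ℂ] A) (AlgHom.id ℂ B))

end MinCoe

variable {E : Type*} [NormedAddCommGroup E] [NormedSpace ℝ E] [FiniteDimensional ℝ E]
  {H : Type*} [TopologicalSpace H]
  {I : ModelWithCorners ℝ E H} {M : Type*} [TopologicalSpace M] [ChartedSpace H M]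
  [IsManifold I ∞ M] [CompactSpace M] {Q : Type*} [CStarAlgebra Q] {B : Type*} [PreCStarAlgebra B]

theorem contMDiff_clm_comp {W : Type*} [CStarAlgebra W] (L : Q →L[ℂ] W) (f : SmoothAlg I M Q) :
    ContMDiff I 𝓘(ℝ, W) ∞ fun x => L (f x) :=
  ((L.restrictScalars ℝ).contDiff (n := ∞)).comp_contMDiff f.contMDiff

theorem contMDiff_minCoe_evalTensor (X : PreTensor (SmoothAlg I M Q) B) :
    ContMDiff I 𝓘(ℝ, MinTensorProduct Q B) ∞ fun x => minCoe Q B (evalTensor B x X) := by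
  induction X using PreTensor.induction with
  | zero => simp only [map_zero]; exact contMDiff_const
  | tmul f b => exact contMDiff_clm_comp (minTmulL Q b) f
  | add X Y hX hY => simp only [map_add]; exact hX.add hY

/-- The inclusion of `C^∞(M, Q) ⊗ B` in `C^∞(M, Q ⊗̂ B)`, as a linear map. -/
def smoothTensor (I : ModelWithCorners ℝ E H) (M : Type*) [TopologicalSpace M] [ChartedSpace H M]
    [IsManifold I ∞ M] [CompactSpace M] (Q B : Type*) [CStarAlgebra Q] [PreCStarAlgebra B] :
    PreTensor (SmoothAlg I M Q) B →ₗ[ℂ] SmoothAlg I M (MinTensorProduct Q B) where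
  toFun X := .mk (fun x => minCoe Q B (evalTensor B x X)) (contMDiff_minCoe_evalTensor X)
  map_add' X Y := SmoothAlg.ext fun x =>
    (congrArg (minCoe Q B) (map_add (evalTensor B x) X Y)).trans (map_add (minCoe Q B) _ _)
  map_smul' z X := SmoothAlg.ext fun x =>
    (congrArg (minCoe Q B) (map_smul (evalTensor B x) z X)).trans (map_smul (minCoe Q B) z _)

theorem smoothTensor_apply (X : PreTensor (SmoothAlg I M Q) B) (x : M) :
    smoothTensor I M Q B X x = minCoe Q B (evalTensor B x X) := rfl

/-- The inclusion of `C^∞(M, Q) ⊗ B` in `C^∞(M, Q ⊗̂ B)`, as a `*`-homomorphism. -/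
def smoothTensorHom (I : ModelWithCorners ℝ E H) (M : Type*) [TopologicalSpace M]
    [ChartedSpace H M] [IsManifold I ∞ M] [CompactSpace M] (Q B : Type*) [CStarAlgebra Q]
    [PreCStarAlgebra B] :
    NiceTensor (SmoothAlg I M Q) B →⋆ₐ[ℂ] SmoothAlg I M (MinTensorProduct Q B) where
  toFun X := smoothTensor I M Q B X
  map_one' := SmoothAlg.ext fun x =>
    (congrArg (minCoe Q B) (rTensor_one (SmoothAlg.eval x))).trans (map_one (minCoe Q B))
  map_mul' X Y := SmoothAlg.ext fun x =>
    (congrArg (minCoe Q B) (rTensor_mul (SmoothAlg.eval x) X Y)).trans (map_mul (minCoe Q B) _ _)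
  map_zero' := map_zero (smoothTensor I M Q B)
  map_add' := map_add (smoothTensor I M Q B)
  commutes' z := SmoothAlg.ext fun x => by
    have h1 : minCoe Q B ((evalTensor B x) (z • (1 : NiceTensor (SmoothAlg I M Q) B))) = z • 1 :=
      (congrArg (minCoe Q B) (map_smul (evalTensor B x) z _)).trans
        ((map_smul (minCoe Q B) z _).trans (congrArg (fun y => z • y)
          ((congrArg (minCoe Q B) (rTensor_one (SmoothAlg.eval x))).trans (map_one (minCoe Q B)))))
    rw [Algebra.algebraMap_eq_smul_one, Algebra.algebraMap_eq_smul_one]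
    exact h1
  map_star' X := SmoothAlg.ext fun x =>
    (congrArg (minCoe Q B) (rTensor_star (SmoothAlg.eval x) X)).trans (map_star (minCoe Q B) _)

theorem ChartField.deriv_clm_comp {W : Type*} [CStarAlgebra W] (V : ChartField I M) (L : Q →L[ℂ] W)
    (f : SmoothAlg I M Q) (x : M) : V.deriv (fun x => L (f x)) x = L (V.deriv f x) := by
  by_cases hx : x ∈ (extChartAt I V.c).source
  · rw [V.deriv_eq_of_source hx, V.deriv_eq_of_source hx]
    have h1 := ((L.restrictScalars ℝ).hasFDerivAt.comp_hasFDerivWithinAt _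
      (ChartField.differentiableWithinAt_loc f.contMDiff hx).hasFDerivWithinAt).fderivWithin
      (uniqueDiffOn_extChartAt_target V.c _ ((extChartAt I V.c).map_source hx))
    refine Eq.trans ?_ (map_smul (L.restrictScalars ℝ) _ _).symm
    congr 1
    exact congrArg (· V.e) h1
  · rw [V.deriv_eq_zero hx, V.deriv_eq_zero hx, map_zero]

theorem smoothTensor_lin (V : ChartField I M) (X : PreTensor (SmoothAlg I M Q) B) :
    smoothTensor I M Q B (derTensor B (V.lin Q) X) =
      V.lin (MinTensorProduct Q B) (smoothTensor I M Q B X) := by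
  induction X using PreTensor.induction with
  | zero => rw [map_zero, map_zero, map_zero]
  | tmul f b =>
    exact SmoothAlg.ext fun x => (V.deriv_clm_comp (minTmulL Q b) f x).symm
  | add X Y hX hY => rw [map_add, map_add, map_add, map_add, hX, hY]

theorem smoothTensor_iterDer (l : List (ChartField I M)) (X : PreTensor (SmoothAlg I M Q) B) :
    smoothTensor I M Q B (derTensor B (iterDer (l.map fun V => V.der Q)) X) =
      iterDer (l.map fun V => V.der (MinTensorProduct Q B)) (smoothTensor I M Q B X) := by
  induction l with
  | nil => exact congrArg (smoothTensor I M Q B) (derTensor_id X)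
  | cons V l ih =>
    rw [List.map_cons, List.map_cons, iterDer_cons, ← ih, ChartField.der_apply, ← smoothTensor_lin]
    exact congrArg (smoothTensor I M Q B) (derTensor_comp (V.lin Q) _ X)

variable [T2Space M]

theorem norm_smoothTensor (X : PreTensor (SmoothAlg I M Q) B) :
    ‖smoothTensor I M Q B X‖ = minNorm X := by
  refine le_antisymm (SmoothAlg.norm_le (minNorm_nonneg X) fun x => ?_)
    (minNorm_le_of_evalTensor_le (norm_nonneg _) fun x => ?_)
  · rw [smoothTensor_apply, norm_minCoe]
    exact minNorm_evalTensor_le x X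
  · rw [← norm_minCoe]
    exact SmoothAlg.norm_apply_le (smoothTensor I M Q B X) x

theorem tensorFieldSem_eq (l : List (ChartField I M)) (X : PreTensor (SmoothAlg I M Q) B) :
    tensorFieldSem I M Q B l X =
      fieldSem I M (MinTensorProduct Q B) l (smoothTensor I M Q B X) := by
  rw [tensorFieldSem_apply, ← norm_smoothTensor, smoothTensor_iterDer]
  rfl

theorem smulVec_minCoe_mem {f : M → ℝ} (hf : ContMDiff I 𝓘(ℝ, ℝ) ∞ f) (Y : PreTensor Q B) :
    ∃ X, smoothTensor I M Q B X = smulVec hf (MinTensorProduct Q B) (minCoe Q B Y) := by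
  induction Y using PreTensor.induction with
  | zero => exact ⟨0, by rw [map_zero, map_zero, map_zero]⟩
  | tmul a b =>
    refine ⟨smulVec hf Q a ⊗ₜ[ℂ] b, SmoothAlg.ext fun x => ?_⟩
    exact map_smul ((minTmulL Q b).restrictScalars ℝ) (f x) a
  | add Y Z hY hZ =>
    obtain ⟨X, hX⟩ := hY
    obtain ⟨X', hX'⟩ := hZ
    exact ⟨X + X', by rw [map_add, map_add, map_add, hX, hX']⟩

/-- The image of `C^∞(M, Q) ⊗ B` is dense in `C^∞(M, Q ⊗̂ B)`. -/
theorem approxBy_range_smoothTensor (F : SmoothAlg I M (MinTensorProduct Q B)) :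
    ApproxBy (LinearMap.range (smoothTensor I M Q B)) (coverSem I M (MinTensorProduct Q B)) F := by
  refine approxBy_of_smulVec_mem (dense_range_minCoe (A := Q) (B := B)) ?_ F
  rintro f hf _ ⟨Y, rfl⟩
  exact smulVec_minCoe_mem hf Y

end SmoothTensor

section SmoothEquiv

variable {E : Type*} [NormedAddCommGroup E] [NormedSpace ℝ E] [FiniteDimensional ℝ E]
  {H : Type*} [TopologicalSpace H]
  (I : ModelWithCorners ℝ E H) (M : Type*) [TopologicalSpace M] [ChartedSpace H M]
  [IsManifold I ∞ M] [CompactSpace M] [T2Space M] (Q B : Type*) [CStarAlgebra Q]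

theorem fieldSem_dominatedBy_coverSem (l : List (ChartField I M)) :
    DominatedBy (fieldSem I M Q l) (coverSem I M Q) := by
  unfold fieldSem
  exact derSeminorm_dominatedBy_coverSem _

theorem fieldSem_withSeminorms :
    WithSeminorms (topology := smoothAlgTopology I M Q) (fieldSem I M Q) :=
  withSeminorms_of_dominated (coverSem_withSeminorms I M Q) (fieldSem_dominatedBy_coverSem I M Q)
    coverSem_dominatedBy_fieldSem

variable [CStarAlgebra B]

/-- `C^∞(M, Q) ⊗̂ B` is isomorphic to `C^∞(M, Q ⊗̂ B)`. -/
theorem exists_smoothAlg_equiv :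
    ∃ Φ : NiceTensorProduct (SmoothAlg I M Q) B ≃⋆ₐ[ℂ] SmoothAlg I M (MinTensorProduct Q B),
      (∀ (F : SmoothAlg I M Q) (b : B) (m : M), Φ (niceTmul F b) m = minTmul (F m) b) ∧
      Continuous[inferInstance, smoothAlgTopology I M (MinTensorProduct Q B)] Φ ∧
      Continuous[smoothAlgTopology I M (MinTensorProduct Q B), inferInstance] Φ.symm := by
  have hi : @IsInducing _ _ inferInstance (smoothAlgTopology I M (MinTensorProduct Q B))
      (smoothTensorHom I M Q B) :=
    isInducing_niceTensor tensorFieldSem_dominatedBy_tensorSeminorm tensorSeminorm_dominatedBy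
      (fieldSem_withSeminorms I M (MinTensorProduct Q B)) (smoothTensor I M Q B) tensorFieldSem_eq
  have hd : @DenseRange _ (smoothAlgTopology I M (MinTensorProduct Q B)) _
      (smoothTensorHom I M Q B) :=
    @dense_of_approxBy _ _ _ _ (smoothAlgTopology I M (MinTensorProduct Q B)) _
      (coverSem_withSeminorms I M (MinTensorProduct Q B)) _ approxBy_range_smoothTensor
  obtain ⟨Φ, h1, h2, h3⟩ := exists_niceTensorProduct_equiv
    (isNice_smoothAlg I M (MinTensorProduct Q B)) (smoothTensorHom I M Q B) hi hd
  exact ⟨Φ, fun F b m => congrArg (fun G : SmoothAlg I M (MinTensorProduct Q B) => G m)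
    (h1 F b), h2, h3⟩

end SmoothEquiv

end NiceAlg

end

open NiceAlg
open scoped Manifold ContDiff

theorem mainTheorem6
    {E : Type*} [NormedAddCommGroup E] [NormedSpace ℝ E] [FiniteDimensional ℝ E]
    {H : Type*} [TopologicalSpace H] (I : ModelWithCorners ℝ E H)
    (M : Type*) [TopologicalSpace M] [ChartedSpace H M] [IsManifold I ∞ M]
    [CompactSpace M] [T2Space M]
    (A B : Type*) [CStarAlgebra A] [CStarAlgebra B] :
    -- `C^∞(M, A)` and `C^∞(M, A ⊗̂ B)`, with their usual topologies, are nice algebras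
    IsNice (SmoothMaps I M A) (smoothTopology I M A) ∧
    IsNice (SmoothMaps I M (MinTensorProduct A B)) (smoothTopology I M (MinTensorProduct A B)) ∧
    -- `C^∞(M, A) ⊗̂ B` is isomorphic to `C^∞(M, A ⊗̂ B)`, by the map `F ⊗ b ↦ (m ↦ F m ⊗ b)`
    (∃ Φ : NiceTensorProduct (SmoothMaps I M A) B ≃⋆ₐ[ℂ] SmoothMaps I M (MinTensorProduct A B),
      (∀ (F : SmoothMaps I M A) (b : B) (m : M),
        (Φ (niceTmul F b) : C(M, MinTensorProduct A B)) m = minTmul ((F : C(M, A)) m) b) ∧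
      Continuous[inferInstance, smoothTopology I M (MinTensorProduct A B)] Φ ∧
      Continuous[smoothTopology I M (MinTensorProduct A B), inferInstance] Φ.symm) ∧
    -- continuous functions all of whose scalar slices are smooth are smooth
    (∀ f : C(M, B), (∀ φ : B →L[ℂ] ℂ, ContMDiff I 𝓘(ℝ, ℂ) ∞ fun m => φ (f m)) →
      f ∈ SmoothMaps I M B) ∧
    (∀ F : C(M, MinTensorProduct A B),
      (∀ φ : MinTensorProduct A B →L[ℂ] ℂ, ContMDiff I 𝓘(ℝ, ℂ) ∞ fun m => φ (F m)) →
      F ∈ SmoothMaps I M (MinTensorProduct A B)) := by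
  refine ⟨isNice_smoothMaps I M A, isNice_smoothMaps I M (MinTensorProduct A B), ?_,
    fun f hf => contMDiff_of_weak hf, fun F hF => contMDiff_of_weak hF⟩
  exact exists_smoothAlg_equiv I M A B
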